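/- **Setting.** Consider a game with $N\ge 1$ players, finite non-empty action sets $\mathcal A_1,\dots,\mathcal A_N$, $\mathcal A=\prod_i\mathcal A_i$, and utilities $u_i:\mathcal A\to[0,1]$. Let $A=\max_i|\mathcal A_i|$ and $\varepsilon,\Delta\in(0,1]$, $\delta\in(0,1)$. In each play the players choose a joint action $a\in\mathcal A$ (each drawing independently from its current mixed strategy, given the past), and each player $j$ observes a random payoff in $[0,1]$ whose conditional mean, given the past and $a$, is $u_j(a)$. One play is one sample. Let $E_0=\emptyset$, and let $E_{l}$ be the set of actions $a\in\mathcal A_i$, $i\in[N]$, for which there is a mixed strategy $x\in\Delta(\mathcal A_i)$ with $u_i(a,a_{-i})\le u_i(x,a_{-i})-\Delta$ for all $a_{-i}$ that contain no action of $E_{l-1}$. Let $L=\inf\{l\ge 0:E_{l+1}=E_l\}$. An action is $\Delta$-rationalizable if it is not in $E_L$. A distribution $\Pi$ on $\mathcal A$ is an $\varepsilon$-CE if $\mathbb E_{a\sim\Pi}[u_i(a)]\ge\mathbb E_{a\sim\Pi}[u_i(\phi(a_i),a_{-i})]-\varepsilon$ for all $i$ and all $\phi:\mathcal A_i\to\mathcal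 A_i$; it is a $\Delta$-rationalizable $\varepsilon$-CE if moreover every joint action in its support consists of $\Delta$-rationalizable actions. **Algorithm.** Put $p=\min\{\varepsilon,\Delta\}/(8AN)$. 1. (Iterative best response.) Start from an arbitrary $a^{(0)}\in\mathcal A$. For $l=1,\dots,L$: for every $i$ and every $a\in\mathcal A_i$ play $(a,a^{(l-1)}_{-i})$ for $\lceil 64\ln(LNA/\delta)/\Delta^2\rceil$ times, and let $a^{(l)}_i$ be an action with the largest average payoff of player $i$. Put $a^\star=a^{(L)}$. 2. Put $\theta_i^{(1)}(a)=(1-|\mathcal A_i|p)\mathbf 1[a=a_i^\star]+p$. 3. For $t=1,\dots,T$ and every player $i$: for every $a\in\mathcal A_i$ play $(a,\theta_{-i}^{(t)})$ for $$M_i^{(t)}=\Big\lceil\max_a\frac{64\ln(ANT/\delta)\,\theta_i^{(t)}(a)}{\Delta^2\sum_{\tau=1}^t\theta_i^{(\tau)}(a)}\Big\rceil$$ times, and let $u_i^{(t)}(a)$ be player $i$'s average payoff; for every $b\in\mathcal A_i$ let $$\hat\theta_i^{(t+1)}(\cdot|b)\propto\exp\Big(\eta_{t,i}^b\sum_{\tau=1}^tu_i^{(\tau)}(\cdot)\theta_i^{(\tau)}(b)\Big),\qquad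 \eta_{t,i}^b=\max\Big\{\frac{2\ln(1/p)}{\Delta\sum_{\tau=1}^t\theta_i^{(\tau)}(b)},\sqrt{\frac{A\ln A}{t}}\Big\};$$ let $\theta_i^{(t+1)}\in\Delta(\mathcal A_i)$ satisfy $\theta_i^{(t+1)}(a)=\sum_b\hat\theta_i^{(t+1)}(a|b)\,\theta_i^{(t+1)}(b)$ for all $a$. 4. Remove from each $\theta_i^{(t)}$ all actions of probability at most $p$, renormalize to $\bar\theta_i^{(t)}$, and output $\frac1T\sum_{t=1}^T\bigotimes_{i=1}^N\bar\theta_i^{(t)}$. **Theorem.** There are universal constants $C_1,C_2>0$ and $\kappa_1,\kappa_2\in\mathbb N$ such that, with $\Lambda=1+\ln\frac{NA}{\varepsilon\Delta\delta}$, for every such game and all such $\varepsilon,\Delta,\delta$, the algorithm run with $$T=\Big\lceil C_1\Big(\frac{A}{\varepsilon^2}+\frac{A}{\Delta^2}\Big)\Lambda^{\kappa_1}\Big\rceil=\tilde O\Big(\frac A{\varepsilon^2}+\frac A{\Delta^2}\Big)$$ outputs, with probability at least $1-3\delta$, a $\Delta$-rationalizable $\varepsilon$-CE, and the total number of samples it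 uses (in steps 1 and 3) is always at most $$C_2\Big(\frac{LNA}{\Delta^2}+\frac{NA^2}{\min\{\varepsilon^2,\Delta^2\}}\Big)\Lambda^{\kappa_2}=\tilde O\Big(\frac{LNA}{\Delta^2}+\frac{NA^2}{\min\{\varepsilon^2,\Delta^2\}}\Big).$$ -/

import Mathlib

open MeasureTheory

noncomputable section

namespace RatCE

/-! ### Games, dominance elimination, correlated equilibria

Player `i : Fin N` has the action set `Fin (k i)`; `u i x` is the utility of player `i` at the
action profile `x`. -/

/-- Joint (pure) action profiles. -/
abbrev Profile {N : ℕ} (k : Fin N → ℕ) : Type := (i : Fin N) → Fin (k i)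

/-- One vector of weights for each player (a mixed strategy profile when each is in the simplex). -/
abbrev Weights {N : ℕ} (k : Fin N → ℕ) : Type := (i : Fin N) → Fin (k i) → ℝ

/-- The maximal number of actions of a player. -/
def maxActions {N : ℕ} (k : Fin N → ℕ) : ℕ := Finset.univ.sup k

/-- `elim u Δ l i` is the set of actions of player `i` eliminated within `l` rounds of iterated
elimination of actions that are `Δ`-dominated by a mixed strategy. The opponents' actions are the
coordinates `j ≠ i` of the profile `y`. -/
def elim {N : ℕ} {k : Fin N → ℕ} (u : Fin N → Profile k → ℝ) (Δ : ℝ) :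
    ℕ → (i : Fin N) → Set (Fin (k i))
  | 0 => fun _ => ∅
  | l + 1 => fun i => {a | ∃ x ∈ stdSimplex ℝ (Fin (k i)),
      ∀ y : Profile k, (∀ j, j ≠ i → y j ∉ elim u Δ l j) →
        u i (Function.update y i a) ≤ (∑ c, x c * u i (Function.update y i c)) - Δ}

/-- The minimum elimination length `L`. -/
def elimLength {N : ℕ} {k : Fin N → ℕ} (u : Fin N → Profile k → ℝ) (Δ : ℝ) : ℕ :=
  sInf {l | elim u Δ (l + 1) = elim u Δ l}

/-- Action `a` of player `i` is `Δ`-rationalizable. -/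
def Rationalizable {N : ℕ} {k : Fin N → ℕ} (u : Fin N → Profile k → ℝ) (Δ : ℝ)
    (i : Fin N) (a : Fin (k i)) : Prop :=
  a ∉ elim u Δ (elimLength u Δ) i

/-- `D` is a distribution on action profiles and an `ε`-correlated equilibrium. -/
def IsApproxCE {N : ℕ} {k : Fin N → ℕ} (u : Fin N → Profile k → ℝ) (ε : ℝ)
    (D : Profile k → ℝ) : Prop :=
  D ∈ stdSimplex ℝ (Profile k) ∧
    ∀ (i : Fin N) (φ : Fin (k i) → Fin (k i)),
      (∑ x, D x * u i (Function.update x i (φ (x i)))) - ε ≤ ∑ x, D x * u i x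

/-- A `Δ`-rationalizable `ε`-CE: an `ε`-CE that only plays `Δ`-rationalizable actions. -/
def IsRationalizableCE {N : ℕ} {k : Fin N → ℕ} (u : Fin N → Profile k → ℝ) (ε Δ : ℝ)
    (D : Profile k → ℝ) : Prop :=
  IsApproxCE u ε D ∧ ∀ x, D x ≠ 0 → ∀ i, Rationalizable u Δ i (x i)

/-! ### Bandit feedback with players exploring in turn

The interaction consists of rounds `r = 0, 1, …`. In round `r`, for each player `i` in turn and for
each action `a` of player `i` in turn, the joint strategy "`i` plays `a`, every other player `j`
draws an action from `strat r j`" is played `batch r i` times. A play is labelled by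
`(r, i, a, m)` with `m < batch r i`, and plays happen in the lexicographic order of their labels.
Labels with `batch r i ≤ m` are not played: nothing is assumed about their outcomes except that
they are adapted and take values in the right sets, and the algorithm does not read them. -/

/-- Labels of plays, in lexicographic order. -/
abbrev Slot : Type := ℕ ×ₗ (ℕ ×ₗ (ℕ ×ₗ ℕ))

/-- The label of the `m`-th play, in round `r`, of action `a` by the exploring player `i`. -/
def slot (r i a m : ℕ) : Slot := toLex (r, toLex (i, toLex (a, m)))

/-- The random objects of an interaction on a sample space `Ω`. -/
structure Interaction {N : ℕ} (k : Fin N → ℕ) (Ω : Type*) [mΩ : MeasurableSpace Ω] where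
  /-- `hist s` is the information available just before the play with label `s`. -/
  hist : Filtration Slot mΩ
  /-- The mixed strategies in force in round `r`. -/
  strat : ℕ → Ω → Weights k
  /-- The number of repetitions, in round `r`, for each action of the exploring player. -/
  batch : ℕ → Ω → Fin N → ℕ
  /-- The joint action realized in a play. -/
  act : Slot → Ω → Profile k
  /-- The payoffs observed by the players in a play. -/
  fb : Slot → Ω → Fin N → ℝ

namespace Interaction

variable {N : ℕ} {k : Fin N → ℕ} {Ω : Type*} [mΩ : MeasurableSpace Ω]

/-- Player `i`'s average payoff over the plays of action `a` in round `r`. -/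
def avg (I : Interaction k Ω) (r : ℕ) (ω : Ω) (i : Fin N) (a : Fin (k i)) : ℝ :=
  (∑ m ∈ Finset.range (I.batch r ω i), I.fb (slot r i a m) ω i) / I.batch r ω i

/-- The total number of plays (samples) in the first `R` rounds. -/
def samples (I : Interaction k Ω) (R : ℕ) (ω : Ω) : ℕ :=
  ∑ r ∈ Finset.range R, ∑ i, k i * I.batch r ω i

/-- The first `R` rounds are an interaction with the game `u` under bandit feedback: strategies and
repetition numbers are decided at the beginning of the round; given the past, the players draw their
actions independently from their strategies; given the past and the realized joint action, the
feedback is `[0,1]`-valued with mean the utility at that joint action. -/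
structure IsBandit (I : Interaction k Ω) (u : Fin N → Profile k → ℝ) (μ : Measure Ω) (R : ℕ) :
    Prop where
  strat_meas : ∀ r < R, ∀ i a, Measurable[I.hist (slot r 0 0 0)] fun ω => I.strat r ω i a
  batch_meas : ∀ r < R, ∀ i, Measurable[I.hist (slot r 0 0 0)] fun ω => I.batch r ω i
  act_meas : ∀ s s', s < s' → Measurable[I.hist s'] (I.act s)
  fb_meas : ∀ s s', s < s' → Measurable[I.hist s'] (I.fb s)
  fb_mem : ∀ s ω j, I.fb s ω j ∈ Set.Icc (0 : ℝ) 1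
  act_law : ∀ r < R, ∀ (i : Fin N) (a : Fin (k i)) (m : ℕ) (x : Profile k),
    ∀ᵐ ω ∂μ, m < I.batch r ω i →
      (μ[(I.act (slot r i a m) ⁻¹' {x}).indicator (fun _ => (1 : ℝ)) | I.hist (slot r i a m)]) ω =
        (if x i = a then 1 else 0) * ∏ j ∈ Finset.univ.erase i, I.strat r ω j (x j)
  fb_mean : ∀ r < R, ∀ (i : Fin N) (a : Fin (k i)) (m : ℕ) (j : Fin N),
    ∀ᵐ ω ∂μ, m < I.batch r ω i →
      (μ[fun ω' => I.fb (slot r i a m) ω' j |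
        I.hist (slot r i a m) ⊔ MeasurableSpace.comap (I.act (slot r i a m)) inferInstance]) ω =
        u j (I.act (slot r i a m) ω)

end Interaction

/-! ### The algorithm -/

/-- The threshold `p = min{ε, Δ} / (8 A N)`. -/
def thr {N : ℕ} (k : Fin N → ℕ) (ε Δ : ℝ) : ℝ := min ε Δ / (8 * maxActions k * N)

/-- The exponential-weights distribution `∝ exp (η * U ·)`. -/
def softmax {n : ℕ} (η : ℝ) (U : Fin n → ℝ) (a : Fin n) : ℝ :=
  Real.exp (η * U a) / ∑ c, Real.exp (η * U c)

/-- Remove the actions of weight at most `p` and renormalize. -/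
def clip {n : ℕ} (p : ℝ) (x : Fin n → ℝ) (a : Fin n) : ℝ :=
  if x a ≤ p then 0 else x a / ∑ c, if x c ≤ p then 0 else x c

/-- The number of repetitions in the iterative best response phase. -/
def ibrBatch {N : ℕ} {k : Fin N → ℕ} (u : Fin N → Profile k → ℝ) (Δ δ : ℝ) : ℕ :=
  ⌈64 * Real.log (elimLength u Δ * N * maxActions k / δ) / Δ ^ 2⌉₊

/-- The cumulative weight `∑_{τ=1}^{t+1} θ_i^{(τ)}(a)`, where `θ τ` stands for `θ^{(τ+1)}`. -/
def cumWeight {N : ℕ} {k : Fin N → ℕ} (θ : ℕ → Weights k) (t : ℕ) (i : Fin N) (a : Fin (k i)) : ℝ :=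
  ∑ τ ∈ Finset.range (t + 1), θ τ i a

/-- The adaptive minibatch size `M_i^{(t+1)}`. -/
def ceBatch {N : ℕ} {k : Fin N → ℕ} (Δ δ : ℝ) (T : ℕ) (θ : ℕ → Weights k) (t : ℕ) (i : Fin N) : ℕ :=
  ⌈⨆ a : Fin (k i), 64 * Real.log (maxActions k * N * T / δ) * θ t i a /
    (Δ ^ 2 * cumWeight θ t i a)⌉₊

/-- The adaptive learning rate `η_{t+1,i}^b` of expert `b`. -/
def ceRate {N : ℕ} {k : Fin N → ℕ} (ε Δ : ℝ) (θ : ℕ → Weights k) (t : ℕ) (i : Fin N)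
    (b : Fin (k i)) : ℝ :=
  max (2 * Real.log (1 / thr k ε Δ) / (Δ * cumWeight θ t i b))
    (Real.sqrt (maxActions k * Real.log (maxActions k) / (t + 1 : ℕ)))

/-- The interaction `I` is a run of the algorithm with `T` rounds. Rounds `r < L` are the iterative
best response phase, with joint actions `br 0, br 1, …, br L` (the first is arbitrary, and ties
between best responses are broken arbitrarily); round `L + t` with `t < T` is round `t + 1` of
adaptive Hedge, whose strategies are `θ t = I.strat (L + t)`. -/
structure IsAdaptiveHedgeRun {N : ℕ} {k : Fin N → ℕ} {Ω : Type*} [MeasurableSpace Ω]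
    (u : Fin N → Profile k → ℝ) (ε Δ δ : ℝ) (T : ℕ)
    (I : Interaction k Ω) (br : ℕ → Ω → Profile k) : Prop where
  ibr_strat : ∀ r < elimLength u Δ, ∀ ω i, I.strat r ω i = Pi.single (br r ω i) 1
  ibr_batch : ∀ r < elimLength u Δ, ∀ ω i, I.batch r ω i = ibrBatch u Δ δ
  ibr_best : ∀ r < elimLength u Δ, ∀ ω i a, I.avg r ω i a ≤ I.avg r ω i (br (r + 1) ω i)
  init : ∀ ω i a, I.strat (elimLength u Δ) ω i a =
    (1 - k i * thr k ε Δ) * (if a = br (elimLength u Δ) ω i then 1 else 0) + thr k ε Δ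
  ce_batch : ∀ t < T, ∀ ω i, I.batch (elimLength u Δ + t) ω i =
    ceBatch Δ δ T (fun τ => I.strat (elimLength u Δ + τ) ω) t i
  ce_simplex : ∀ t, t + 1 < T → ∀ ω i,
    I.strat (elimLength u Δ + (t + 1)) ω i ∈ stdSimplex ℝ (Fin (k i))
  ce_fixed : ∀ t, t + 1 < T → ∀ ω i a,
    I.strat (elimLength u Δ + (t + 1)) ω i a =
      ∑ b, softmax (ceRate ε Δ (fun τ => I.strat (elimLength u Δ + τ) ω) t i b)
          (fun c => ∑ τ ∈ Finset.range (t + 1),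
            I.avg (elimLength u Δ + τ) ω i c * I.strat (elimLength u Δ + τ) ω i b) a *
        I.strat (elimLength u Δ + (t + 1)) ω i b

/-- The output `(∑_t ⊗_i clip (θ_i^{(t)})) / T`. -/
def ceOutput {N : ℕ} {k : Fin N → ℕ} (p : ℝ) (T : ℕ) (θ : ℕ → Weights k) (x : Profile k) : ℝ :=
  (∑ t ∈ Finset.range T, ∏ i, clip p (θ t i) (x i)) / T

/-- The logarithmic factor suppressed by `Õ`, at least `1` when `N, A ≥ 1` and
`ε, Δ, δ ≤ 1`. -/
def logFactor {N : ℕ} (k : Fin N → ℕ) (ε Δ δ : ℝ) : ℝ :=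
  1 + Real.log (N * maxActions k / (ε * Δ * δ))

/-- The number of rounds `T = ⌈C (A/ε² + A/Δ²) logFactor ^ κ⌉`. -/
def ceRounds {N : ℕ} (C : ℝ) (κ : ℕ) (k : Fin N → ℕ) (ε Δ δ : ℝ) : ℕ :=
  ⌈C * (maxActions k / ε ^ 2 + maxActions k / Δ ^ 2) * logFactor k ε Δ δ ^ κ⌉₊

end RatCE

end

open MeasureTheory RatCE

/-!
Every action eliminated in round `l` loses at least `Δ` to a fixed mixed strategy against opponents
who avoid the actions eliminated before. By Hoeffding's inequality the average payoffs of iterative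
best response reveal this gap, so `L` iterations reach a profile of rationalizable actions, around
which adaptive Hedge starts.

In adaptive Hedge every eliminated action keeps probability at most `p`, by induction on the rounds.
As long as this holds, the gains of the expert of an action `b` favour the dominating strategy of an
eliminated action by a constant multiple of `Δ` times the cumulative weight of `b`, and the learning
rate, at least `2 log (1 / p) / Δ` over that weight, turns this gap into a probability at most `p`,
which the stationarity of the strategies passes on from the experts. The cumulative weight is
random, so the concentration of the gains is a union bound over a geometric grid of slopes in an
exponential supermartingale, the batch sizes keeping its variance small relative to that weight.

The regrets of the experts add up to the swap regret, because the strategies are stationary. The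
first term in the learning rates costs only a logarithmic factor, since the ratios of the weight
added in a round to the cumulative weight are bounded by increments of a logarithm, which telescope.
The same telescoping bounds the number of samples. Removing the actions of probability at most `p`
changes every payoff by a small fraction of `ε`.
-/

namespace RatCE

/-! ### Product distributions -/

theorem update_single_mem_stdSimplex {ι : Type*} [DecidableEq ι] {α : ι → Type*}
    [∀ i, Fintype (α i)] [∀ i, DecidableEq (α i)] {θ : ∀ i, α i → ℝ}
    (hθ : ∀ i, θ i ∈ stdSimplex ℝ (α i)) (i : ι) (a : α i) (j : ι) :
    Function.update θ i (Pi.single a 1) j ∈ stdSimplex ℝ (α j) := by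
  obtain rfl | hj := eq_or_ne j i
  · simpa using single_mem_stdSimplex ℝ a
  · simpa [hj] using hθ j

section ProductDistributions

variable {ι : Type*} [Fintype ι] {α : ι → Type*} [∀ i, Fintype (α i)]
  {θ : ∀ i, α i → ℝ}

theorem sum_indicator_le_sum_card_mul {p : ℝ} (hp : 0 ≤ p) {bad : ∀ i, Set (α i)}
    (hbad : ∀ i, ∀ a ∈ bad i, θ i a ≤ p) :
    ∑ i, ∑ a, (bad i).indicator (θ i) a ≤ (∑ i, Fintype.card (α i) : ℕ) * p := by
  rw [Nat.cast_sum, Finset.sum_mul]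
  refine Finset.sum_le_sum fun i _ => (Finset.sum_le_card_nsmul _ _ p fun a _ => ?_).trans ?_
  · exact Set.indicator_apply_le' (hbad i a) fun _ => hp
  · simp

variable [DecidableEq ι]

/-- `jointMean θ f` is the mean of `f` when every player `i` draws an action independently from
the weights `θ i`. -/
def jointMean (θ : ∀ i, α i → ℝ) : ((∀ i, α i) → ℝ) →ₗ[ℝ] ℝ :=
  ∑ x, (∏ i, θ i (x i)) • LinearMap.proj x

theorem jointMean_apply (θ : ∀ i, α i → ℝ) (f : (∀ i, α i) → ℝ) :
    jointMean θ f = ∑ x, (∏ i, θ i (x i)) * f x := by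
  simp [jointMean]

theorem jointMean_mono (hθ : ∀ i, 0 ≤ θ i) {f g : (∀ i, α i) → ℝ} (hfg : f ≤ g) :
    jointMean θ f ≤ jointMean θ g := by
  simp only [jointMean_apply]
  exact Finset.sum_le_sum fun x _ =>
    mul_le_mul_of_nonneg_left (hfg x) (Finset.prod_nonneg fun i _ => hθ i (x i))

theorem sum_prod_eq_prod_sum (θ : ∀ i, α i → ℝ) :
    ∑ x : ∀ i, α i, ∏ i, θ i (x i) = ∏ i, ∑ a, θ i a := by
  rw [Finset.prod_univ_sum, Fintype.piFinset_univ]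

theorem sum_prod_eq_one (hθ : ∀ i, ∑ a, θ i a = 1) : ∑ x : ∀ i, α i, ∏ i, θ i (x i) = 1 := by
  rw [sum_prod_eq_prod_sum, Finset.prod_eq_one fun i _ => hθ i]

theorem jointMean_const (hθ : ∀ i, ∑ a, θ i a = 1) (r : ℝ) : jointMean θ (fun _ => r) = r := by
  rw [jointMean_apply, ← Finset.sum_mul, sum_prod_eq_one hθ, one_mul]

section Deviation

variable [∀ i, DecidableEq (α i)]

/-- `deviationMean θ i a f` is the mean of `f` when player `i` plays `a` and every other player `j`
draws an action independently from the weights `θ j`. -/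
def deviationMean (θ : ∀ i, α i → ℝ) (i : ι) (a : α i) : ((∀ i, α i) → ℝ) →ₗ[ℝ] ℝ :=
  jointMean (Function.update θ i (Pi.single a 1))

theorem deviationMean_apply (θ : ∀ i, α i → ℝ) (i : ι) (a : α i) (f : (∀ i, α i) → ℝ) :
    deviationMean θ i a f =
      ∑ x, ((if x i = a then 1 else 0) * ∏ j ∈ Finset.univ.erase i, θ j (x j)) * f x := by
  rw [deviationMean, jointMean_apply]
  refine Finset.sum_congr rfl fun x _ => ?_
  rw [← Finset.mul_prod_erase _ _ (Finset.mem_univ i), Function.update_self, Pi.single_apply]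
  congr 2
  exact Finset.prod_congr rfl fun j hj => by
    rw [Function.update_of_ne (Finset.ne_of_mem_erase hj)]

theorem deviationMean_eq_sum_filter (θ : ∀ i, α i → ℝ) (i : ι) (a : α i) (f : (∀ i, α i) → ℝ) :
    deviationMean θ i a f =
      ∑ x with x i = a, (∏ j ∈ Finset.univ.erase i, θ j (x j)) * f x := by
  simp only [deviationMean_apply, Finset.sum_filter, ite_mul, one_mul, zero_mul]

theorem deviationMean_congr (θ : ∀ i, α i → ℝ) {i : ι} {a : α i} {f g : (∀ i, α i) → ℝ}
    (h : ∀ x, x i = a → f x = g x) : deviationMean θ i a f = deviationMean θ i a g := by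
  simp only [deviationMean_eq_sum_filter]
  exact Finset.sum_congr rfl fun x hx => by rw [h x (Finset.mem_filter.1 hx).2]

theorem deviationMean_comp_update (θ : ∀ i, α i → ℝ) (i : ι) (a b : α i)
    (f : (∀ i, α i) → ℝ) :
    deviationMean θ i a (fun x => f (Function.update x i b)) = deviationMean θ i b f := by
  simp only [deviationMean_eq_sum_filter]
  refine Finset.sum_nbij' (Function.update · i b) (Function.update · i a)
    (by simp) (by simp) ?_ ?_ fun x _ => ?_
  · rintro x hx
    simp [← (Finset.mem_filter.1 hx).2]
  · rintro x hx
    simp [← (Finset.mem_filter.1 hx).2]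
  · congr 1
    exact Finset.prod_congr rfl fun j hj => by
      rw [Function.update_of_ne (Finset.ne_of_mem_erase hj)]

theorem jointMean_eq_sum_deviationMean (θ : ∀ i, α i → ℝ) (i : ι) (f : (∀ i, α i) → ℝ) :
    jointMean θ f = ∑ a, θ i a * deviationMean θ i a f := by
  simp only [jointMean_apply, deviationMean_apply, Finset.mul_sum]
  rw [Finset.sum_comm]
  refine Finset.sum_congr rfl fun x _ => ?_
  rw [Finset.sum_eq_single (x i) (fun a _ ha => by simp [ha.symm]) (by simp),
    ← Finset.mul_prod_erase _ (fun j => θ j (x j)) (Finset.mem_univ i), if_pos rfl]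
  ring

theorem jointMean_comp_update (θ : ∀ i, α i → ℝ) (i : ι) (φ : α i → α i)
    (f : (∀ i, α i) → ℝ) :
    jointMean θ (fun x => f (Function.update x i (φ (x i)))) =
      ∑ a, θ i a * deviationMean θ i (φ a) f := by
  rw [jointMean_eq_sum_deviationMean θ i]
  refine Finset.sum_congr rfl fun a _ => ?_
  rw [← deviationMean_comp_update θ i a (φ a) f]
  exact congrArg _ (deviationMean_congr θ fun x hx => by rw [hx])

theorem deviationMean_mono (hθ : ∀ i, θ i ∈ stdSimplex ℝ (α i)) (i : ι) (a : α i)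
    {f g : (∀ i, α i) → ℝ} (hfg : f ≤ g) :
    deviationMean θ i a f ≤ deviationMean θ i a g :=
  jointMean_mono (fun j => (update_single_mem_stdSimplex hθ i a j).1) hfg

theorem deviationMean_const (hθ : ∀ i, θ i ∈ stdSimplex ℝ (α i)) (i : ι) (a : α i)
    (r : ℝ) : deviationMean θ i a (fun _ => r) = r :=
  jointMean_const (fun j => (update_single_mem_stdSimplex hθ i a j).2) r

theorem deviationMean_mem_Icc (hθ : ∀ i, θ i ∈ stdSimplex ℝ (α i)) (i : ι) (a : α i)
    {f : (∀ i, α i) → ℝ} {m M : ℝ}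
    (hf : ∀ x, f x ∈ Set.Icc m M) : deviationMean θ i a f ∈ Set.Icc m M :=
  ⟨(deviationMean_const hθ i a m).ge.trans (deviationMean_mono hθ i a fun x => (hf x).1),
    (deviationMean_mono hθ i a fun x => (hf x).2).trans_eq (deviationMean_const hθ i a M)⟩

end Deviation

theorem jointMean_eval (hθ : ∀ i, θ i ∈ stdSimplex ℝ (α i)) (i : ι) (g : α i → ℝ) :
    jointMean θ (fun x => g (x i)) = ∑ a, θ i a * g a := by
  classical
  rw [jointMean_eq_sum_deviationMean θ i]
  refine Finset.sum_congr rfl fun a _ => ?_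
  rw [deviationMean_congr (g := fun _ => g a) θ fun x hx => by rw [hx], deviationMean_const hθ]

theorem jointMean_indicator_exists_le (hθ : ∀ i, θ i ∈ stdSimplex ℝ (α i))
    (bad : ∀ i, Set (α i)) :
    jointMean θ ({x | ∃ i, x i ∈ bad i}.indicator 1) ≤
      ∑ i, ∑ a, (bad i).indicator (θ i) a := by
  have union_bound : ({x | ∃ i, x i ∈ bad i}.indicator 1 : (∀ i, α i) → ℝ) ≤
      ∑ i, fun x => (bad i).indicator 1 (x i) := fun x => by
    rw [Finset.sum_apply]
    refine Set.indicator_apply_le' (fun ⟨i, hi⟩ => ?_) fun _ =>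
      Finset.sum_nonneg fun i _ => Set.indicator_nonneg (by simp) _
    rw [Pi.one_apply, ← Set.indicator_of_mem hi (fun _ : α i => (1 : ℝ))]
    exact Finset.single_le_sum (f := fun i => (bad i).indicator (1 : α i → ℝ) (x i))
      (fun j _ => Set.indicator_nonneg (by simp) _) (Finset.mem_univ i)
  refine (jointMean_mono (fun i => (hθ i).1) union_bound).trans_eq ?_
  rw [map_sum]
  refine Finset.sum_congr rfl fun i _ => ?_
  rw [jointMean_eval hθ i]
  exact Finset.sum_congr rfl fun a _ => by by_cases ha : a ∈ bad i <;> simp [ha]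

theorem deviationMean_le_of_dominated [∀ i, DecidableEq (α i)]
    (hθ : ∀ i, θ i ∈ stdSimplex ℝ (α i))
    {f : (∀ i, α i) → ℝ} (hf : ∀ x, f x ∈ Set.Icc (0 : ℝ) 1)
    {Δ : ℝ} (hΔ : 0 ≤ Δ) (bad : ∀ i, Set (α i)) {i : ι} {a : α i} {x : α i → ℝ}
    (hx : 0 ≤ x)
    (hdom : ∀ y : ∀ i, α i, (∀ j, j ≠ i → y j ∉ bad j) →
      f (Function.update y i a) ≤ (∑ c, x c * f (Function.update y i c)) - Δ) :
    deviationMean θ i a f ≤ (∑ c, x c * deviationMean θ i c f) - Δ +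
      (1 + Δ) * ∑ j, ∑ c, (bad j).indicator (θ j) c := by
  let bad' := Function.update bad i ∅
  let E : Set (∀ i, α i) := {y | ∃ j, y j ∈ bad' j}
  have pointwise : (fun y => f (Function.update y i a)) ≤
      (∑ c, x c • fun y => f (Function.update y i c)) - (fun _ => Δ) +
        (1 + Δ) • E.indicator (1 : (∀ i, α i) → ℝ) := by
    intro y
    simp only [Pi.add_apply, Pi.sub_apply, Finset.sum_apply, Pi.smul_apply, smul_eq_mul]
    by_cases hy : y ∈ E
    · have h0 : 0 ≤ ∑ c, x c * f (Function.update y i c) :=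
        Finset.sum_nonneg fun c _ => mul_nonneg (hx c) (hf _).1
      rw [Set.indicator_of_mem hy, Pi.one_apply]
      linarith [(hf (Function.update y i a)).2]
    · rw [Set.indicator_of_notMem hy, mul_zero, add_zero]
      exact hdom y fun j hj hmem => hy ⟨j, by simpa [bad', hj] using hmem⟩
  have mass : deviationMean θ i a (E.indicator 1) ≤ ∑ j, ∑ c, (bad j).indicator (θ j) c := by
    refine (jointMean_indicator_exists_le (update_single_mem_stdSimplex hθ i a) bad').trans
      (Finset.sum_le_sum fun j _ => Finset.sum_le_sum fun c _ => ?_)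
    obtain rfl | hj := eq_or_ne j i
    · simpa [bad'] using Set.indicator_nonneg (fun c _ => (hθ j).1 c) c
    · simp [bad', hj]
  have averaged := deviationMean_mono hθ i a pointwise
  simp only [map_add, map_sub, map_sum, map_smul, smul_eq_mul, deviationMean_comp_update,
    deviationMean_const hθ] at averaged
  exact averaged.trans (by gcongr)

end ProductDistributions

/-! ### Iterated elimination and clipping -/

section Elimination

variable {N : ℕ} {k : Fin N → ℕ} {u : Fin N → Profile k → ℝ} {Δ : ℝ}

theorem le_maxActions (k : Fin N → ℕ) (i : Fin N) : k i ≤ maxActions k :=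
  Finset.le_sup (f := k) (Finset.mem_univ i)

theorem sum_le_mul_maxActions (k : Fin N → ℕ) : ∑ i, k i ≤ N * maxActions k := by
  simpa using Finset.sum_le_card_nsmul Finset.univ k _ fun i _ => le_maxActions k i

theorem elim_subset_succ (l : ℕ) (i : Fin N) : elim u Δ l i ⊆ elim u Δ (l + 1) i := by
  induction l generalizing i with
  | zero => exact Set.empty_subset _
  | succ l ih =>
    rintro a ⟨x, hx, hdom⟩
    exact ⟨x, hx, fun y hy => hdom y fun j hj hmem => hy j hj (ih j hmem)⟩

theorem sum_ncard_elim_lt_succ {l : ℕ} (h : elim u Δ (l + 1) ≠ elim u Δ l) :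
    ∑ i, (elim u Δ l i).ncard < ∑ i, (elim u Δ (l + 1) i).ncard := by
  obtain ⟨i, hi⟩ := Function.ne_iff.1 h
  exact Finset.sum_lt_sum
    (fun j _ => Set.ncard_le_ncard (elim_subset_succ l j) (Set.toFinite _))
    ⟨i, Finset.mem_univ i, Set.ncard_lt_ncard ((elim_subset_succ l i).ssubset_of_ne hi.symm)
      (Set.toFinite _)⟩

theorem le_sum_ncard_elim {l : ℕ} (h : ∀ m < l, elim u Δ (m + 1) ≠ elim u Δ m) :
    l ≤ ∑ i, (elim u Δ l i).ncard := by
  induction l with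
  | zero => exact Nat.zero_le _
  | succ l ih =>
    exact (ih fun m hm => h m (hm.trans l.lt_succ_self)).trans_lt
      (sum_ncard_elim_lt_succ (h l l.lt_succ_self))

theorem sum_ncard_elim_le (l : ℕ) : ∑ i, (elim u Δ l i).ncard ≤ N * maxActions k :=
  (Finset.sum_le_sum fun i _ => by
    simpa using Set.ncard_le_card (elim u Δ l i)).trans (sum_le_mul_maxActions k)

theorem elim_elimLength_succ :
    elim u Δ (elimLength u Δ + 1) = elim u Δ (elimLength u Δ) := by
  refine Nat.sInf_mem (s := {l | elim u Δ (l + 1) = elim u Δ l}) ?_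
  by_contra! hne
  have := (le_sum_ncard_elim (u := u) (Δ := Δ) (l := N * maxActions k + 1) fun m _ hm =>
    hne.subset hm).trans (sum_ncard_elim_le _)
  omega

theorem elimLength_le : elimLength u Δ ≤ N * maxActions k :=
  (le_sum_ncard_elim fun _ hm => Nat.notMem_of_lt_sInf
    (s := {l | elim u Δ (l + 1) = elim u Δ l}) hm).trans (sum_ncard_elim_le _)

open Classical in
/-- A mixed strategy dominating the action `a` when `a` is eliminated by round `l + 1`, and the
pure strategy `a` otherwise. -/
noncomputable def dominator (u : Fin N → Profile k → ℝ) (Δ : ℝ) (l : ℕ) (i : Fin N)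
    (a : Fin (k i)) : Fin (k i) → ℝ :=
  if h : a ∈ elim u Δ (l + 1) i then h.choose else Pi.single a 1

theorem dominator_mem_stdSimplex (u : Fin N → Profile k → ℝ) (Δ : ℝ) (l : ℕ) (i : Fin N)
    (a : Fin (k i)) : dominator u Δ l i a ∈ stdSimplex ℝ (Fin (k i)) := by
  unfold dominator
  split_ifs with h
  exacts [h.choose_spec.1, single_mem_stdSimplex ℝ a]

theorem le_sum_dominator_sub {l : ℕ} {i : Fin N} {a : Fin (k i)} (ha : a ∈ elim u Δ (l + 1) i)
    {y : Profile k} (hy : ∀ j, j ≠ i → y j ∉ elim u Δ l j) :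
    u i (Function.update y i a) ≤
      (∑ c, dominator u Δ l i a c * u i (Function.update y i c)) - Δ := by
  rw [dominator, dif_pos ha]
  exact ha.choose_spec.2 y hy

end Elimination

section Clipping

/-- The weights `x` with those of size at most `p` replaced by `0`; `clip p x` normalizes them. -/
noncomputable def truncate {n : ℕ} (p : ℝ) (x : Fin n → ℝ) (a : Fin n) : ℝ :=
  if x a ≤ p then 0 else x a

theorem clip_eq_truncate_div {n : ℕ} (p : ℝ) (x : Fin n → ℝ) (a : Fin n) :
    clip p x a = truncate p x a / ∑ c, truncate p x c := by
  unfold clip truncate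
  split_ifs <;> simp

theorem truncate_nonneg {n : ℕ} {p : ℝ} {x : Fin n → ℝ} (hx : 0 ≤ x) : 0 ≤ truncate p x :=
  fun a => by unfold truncate; split_ifs; exacts [le_rfl, hx a]

theorem truncate_le {n : ℕ} {p : ℝ} {x : Fin n → ℝ} (hx : 0 ≤ x) : truncate p x ≤ x :=
  fun a => by unfold truncate; split_ifs; exacts [hx a, le_rfl]

theorem lt_of_clip_ne_zero {n : ℕ} {p : ℝ} {x : Fin n → ℝ} {a : Fin n} (h : clip p x a ≠ 0) :
    p < x a := by
  by_contra! hle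
  exact h (if_pos hle)

theorem sum_truncate_pos {n : ℕ} {p : ℝ} {x : Fin n → ℝ} (hx : x ∈ stdSimplex ℝ (Fin n))
    (hp : n * p < 1) : 0 < ∑ c, truncate p x c := by
  obtain ⟨a, ha⟩ : ∃ a, max p 0 < x a := by
    by_contra! hle
    have := Finset.sum_le_card_nsmul Finset.univ x _ fun c _ => hle c
    rw [hx.2, Finset.card_fin, nsmul_eq_mul, mul_max_of_nonneg _ _ n.cast_nonneg, mul_zero] at this
    exact this.not_gt (max_lt hp one_pos)
  obtain ⟨hpa, h0a⟩ := max_lt_iff.1 ha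
  exact Finset.sum_pos' (fun c _ => truncate_nonneg hx.1 c)
    ⟨a, Finset.mem_univ a, by rwa [truncate, if_neg hpa.not_ge]⟩

theorem clip_mem_stdSimplex {n : ℕ} {p : ℝ} {x : Fin n → ℝ} (hx : x ∈ stdSimplex ℝ (Fin n))
    (hp : n * p < 1) : clip p x ∈ stdSimplex ℝ (Fin n) := by
  have hpos := sum_truncate_pos hx hp
  refine ⟨fun a => ?_, ?_⟩
  · rw [clip_eq_truncate_div]
    exact div_nonneg (truncate_nonneg hx.1 a) hpos.le
  · simp only [clip_eq_truncate_div, ← Finset.sum_div, div_self hpos.ne']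

theorem sum_normalize_mul_le {β : Type*} [Fintype β] {P q f : β → ℝ} (hP : ∑ x, P x = 1)
    (hq : 0 ≤ q) (hqP : q ≤ P) (hpos : 0 < ∑ x, q x) (hf : ∀ x, |f x| ≤ 1) :
    ∑ x, q x / (∑ y, q y) * f x ≤ ∑ x, P x * f x + 2 * (1 - ∑ x, q x) := by
  set Z := ∑ x, q x
  have hZ : Z ≤ 1 := hP ▸ Finset.sum_le_sum fun x _ => hqP x
  have pointwise (x : β) : q x / Z * f x ≤ P x * f x + ((q x / Z - q x) + (P x - q x)) := by
    have hdiv : q x ≤ q x / Z := le_div_self (hq x) hpos hZ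
    have hf' := abs_le.1 (hf x)
    nlinarith [mul_nonneg (sub_nonneg.2 hdiv) (sub_nonneg.2 hf'.2),
      mul_nonneg (sub_nonneg.2 (hqP x)) (neg_le_iff_add_nonneg.1 hf'.1)]
  refine (Finset.sum_le_sum fun x _ => pointwise x).trans_eq ?_
  simp only [Finset.sum_add_distrib, Finset.sum_sub_distrib, ← Finset.sum_div, hP]
  rw [div_self hpos.ne']
  ring

variable {N : ℕ} {k : Fin N → ℕ} {θ : Weights k} {p : ℝ}

theorem one_sub_le_prod_sum_truncate (hθ : ∀ i, θ i ∈ stdSimplex ℝ (Fin (k i))) (hp : 0 ≤ p) :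
    1 - N * maxActions k * p ≤ ∏ i, ∑ c, truncate p (θ i) c := by
  let bad (i : Fin N) : Set (Fin (k i)) := {c | θ i c ≤ p}
  let E : Set (Profile k) := {x | ∃ i, x i ∈ bad i}
  have mass : jointMean θ (E.indicator 1) ≤ N * maxActions k * p := by
    refine (jointMean_indicator_exists_le hθ bad).trans
      ((sum_indicator_le_sum_card_mul hp fun i a ha => ha).trans ?_)
    simp only [Fintype.card_fin]
    gcongr
    exact_mod_cast sum_le_mul_maxActions k
  have pointwise (x : Profile k) : ∏ i, θ i (x i) ≤
      ∏ i, truncate p (θ i) (x i) + (∏ i, θ i (x i)) * E.indicator 1 x := by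
    by_cases hx : x ∈ E
    · simpa [hx] using Finset.prod_nonneg fun i _ => truncate_nonneg (hθ i).1 (x i)
    · have hgood (i : Fin N) : truncate p (θ i) (x i) = θ i (x i) :=
        if_neg fun hle => hx ⟨i, hle⟩
      simp [hx, hgood]
  have total := Finset.sum_le_sum fun x (_ : x ∈ Finset.univ) => pointwise x
  rw [sum_prod_eq_one fun i => (hθ i).2, Finset.sum_add_distrib, sum_prod_eq_prod_sum,
    ← jointMean_apply] at total
  linarith

theorem jointMean_clip_le (hθ : ∀ i, θ i ∈ stdSimplex ℝ (Fin (k i))) (hp : 0 ≤ p)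
    (hp1 : N * maxActions k * p < 1) {f : Profile k → ℝ} (hf : ∀ x, |f x| ≤ 1) :
    jointMean (fun i => clip p (θ i)) f ≤ jointMean θ f + 2 * (N * maxActions k * p) := by
  have kept := one_sub_le_prod_sum_truncate hθ hp
  rw [← sum_prod_eq_prod_sum] at kept
  have hclip (x : Profile k) : ∏ i, clip p (θ i) (x i) =
      (∏ i, truncate p (θ i) (x i)) / ∑ y : Profile k, ∏ i, truncate p (θ i) (y i) := by
    simp only [clip_eq_truncate_div, Finset.prod_div_distrib, sum_prod_eq_prod_sum]
  have normalized := sum_normalize_mul_le (P := fun x : Profile k => ∏ i, θ i (x i))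
    (q := fun x : Profile k => ∏ i, truncate p (θ i) (x i))
    (sum_prod_eq_one fun i => (hθ i).2)
    (fun x => Finset.prod_nonneg fun i _ => truncate_nonneg (hθ i).1 _)
    (fun x => Finset.prod_le_prod (fun i _ => truncate_nonneg (hθ i).1 _)
      fun i _ => truncate_le (hθ i).1 _) (by linarith) hf
  simp only [jointMean_apply, hclip]
  linarith

end Clipping

/-! ### Exponential supermartingales -/

section ExponentialSupermartingale

theorem exp_mul_le_chord {x : ℝ} (hx : x ∈ Set.Icc (0 : ℝ) 1) (t : ℝ) :
    Real.exp (t * x) ≤ 1 + x * (Real.exp t - 1) := by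
  have hconvex := convexOn_exp.2 (Set.mem_univ 0) (Set.mem_univ t) (sub_nonneg.2 hx.2) hx.1
    (by ring)
  simp only [smul_eq_mul, mul_zero, zero_add, Real.exp_zero, mul_one] at hconvex
  rw [mul_comm]
  linarith

theorem one_add_mul_exp_sub_one_le {q : ℝ} (hq : q ∈ Set.Icc (0 : ℝ) 1) (t : ℝ) :
    1 + q * (Real.exp t - 1) ≤ Real.exp (t * q + t ^ 2 / 8) := by
  let ν : Measure ℝ := ProbabilityTheory.bernoulliMeasure 1 0 ⟨q, hq⟩
  have hintegral (g : ℝ → ℝ) : ∫ x, g x ∂ν = q * g 1 + (1 - q) * g 0 := by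
    simp [ν, ProbabilityTheory.integral_bernoulliMeasure]
  have hmem : ∀ᵐ x ∂ν, id x ∈ Set.Icc (0 : ℝ) 1 := by
    simp only [ν, ProbabilityTheory.bernoulliMeasure_def, ae_add_measure_iff]
    constructor <;> refine Measure.ae_smul_measure ?_ _ <;> simp [ae_dirac_eq]
  have hsub := (ProbabilityTheory.hasSubgaussianMGF_of_mem_Icc aemeasurable_id hmem).mgf_le t
  simp only [ProbabilityTheory.mgf, hintegral, id, mul_one, mul_zero, add_zero] at hsub
  have hexp := mul_le_mul_of_nonneg_left hsub (Real.exp_pos (t * q)).le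
  calc 1 + q * (Real.exp t - 1)
      = Real.exp (t * q) * (q * Real.exp (t * (1 - q)) + (1 - q) * Real.exp (t * (0 - q))) := by
        rw [mul_add, mul_left_comm, mul_left_comm (Real.exp _), ← Real.exp_add, ← Real.exp_add]
        ring_nf
        simp only [Real.exp_zero]
        ring
    _ ≤ Real.exp (t * q + t ^ 2 / 8) := by
        rw [Real.exp_add]
        refine hexp.trans_eq ?_
        congr 2
        norm_num
        ring

/-- The exponent of Hoeffding's lemma: `exp (hoeffdingTerm l X q)` has mean at most `1` when `X` is
`[0,1]`-valued with mean `q`. Summed along a filtration, these exponents give a supermartingale. -/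
noncomputable def hoeffdingTerm (l x q : ℝ) : ℝ := l * (x - q) - l ^ 2 / 8

theorem abs_mul_sub_le {l x q B : ℝ} (hx : x ∈ Set.Icc (0 : ℝ) 1) (hq : q ∈ Set.Icc (0 : ℝ) 1)
    (hl : |l| ≤ B) : |l * (x - q)| ≤ B := by
  rw [abs_mul]
  refine (mul_le_of_le_one_right (abs_nonneg l) ?_).trans hl
  rw [abs_le]
  constructor <;> linarith [hx.1, hx.2, hq.1, hq.2]

theorem hoeffdingTerm_le {l x q B : ℝ} (hx : x ∈ Set.Icc (0 : ℝ) 1) (hq : q ∈ Set.Icc (0 : ℝ) 1)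
    (hl : |l| ≤ B) : hoeffdingTerm l x q ≤ B := by
  have hlin := (abs_le.1 (abs_mul_sub_le hx hq hl)).2
  unfold hoeffdingTerm
  linarith [sq_nonneg l]

theorem exp_hoeffdingTerm_le {x : ℝ} (hx : x ∈ Set.Icc (0 : ℝ) 1) (l q : ℝ) :
    Real.exp (hoeffdingTerm l x q) ≤
      Real.exp (hoeffdingTerm l 0 q) + Real.exp (hoeffdingTerm l 0 q) * (Real.exp l - 1) * x := by
  have hsplit : hoeffdingTerm l x q = hoeffdingTerm l 0 q + l * x := by
    unfold hoeffdingTerm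
    ring
  rw [hsplit, Real.exp_add]
  linarith [mul_le_mul_of_nonneg_left (exp_mul_le_chord hx l)
    (Real.exp_pos (hoeffdingTerm l 0 q)).le]

theorem exp_hoeffdingTerm_zero_add_le_one {q : ℝ} (hq : q ∈ Set.Icc (0 : ℝ) 1) (l : ℝ) :
    Real.exp (hoeffdingTerm l 0 q) + Real.exp (hoeffdingTerm l 0 q) * (Real.exp l - 1) * q ≤ 1 := by
  calc Real.exp (hoeffdingTerm l 0 q) + Real.exp (hoeffdingTerm l 0 q) * (Real.exp l - 1) * q
      = Real.exp (hoeffdingTerm l 0 q) * (1 + q * (Real.exp l - 1)) := by ring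
    _ ≤ Real.exp (hoeffdingTerm l 0 q) * Real.exp (l * q + l ^ 2 / 8) :=
        mul_le_mul_of_nonneg_left (one_add_mul_exp_sub_one_le hq l) (Real.exp_pos _).le
    _ = 1 := by
        rw [← Real.exp_add, hoeffdingTerm]
        ring_nf
        exact Real.exp_zero

variable {Ω : Type*} {m mΩ : MeasurableSpace Ω} {μ : Measure Ω}

theorem measurable_hoeffdingTerm {l x q : Ω → ℝ} (hl : Measurable l) (hx : Measurable x)
    (hq : Measurable q) : Measurable fun ω => hoeffdingTerm (l ω) (x ω) (q ω) :=
  (hl.mul (hx.sub hq)).sub ((hl.pow_const 2).div_const 8)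

theorem integrable_of_mem_Icc [IsFiniteMeasure μ] {f : Ω → ℝ} {a b : ℝ} (hf : Measurable f)
    (hab : ∀ ω, f ω ∈ Set.Icc a b) : Integrable f μ :=
  Integrable.of_mem_Icc a b hf.aemeasurable (ae_of_all μ hab)

theorem condExp_exp_hoeffdingTerm_le_one [IsFiniteMeasure μ] (hm : m ≤ mΩ)
    {f l q : Ω → ℝ} {B : ℝ} (hf : Measurable f) (hf01 : ∀ ω, f ω ∈ Set.Icc (0 : ℝ) 1)
    (hl : Measurable[m] l) (hlB : ∀ ω, |l ω| ≤ B)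
    (hq : Measurable[m] q) (hq01 : ∀ ω, q ω ∈ Set.Icc (0 : ℝ) 1)
    (hmean : ∀ᵐ ω ∂μ, l ω ≠ 0 → (μ[f | m]) ω = q ω) :
    ∀ᵐ ω ∂μ, (μ[fun ω => Real.exp (hoeffdingTerm (l ω) (f ω) (q ω)) | m]) ω ≤ 1 := by
  let K : Ω → ℝ := fun ω => Real.exp (hoeffdingTerm (l ω) 0 (q ω))
  let H : Ω → ℝ := fun ω => K ω * (Real.exp (l ω) - 1)
  have hKm : Measurable[m] K :=
    Real.measurable_exp.comp (measurable_hoeffdingTerm hl measurable_const hq)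
  have hHm : Measurable[m] H := hKm.mul ((Real.measurable_exp.comp hl).sub_const 1)
  have hKB (ω : Ω) : K ω ≤ Real.exp B :=
    Real.exp_le_exp.2 (hoeffdingTerm_le (by simp) (hq01 ω) (hlB ω))
  have hHB (ω : Ω) : |H ω| ≤ Real.exp B * (Real.exp B + 1) := by
    rw [abs_mul, abs_of_pos (Real.exp_pos _)]
    refine mul_le_mul (hKB ω) ?_ (abs_nonneg _) (Real.exp_pos B).le
    have hle := Real.exp_le_exp.2 ((le_abs_self (l ω)).trans (hlB ω))
    rw [abs_le]
    constructor <;> linarith [Real.exp_pos (l ω), Real.exp_pos B]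
  have hfint : Integrable f μ := integrable_of_mem_Icc hf hf01
  have hKint : Integrable K μ :=
    integrable_of_mem_Icc (hKm.mono hm le_rfl) fun ω => ⟨(Real.exp_pos _).le, hKB ω⟩
  have hHf : Integrable (H * f) μ :=
    hfint.bdd_mul (hHm.mono hm le_rfl).aestronglyMeasurable (ae_of_all μ hHB)
  have hexp : Integrable (fun ω => Real.exp (hoeffdingTerm (l ω) (f ω) (q ω))) μ :=
    integrable_of_mem_Icc (Real.measurable_exp.comp
      (measurable_hoeffdingTerm (hl.mono hm le_rfl) hf (hq.mono hm le_rfl))) fun ω =>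
        ⟨(Real.exp_pos _).le, Real.exp_le_exp.2 (hoeffdingTerm_le (hf01 ω) (hq01 ω) (hlB ω))⟩
  have hle := condExp_mono (m := m) hexp (hKint.add hHf)
    (ae_of_all μ fun ω => exp_hoeffdingTerm_le (hf01 ω) (l ω) (q ω))
  have hpull := condExp_mul_of_stronglyMeasurable_left hHm.stronglyMeasurable hHf hfint
  filter_upwards [hmean, hle, hpull, condExp_add hKint hHf m] with ω hmean hle hpull hadd
  rw [hadd, Pi.add_apply, condExp_of_stronglyMeasurable hm hKm.stronglyMeasurable hKint, hpull,
    Pi.mul_apply] at hle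
  refine (hle.trans_eq ?_).trans (exp_hoeffdingTerm_zero_add_le_one (hq01 ω) (l ω))
  rcases eq_or_ne (l ω) 0 with h0 | h0
  · simp [K, H, h0]
  · rw [hmean h0]

theorem integral_mul_le_integral_of_condExp_le_one [IsFiniteMeasure μ]
    (hm : m ≤ mΩ) {G E : Ω → ℝ} {C : ℝ} (hG : Measurable[m] G) (hG0 : ∀ ω, G ω ∈ Set.Icc 0 C)
    (hE : Integrable E μ) (hE1 : ∀ᵐ ω ∂μ, (μ[E | m]) ω ≤ 1) :
    ∫ ω, G ω * E ω ∂μ ≤ ∫ ω, G ω ∂μ := by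
  have hGB (ω : Ω) : ‖G ω‖ ≤ C := (abs_of_nonneg (hG0 ω).1).trans_le (hG0 ω).2
  have hGint : Integrable G μ := integrable_of_mem_Icc (hG.mono hm le_rfl) hG0
  have hpull := condExp_stronglyMeasurable_mul_of_bound hm hG.stronglyMeasurable hE C
    (ae_of_all μ hGB)
  rw [← integral_condExp hm (f := fun ω => G ω * E ω)]
  refine integral_mono_ae integrable_condExp hGint ?_
  filter_upwards [hpull, hE1] with ω hpull hE1
  exact hpull.trans_le (mul_le_of_le_one_right (hG0 ω).1 hE1)

theorem integral_exp_sum_hoeffdingTerm_le_one [IsProbabilityMeasure μ] {ι : Type*} [LinearOrder ι]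
    (ℱ : Filtration ι mΩ) {f l q : ι → Ω → ℝ} {B : ℝ} (S : Finset ι)
    (hfm : ∀ s ∈ S, Measurable (f s))
    (hf : ∀ s ∈ S, ∀ s', s < s' → Measurable[ℱ s'] (f s))
    (hf01 : ∀ s ∈ S, ∀ ω, f s ω ∈ Set.Icc (0 : ℝ) 1)
    (hq : ∀ s ∈ S, Measurable[ℱ s] (q s)) (hq01 : ∀ s ∈ S, ∀ ω, q s ω ∈ Set.Icc (0 : ℝ) 1)
    (hl : ∀ s ∈ S, Measurable[ℱ s] (l s)) (hlB : ∀ s ∈ S, ∀ ω, |l s ω| ≤ B)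
    (hmean : ∀ s ∈ S, ∀ᵐ ω ∂μ, l s ω ≠ 0 → (μ[f s | ℱ s]) ω = q s ω) :
    Integrable (fun ω => Real.exp (∑ s ∈ S, hoeffdingTerm (l s ω) (f s ω) (q s ω))) μ ∧
      ∫ ω, Real.exp (∑ s ∈ S, hoeffdingTerm (l s ω) (f s ω) (q s ω)) ∂μ ≤ 1 := by
  have hbound (S' : Finset ι) (hS' : S' ⊆ S) (ω : Ω) :
      Real.exp (∑ s ∈ S', hoeffdingTerm (l s ω) (f s ω) (q s ω)) ∈
        Set.Icc 0 (Real.exp (S'.card • B)) :=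
    ⟨(Real.exp_pos _).le, Real.exp_le_exp.2 <| Finset.sum_le_card_nsmul _ _ _ fun s hs =>
      hoeffdingTerm_le (hf01 s (hS' hs) ω) (hq01 s (hS' hs) ω) (hlB s (hS' hs) ω)⟩
  have hmeas {𝒢 : MeasurableSpace Ω} (S' : Finset ι) (hS' : S' ⊆ S) (h𝒢 : ∀ s ∈ S', ℱ s ≤ 𝒢)
      (hf𝒢 : ∀ s ∈ S', Measurable[𝒢] (f s)) :
      Measurable[𝒢] fun ω => Real.exp (∑ s ∈ S', hoeffdingTerm (l s ω) (f s ω) (q s ω)) :=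
    Real.measurable_exp.comp <| Finset.measurable_sum S' fun s hs =>
      measurable_hoeffdingTerm ((hl s (hS' hs)).mono (h𝒢 s hs) le_rfl) (hf𝒢 s hs)
        ((hq s (hS' hs)).mono (h𝒢 s hs) le_rfl)
  have hintegrable (S' : Finset ι) (hS' : S' ⊆ S) :
      Integrable (fun ω => Real.exp (∑ s ∈ S', hoeffdingTerm (l s ω) (f s ω) (q s ω))) μ :=
    integrable_of_mem_Icc (hmeas S' hS' (fun s _ => ℱ.le s) fun s hs => hfm s (hS' hs))
      (hbound S' hS')
  suffices h : ∀ S' ⊆ S,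
      ∫ ω, Real.exp (∑ s ∈ S', hoeffdingTerm (l s ω) (f s ω) (q s ω)) ∂μ ≤ 1 from
    ⟨hintegrable S subset_rfl, h S subset_rfl⟩
  intro S'
  induction S' using Finset.induction_on_max with
  | empty => simp
  | insert a S' hmax ih =>
    intro hS'
    have ha : a ∈ S := hS' (Finset.mem_insert_self a S')
    have hsub : S' ⊆ S := (Finset.subset_insert a S').trans hS'
    have hpast : Measurable[ℱ a] fun ω =>
        Real.exp (∑ s ∈ S', hoeffdingTerm (l s ω) (f s ω) (q s ω)) :=
      hmeas S' hsub (fun s hs => ℱ.mono (hmax s hs).le) fun s hs => hf s (hsub hs) a (hmax s hs)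
    have hterm : Integrable (fun ω => Real.exp (hoeffdingTerm (l a ω) (f a ω) (q a ω))) μ := by
      simpa using hintegrable {a} (by simpa using ha)
    refine le_trans (le_of_eq ?_) ((integral_mul_le_integral_of_condExp_le_one (ℱ.le a) hpast
      (hbound S' hsub) hterm (condExp_exp_hoeffdingTerm_le_one (ℱ.le a) (hfm a ha) (hf01 a ha)
        (hl a ha) (hlB a ha) (hq a ha) (hq01 a ha) (hmean a ha))).trans (ih hsub))
    simp only [Finset.sum_insert fun h => lt_irrefl _ (hmax a h), Real.exp_add, mul_comm]

theorem measureReal_ge_le_exp_neg [IsProbabilityMeasure μ] {Y : Ω → ℝ}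
    (hY : Integrable (fun ω => Real.exp (Y ω)) μ) (hmean : ∫ ω, Real.exp (Y ω) ∂μ ≤ 1) (x : ℝ) :
    μ.real {ω | x ≤ Y ω} ≤ Real.exp (-x) := by
  have hmarkov := mul_meas_ge_le_integral_of_nonneg
    (ae_of_all μ fun ω => (Real.exp_pos (Y ω)).le) hY (Real.exp x)
  simp only [Real.exp_le_exp] at hmarkov
  rw [Real.exp_neg, ← one_div, le_div_iff₀ (Real.exp_pos x), mul_comm]
  exact hmarkov.trans hmean

end ExponentialSupermartingale

/-! ### Bandit feedback -/

section ConditionalExpectation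

variable {Ω : Type*} {m m' mΩ : MeasurableSpace Ω} {μ : Measure Ω}

theorem condExp_eq_condExp_of_tower_on (hm : m ≤ m') (hm' : m' ≤ mΩ) [SigmaFinite (μ.trim hm')]
    {f g : Ω → ℝ} {s : Set Ω} (hs : MeasurableSet[m] s) (hf : Integrable f μ) (hg : Integrable g μ)
    (hfg : ∀ᵐ ω ∂μ, ω ∈ s → (μ[f | m']) ω = g ω) :
    ∀ᵐ ω ∂μ, ω ∈ s → (μ[f | m]) ω = (μ[g | m]) ω := by
  have hindicator : s.indicator (μ[f | m']) =ᵐ[μ] s.indicator g := by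
    filter_upwards [hfg] with ω hω
    by_cases h : ω ∈ s
    · simp only [Set.indicator_of_mem h, hω h]
    · simp only [Set.indicator_of_notMem h]
  have hcond : s.indicator (μ[f | m]) =ᵐ[μ] s.indicator (μ[g | m]) :=
    calc s.indicator (μ[f | m]) =ᵐ[μ] μ[s.indicator f | m] := (condExp_indicator hf hs).symm
      _ =ᵐ[μ] μ[μ[s.indicator f | m'] | m] := (condExp_condExp_of_le hm hm').symm
      _ =ᵐ[μ] μ[s.indicator (μ[f | m']) | m] :=
          condExp_congr_ae (condExp_indicator hf (hm s hs))
      _ =ᵐ[μ] μ[s.indicator g | m] := condExp_congr_ae hindicator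
      _ =ᵐ[μ] s.indicator (μ[g | m]) := condExp_indicator hg hs
  filter_upwards [hcond] with ω hω h
  simpa only [Set.indicator_of_mem h] using hω

theorem condExp_comp_eq_sum [IsFiniteMeasure μ] {X : Type*} [Fintype X] [MeasurableSpace X]
    [MeasurableSingletonClass X] {Y : Ω → X} (hY : Measurable Y) (v : X → ℝ) :
    μ[fun ω => v (Y ω) | m] =ᵐ[μ]
      fun ω => ∑ x, v x * (μ[(Y ⁻¹' {x}).indicator fun _ => (1 : ℝ) | m]) ω := by
  classical
  have hsum : (fun ω => v (Y ω)) = ∑ x, v x • (Y ⁻¹' {x}).indicator fun _ => (1 : ℝ) := by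
    ext ω
    simp [Set.indicator_apply, eq_comm]
  have hintegrable (x : X) : Integrable ((Y ⁻¹' {x}).indicator fun _ => (1 : ℝ)) μ :=
    (integrable_const 1).indicator (hY (measurableSet_singleton x))
  have hscalar : ∀ᵐ ω ∂μ, ∀ x, (μ[v x • (Y ⁻¹' {x}).indicator fun _ => (1 : ℝ) | m]) ω =
      v x * (μ[(Y ⁻¹' {x}).indicator fun _ => (1 : ℝ) | m]) ω :=
    ae_all_iff.2 fun x => condExp_smul (v x) _ m
  rw [hsum]
  filter_upwards [condExp_finsetSum (s := Finset.univ) (fun x _ => (hintegrable x).smul (v x)) m,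
    hscalar] with ω hω hscalar
  rw [hω, Finset.sum_apply]
  exact Finset.sum_congr rfl fun x _ => hscalar x

end ConditionalExpectation

section Feedback

variable {N : ℕ} {k : Fin N → ℕ} {Ω : Type*} [mΩ : MeasurableSpace Ω]

theorem slot_lt_slot {r i a m r' i' a' m' : ℕ} : slot r i a m < slot r' i' a' m' ↔
    r < r' ∨ r = r' ∧ (i < i' ∨ i = i' ∧ (a < a' ∨ a = a' ∧ m < m')) := by
  simp [slot, Prod.Lex.toLex_lt_toLex]

theorem slot_zero_le (r i a m : ℕ) : slot r 0 0 0 ≤ slot r i a m := by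
  rw [← not_lt, slot_lt_slot]
  lia

theorem sum_hoeffdingTerm_batch {b K : ℕ} (hb : 0 < b) (hbK : b ≤ K) (w q : ℝ) (x : ℕ → ℝ) :
    ∑ m ∈ Finset.range K, hoeffdingTerm (if m < b then w / b else 0) (x m) q =
      w * ((∑ m ∈ Finset.range b, x m) / b - q) - w ^ 2 / (8 * b) := by
  have hb0 : (b : ℝ) ≠ 0 := Nat.cast_ne_zero.2 hb.ne'
  have hplayed : ∑ m ∈ Finset.range K, hoeffdingTerm (if m < b then w / b else 0) (x m) q =
      ∑ m ∈ Finset.range b, (w / b * (x m - q) - (w / b) ^ 2 / 8) := by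
    rw [← Finset.sum_subset (Finset.range_subset_range.2 hbK)]
    · exact Finset.sum_congr rfl fun m hm => by rw [if_pos (Finset.mem_range.1 hm), hoeffdingTerm]
    · intro m _ hm
      simp [hoeffdingTerm, Finset.mem_range.not.1 hm]
  rw [hplayed, Finset.sum_sub_distrib, ← Finset.mul_sum, Finset.sum_sub_distrib]
  simp only [Finset.sum_const, Finset.card_range, nsmul_eq_mul]
  field_simp

/-- The label of the `m`-th play of action `c` of player `i` in round `r`, where `(r, c, m)` is
ordered lexicographically, so that the labels of the plays explored by `i` are in order. -/
def exploredSlot (i : Fin N) (t : ℕ ×ₗ (Fin (k i) ×ₗ ℕ)) : Slot :=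
  slot (ofLex t).1 i (ofLex (ofLex t).2).1 (ofLex (ofLex t).2).2

theorem strictMono_exploredSlot (i : Fin N) : StrictMono (exploredSlot (k := k) i) := by
  intro t t' h
  rw [exploredSlot, exploredSlot, slot_lt_slot]
  rw [Prod.Lex.lt_iff, Prod.Lex.lt_iff] at h
  rcases h with hround | ⟨hround, haction | ⟨haction, hplay⟩⟩
  · exact Or.inl hround
  · exact Or.inr ⟨hround, Or.inr ⟨rfl, Or.inl haction⟩⟩
  · exact Or.inr ⟨hround, Or.inr ⟨rfl, Or.inr ⟨congrArg Fin.val haction, hplay⟩⟩⟩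

theorem sum_map_toLex {α β γ : Type*} (s : Finset α) (t : Finset β) (v : Finset γ)
    (F : α ×ₗ (β ×ₗ γ) → ℝ) :
    ∑ x ∈ (s ×ˢ t ×ˢ v).map
        ((Equiv.prodCongr (Equiv.refl α) toLex).trans toLex).toEmbedding, F x =
      ∑ a ∈ s, ∑ b ∈ t, ∑ c ∈ v, F (toLex (a, toLex (b, c))) := by
  rw [Finset.sum_map, Finset.sum_product]
  exact Finset.sum_congr rfl fun a _ => Finset.sum_product ..

/-- The weight of the play `t = (r, c, m)` explored by player `i`: a weight `w r ω c` of the action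
`c` in round `r` is shared evenly by the plays of its batch. -/
noncomputable def playWeight (I : Interaction k Ω) (i : Fin N) (w : ℕ → Ω → Fin (k i) → ℝ)
    (t : ℕ ×ₗ (Fin (k i) ×ₗ ℕ)) (ω : Ω) : ℝ :=
  if (ofLex (ofLex t).2).2 < I.batch (ofLex t).1 ω i
    then w (ofLex t).1 ω (ofLex (ofLex t).2).1 / I.batch (ofLex t).1 ω i else 0

theorem abs_playWeight_le (I : Interaction k Ω) {i : Fin N} {w : ℕ → Ω → Fin (k i) → ℝ}
    {t : ℕ ×ₗ (Fin (k i) ×ₗ ℕ)} {ω : Ω} {B : ℝ} (hpos : 0 < I.batch (ofLex t).1 ω i)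
    (hw : ∀ c, |w (ofLex t).1 ω c| ≤ B) : |playWeight I i w t ω| ≤ B := by
  have hB := hw (ofLex (ofLex t).2).1
  unfold playWeight
  split_ifs
  · rw [abs_div, Nat.abs_cast]
    exact (div_le_self (abs_nonneg _) (Nat.one_le_cast.2 hpos)).trans hB
  · exact abs_zero.trans_le ((abs_nonneg _).trans hB)

namespace Interaction.IsBandit

variable {I : Interaction k Ω} {u : Fin N → Profile k → ℝ} {μ : Measure Ω} {R : ℕ}

theorem measurable_act (hI : I.IsBandit u μ R) (r i a m : ℕ) :
    Measurable (I.act (slot r i a m)) :=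
  (hI.act_meas _ (slot (r + 1) i a m) (slot_lt_slot.2 (by lia))).mono (I.hist.le _) le_rfl

theorem measurable_fb (hI : I.IsBandit u μ R) (r i a m : ℕ) (j : Fin N) :
    Measurable fun ω => I.fb (slot r i a m) ω j :=
  (measurable_pi_apply j).comp
    ((hI.fb_meas _ (slot (r + 1) i a m) (slot_lt_slot.2 (by lia))).mono (I.hist.le _) le_rfl)

theorem measurable_deviationMean (hI : I.IsBandit u μ R) {r : ℕ} (hr : r < R) (i : Fin N)
    (a : Fin (k i)) (f : Profile k → ℝ) :
    Measurable[I.hist (slot r 0 0 0)] fun ω => deviationMean (I.strat r ω) i a f := by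
  simp only [deviationMean_apply]
  refine Finset.measurable_sum _ fun x _ => Measurable.mul_const (Measurable.const_mul ?_ _) _
  exact Finset.measurable_prod _ fun j _ => hI.strat_meas r hr j (x j)

theorem condExp_utility_act [IsFiniteMeasure μ] (hI : I.IsBandit u μ R) {r : ℕ} (hr : r < R)
    (i : Fin N) (a : Fin (k i)) (m : ℕ) (f : Profile k → ℝ) :
    ∀ᵐ ω ∂μ, m < I.batch r ω i →
      (μ[fun ω => f (I.act (slot r i a m) ω) | I.hist (slot r i a m)]) ω =
        deviationMean (I.strat r ω) i a f := by
  have hlaw := ae_all_iff.2 (hI.act_law r hr i a m)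
  filter_upwards [hlaw, condExp_comp_eq_sum (hI.measurable_act r i a m) f] with ω hlaw hsum hplayed
  rw [hsum, deviationMean_apply]
  exact Finset.sum_congr rfl fun x _ => by rw [hlaw x hplayed, mul_comm]

theorem condExp_fb [IsFiniteMeasure μ] (hI : I.IsBandit u μ R) {r : ℕ} (hr : r < R)
    (i : Fin N) (a : Fin (k i)) (m : ℕ) (j : Fin N) :
    ∀ᵐ ω ∂μ, m < I.batch r ω i →
      (μ[fun ω => I.fb (slot r i a m) ω j | I.hist (slot r i a m)]) ω =
        deviationMean (I.strat r ω) i a (u j) := by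
  have hplayed : MeasurableSet[I.hist (slot r i a m)] {ω | m < I.batch r ω i} :=
    I.hist.mono (slot_zero_le r i a m) _ (hI.batch_meas r hr i (measurableSet_Ioi (a := m)))
  have hact := hI.measurable_act r i a m
  have hutility : Integrable (fun ω => u j (I.act (slot r i a m) ω)) μ :=
    (Integrable.of_finite (μ := μ.map (I.act (slot r i a m))) (f := u j)).comp_measurable hact
  filter_upwards [condExp_eq_condExp_of_tower_on le_sup_left (sup_le (I.hist.le _) hact.comap_le)
    hplayed (integrable_of_mem_Icc (hI.measurable_fb r i a m j) fun ω => hI.fb_mem _ ω j) hutility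
    (hI.fb_mean r hr i a m j), hI.condExp_utility_act hr i a m (u j)] with ω htower hmean hω
  rw [htower hω, hmean hω]

theorem measurable_playWeight (hI : I.IsBandit u μ R) {i : Fin N} {w : ℕ → Ω → Fin (k i) → ℝ}
    {t : ℕ ×ₗ (Fin (k i) ×ₗ ℕ)} (ht : (ofLex t).1 < R)
    (hw : ∀ c, Measurable[I.hist (slot (ofLex t).1 0 0 0)] fun ω => w (ofLex t).1 ω c) :
    Measurable[I.hist (slot (ofLex t).1 0 0 0)] (playWeight I i w t) :=
  Measurable.ite (hI.batch_meas _ ht i measurableSet_Ioi)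
    ((hw _).div (measurable_from_top.comp (hI.batch_meas _ ht i))) measurable_const

theorem integral_exp_avg_sub_le_one [IsProbabilityMeasure μ] (hI : I.IsBandit u μ R)
    {i : Fin N} (hu : ∀ x, u i x ∈ Set.Icc (0 : ℝ) 1) (s : Finset ℕ) (hs : ∀ r ∈ s, r < R)
    (hstrat : ∀ r ∈ s, ∀ ω j, I.strat r ω j ∈ stdSimplex ℝ (Fin (k j)))
    {K : ℕ} (hpos : ∀ r ∈ s, ∀ ω, 0 < I.batch r ω i) (hK : ∀ r ∈ s, ∀ ω, I.batch r ω i ≤ K)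
    (w : ℕ → Ω → Fin (k i) → ℝ) {B : ℝ}
    (hw : ∀ r ∈ s, ∀ c, Measurable[I.hist (slot r 0 0 0)] fun ω => w r ω c)
    (hwB : ∀ r ∈ s, ∀ ω c, |w r ω c| ≤ B) :
    Integrable (fun ω => Real.exp (∑ r ∈ s, ∑ c,
      (w r ω c * (I.avg r ω i c - deviationMean (I.strat r ω) i c (u i)) -
        w r ω c ^ 2 / (8 * I.batch r ω i)))) μ ∧
    ∫ ω, Real.exp (∑ r ∈ s, ∑ c,
      (w r ω c * (I.avg r ω i c - deviationMean (I.strat r ω) i c (u i)) -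
        w r ω c ^ 2 / (8 * I.batch r ω i))) ∂μ ≤ 1 := by
  let ℱ : Filtration (ℕ ×ₗ (Fin (k i) ×ₗ ℕ)) mΩ :=
    ⟨fun t => I.hist (exploredSlot i t),
      fun _ _ h => I.hist.mono ((strictMono_exploredSlot i).monotone h), fun _ => I.hist.le _⟩
  let S : Finset (ℕ ×ₗ (Fin (k i) ×ₗ ℕ)) := (s ×ˢ Finset.univ ×ˢ Finset.range K).map
    ((Equiv.prodCongr (Equiv.refl ℕ) toLex).trans toLex).toEmbedding
  let q (t : ℕ ×ₗ (Fin (k i) ×ₗ ℕ)) (ω : Ω) : ℝ :=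
    deviationMean (I.strat (ofLex t).1 ω) i (ofLex (ofLex t).2).1 (u i)
  have hsum (ω : Ω) : ∑ t ∈ S, hoeffdingTerm (playWeight I i w t ω)
      (I.fb (exploredSlot i t) ω i) (q t ω) =
      ∑ r ∈ s, ∑ c, (w r ω c * (I.avg r ω i c - deviationMean (I.strat r ω) i c (u i)) -
        w r ω c ^ 2 / (8 * I.batch r ω i)) :=
    (sum_map_toLex _ _ _ _).trans <| Finset.sum_congr rfl fun r hr => Finset.sum_congr rfl
      fun c _ => sum_hoeffdingTerm_batch (hpos r hr ω) (hK r hr ω) (w r ω c)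
        (deviationMean (I.strat r ω) i c (u i)) fun m => I.fb (slot r i c m) ω i
  have hround (t) (ht : t ∈ S) : (ofLex t).1 ∈ s := by
    obtain ⟨x, hx, rfl⟩ := Finset.mem_map.1 ht
    exact (Finset.mem_product.1 hx).1
  have hstart (t) : I.hist (slot (ofLex t).1 0 0 0) ≤ ℱ t :=
    I.hist.mono (slot_zero_le _ i (ofLex (ofLex t).2).1 (ofLex (ofLex t).2).2)
  simpa only [hsum] using integral_exp_sum_hoeffdingTerm_le_one ℱ S
    (f := fun t ω => I.fb (exploredSlot i t) ω i) (q := q) (fun t _ => hI.measurable_fb _ _ _ _ i)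
    (fun t _ t' h => (measurable_pi_apply i).comp (hI.fb_meas _ _ (strictMono_exploredSlot i h)))
    (fun t _ ω => hI.fb_mem _ ω i)
    (fun t ht => (hI.measurable_deviationMean (hs _ (hround t ht)) i _ (u i)).mono
      (hstart t) le_rfl)
    (fun t ht ω => deviationMean_mem_Icc (hstrat _ (hround t ht) ω) i _ hu)
    (fun t ht => (hI.measurable_playWeight (hs _ (hround t ht)) (hw _ (hround t ht))).mono
      (hstart t) le_rfl)
    (fun t ht ω => abs_playWeight_le I (hpos _ (hround t ht) ω) (hwB _ (hround t ht) ω))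
    fun t ht => (hI.condExp_fb (hs _ (hround t ht)) i _ _ i).mono fun ω hω hl => hω <| by
      contrapose! hl
      exact if_neg hl.not_gt

end Interaction.IsBandit

end Feedback

/-! ### Exponential weights and swap regret -/

section ExponentialWeights

variable {n : ℕ}

/-- The log-sum-exp potential of exponential weights with learning rate `h`, normalized so that it
is at most `max U`. Its increments bound the gains of exponential weights from below. -/
noncomputable def hedgePotential (h : ℝ) (U : Fin n → ℝ) : ℝ :=
  Real.log (∑ c, (1 / n : ℝ) * Real.exp (h * U c)) / h

theorem sum_exp_pos (hn : 0 < n) (U : Fin n → ℝ) : 0 < ∑ c, Real.exp (U c) :=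
  Finset.sum_pos (fun _ _ => Real.exp_pos _) ⟨⟨0, hn⟩, Finset.mem_univ _⟩

theorem softmax_pos (hn : 0 < n) (h : ℝ) (U : Fin n → ℝ) (a : Fin n) : 0 < softmax h U a :=
  div_pos (Real.exp_pos _) (sum_exp_pos hn fun c => h * U c)

theorem softmax_mem_stdSimplex (hn : 0 < n) (h : ℝ) (U : Fin n → ℝ) :
    softmax h U ∈ stdSimplex ℝ (Fin n) := by
  refine ⟨fun a => (softmax_pos hn h U a).le, ?_⟩
  simp only [softmax, ← Finset.sum_div]
  exact div_self (sum_exp_pos hn fun c => h * U c).ne'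

theorem sum_one_div_mul_exp_pos (hn : 0 < n) (U : Fin n → ℝ) :
    0 < ∑ c, (1 / n : ℝ) * Real.exp (U c) := by
  rw [← Finset.mul_sum]
  exact mul_pos (one_div_pos.2 (Nat.cast_pos.2 hn)) (sum_exp_pos hn U)

theorem hedgePotential_mono_rate (hn : 0 < n) {h h' : ℝ} (hh : 0 < h) (hle : h ≤ h')
    (U : Fin n → ℝ) : hedgePotential h U ≤ hedgePotential h' U := by
  have hn' : (0 : ℝ) < n := Nat.cast_pos.2 hn
  have hpos := sum_one_div_mul_exp_pos hn fun c => h * U c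
  have hpower := Real.rpow_arith_mean_le_arith_mean_rpow Finset.univ (fun _ : Fin n => (1 / n : ℝ))
    (fun c => Real.exp (h * U c)) (fun _ _ => (one_div_pos.2 hn').le) (by simp [hn'.ne'])
    (fun _ _ => (Real.exp_pos _).le) ((one_le_div hh).2 hle)
  have hrate (c : Fin n) : h * U c * (h' / h) = h' * U c := by field_simp
  simp only [← Real.exp_mul, hrate] at hpower
  have hlog := Real.log_le_log (Real.rpow_pos_of_pos hpos _) hpower
  rw [Real.log_rpow hpos, div_mul_eq_mul_div, div_le_iff₀ hh] at hlog
  unfold hedgePotential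
  rw [div_le_div_iff₀ hh (hh.trans_le hle)]
  linarith

theorem le_hedgePotential_add (hn : 0 < n) {h : ℝ} (hh : 0 < h) (U : Fin n → ℝ) (c : Fin n) :
    U c ≤ hedgePotential h U + Real.log n / h := by
  have hn' : (0 : ℝ) < n := Nat.cast_pos.2 hn
  have hcancel : 1 / (n : ℝ) * (∑ c, Real.exp (h * U c)) * n = ∑ c, Real.exp (h * U c) := by
    field_simp
  unfold hedgePotential
  rw [← add_div, le_div_iff₀ hh,
    ← Real.log_mul (sum_one_div_mul_exp_pos hn fun c => h * U c).ne' hn'.ne', ← Finset.mul_sum,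
    hcancel, Real.le_log_iff_exp_le (sum_exp_pos hn fun c => h * U c), mul_comm]
  exact Finset.single_le_sum (f := fun c => Real.exp (h * U c)) (fun _ _ => (Real.exp_pos _).le)
    (Finset.mem_univ c)

theorem hedgePotential_le (hn : 0 < n) {h : ℝ} (hh : 0 < h) {U : Fin n → ℝ} {w : ℝ}
    (hU : ∀ c, U c ≤ w) : hedgePotential h U ≤ w := by
  have hn' : (0 : ℝ) < n := Nat.cast_pos.2 hn
  unfold hedgePotential
  rw [div_le_iff₀ hh, Real.log_le_iff_le_exp (sum_one_div_mul_exp_pos hn fun c => h * U c)]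
  calc ∑ c, (1 / n : ℝ) * Real.exp (h * U c) ≤ ∑ _c : Fin n, (1 / n : ℝ) * Real.exp (w * h) := by
        refine Finset.sum_le_sum fun c _ =>
          mul_le_mul_of_nonneg_left (Real.exp_le_exp.2 ?_) (one_div_pos.2 hn').le
        rw [mul_comm]
        exact mul_le_mul_of_nonneg_right (hU c) hh.le
    _ = Real.exp (w * h) := by
        simp only [Finset.sum_const, Finset.card_univ, Fintype.card_fin, nsmul_eq_mul]
        field_simp

theorem sum_mul_exp_pos {s : Fin n → ℝ} (hs : s ∈ stdSimplex ℝ (Fin n)) (x : Fin n → ℝ) :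
    0 < ∑ a, s a * Real.exp (x a) := by
  have hnonneg (a : Fin n) : 0 ≤ s a * Real.exp (x a) := mul_nonneg (hs.1 a) (Real.exp_pos _).le
  refine lt_of_le_of_ne (Finset.sum_nonneg fun a _ => hnonneg a) fun h0 => ?_
  have hzero (a : Fin n) : s a = 0 := by
    simpa using (Finset.sum_eq_zero_iff_of_nonneg fun a _ => hnonneg a).1 h0.symm a
      (Finset.mem_univ a)
  simpa [hzero] using hs.2

theorem log_sum_mul_exp_le {s x : Fin n → ℝ} (hs : s ∈ stdSimplex ℝ (Fin n)) {w : ℝ}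
    (hxw : ∀ a, x a ≤ w) : Real.log (∑ a, s a * Real.exp (x a)) ≤ w := by
  rw [Real.log_le_iff_le_exp (sum_mul_exp_pos hs x)]
  calc ∑ a, s a * Real.exp (x a) ≤ ∑ a, s a * Real.exp w := by
        gcongr with a
        exacts [hs.1 a, hxw a]
    _ = Real.exp w := by rw [← Finset.sum_mul, hs.2, one_mul]

theorem log_sum_mul_exp_le_add_sq {s x : Fin n → ℝ} (hs : s ∈ stdSimplex ℝ (Fin n)) {w : ℝ}
    (hx0 : ∀ a, 0 ≤ x a) (hxw : ∀ a, x a ≤ w) (hw : w ≤ 1) :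
    Real.log (∑ a, s a * Real.exp (x a)) ≤ ∑ a, s a * x a + w ^ 2 := by
  have hexp (a : Fin n) : Real.exp (x a) ≤ 1 + x a + w ^ 2 := by
    have htaylor := (abs_le.1 (Real.abs_exp_sub_one_sub_id_le
      ((abs_of_nonneg (hx0 a)).trans_le ((hxw a).trans hw)))).2
    linarith [pow_le_pow_left₀ (hx0 a) (hxw a) 2]
  have hsum : ∑ a, s a * Real.exp (x a) ≤ 1 + ∑ a, s a * x a + w ^ 2 := by
    calc ∑ a, s a * Real.exp (x a) ≤ ∑ a, s a * (1 + x a + w ^ 2) :=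
          Finset.sum_le_sum fun a _ => mul_le_mul_of_nonneg_left (hexp a) (hs.1 a)
      _ = 1 + ∑ a, s a * x a + w ^ 2 := by
          simp only [mul_add, Finset.sum_add_distrib, ← Finset.sum_mul, hs.2, one_mul, mul_one]
  linarith [Real.log_le_sub_one_of_pos (sum_mul_exp_pos hs x)]

theorem log_sum_mul_exp_div_le {s g : Fin n → ℝ} (hs : s ∈ stdSimplex ℝ (Fin n)) {h w : ℝ}
    (hh : 0 < h) (hg0 : ∀ a, 0 ≤ g a) (hgw : ∀ a, g a ≤ w) :
    Real.log (∑ a, s a * Real.exp (h * g a)) / h ≤ ∑ a, s a * g a + min w (h * w ^ 2) := by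
  have hscaled (a : Fin n) : h * g a ≤ h * w := mul_le_mul_of_nonneg_left (hgw a) hh.le
  have hmean : 0 ≤ ∑ a, s a * g a := Finset.sum_nonneg fun a _ => mul_nonneg (hs.1 a) (hg0 a)
  have hlinear := log_sum_mul_exp_le hs hscaled
  rw [div_le_iff₀ hh]
  rcases min_cases w (h * w ^ 2) with ⟨hmin, -⟩ | ⟨hmin, hlt⟩
  · rw [hmin]
    nlinarith
  · have hw : 0 < w := by
      by_contra! hw
      nlinarith [sq_nonneg w]
    have hw1 : h * w ≤ 1 := by nlinarith
    have hquadratic := log_sum_mul_exp_le_add_sq hs (fun a => mul_nonneg hh.le (hg0 a)) hscaled hw1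
    simp only [mul_left_comm _ h, ← Finset.mul_sum] at hquadratic
    rw [hmin]
    linarith

theorem hedgePotential_add_le (hn : 0 < n) {h : ℝ} (hh : 0 < h) (U : Fin n → ℝ) {g : Fin n → ℝ}
    {w : ℝ} (hg0 : ∀ c, 0 ≤ g c) (hgw : ∀ c, g c ≤ w) :
    hedgePotential h (fun c => U c + g c) ≤
      hedgePotential h U + (∑ a, softmax h U a * g a + min w (h * w ^ 2)) := by
  have hs := softmax_mem_stdSimplex hn h U
  have hratio : ∑ c, (1 / n : ℝ) * Real.exp (h * (U c + g c)) =
      (∑ c, (1 / n : ℝ) * Real.exp (h * U c)) * ∑ a, softmax h U a * Real.exp (h * g a) := by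
    simp only [← Finset.mul_sum, mul_assoc, softmax, mul_add, Real.exp_add, div_mul_eq_mul_div,
      ← Finset.sum_div]
    rw [mul_div_cancel₀ _ (sum_exp_pos hn fun c => h * U c).ne']
  have hgain := log_sum_mul_exp_div_le hs hh hg0 hgw
  unfold hedgePotential
  rw [hratio, Real.log_mul (sum_one_div_mul_exp_pos hn fun c => h * U c).ne'
    (sum_mul_exp_pos hs fun a => h * g a).ne', add_div]
  linarith

theorem hedge_regret (hn : 0 < n) (g : ℕ → Fin n → ℝ) (w h : ℕ → ℝ) (m : ℕ)
    (hh : ∀ t ≤ m, 0 < h t) (hanti : ∀ t < m, h (t + 1) ≤ h t)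
    (hg0 : ∀ t ≤ m, ∀ c, 0 ≤ g t c) (hgw : ∀ t ≤ m, ∀ c, g t c ≤ w t) (c : Fin n) :
    ∑ τ ∈ Finset.range (m + 1), g τ c ≤ w 0 + Real.log n / h m +
      ∑ t ∈ Finset.range m,
        (∑ a, softmax (h t) (fun c => ∑ τ ∈ Finset.range (t + 1), g τ c) a * g (t + 1) a +
          min (w (t + 1)) (h t * w (t + 1) ^ 2)) := by
  have hpotential : ∀ j ≤ m, hedgePotential (h j) (fun c => ∑ τ ∈ Finset.range (j + 1), g τ c) ≤
      w 0 + ∑ t ∈ Finset.range j,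
        (∑ a, softmax (h t) (fun c => ∑ τ ∈ Finset.range (t + 1), g τ c) a * g (t + 1) a +
          min (w (t + 1)) (h t * w (t + 1) ^ 2)) := by
    intro j
    induction j with
    | zero =>
      intro h0
      simpa using hedgePotential_le hn (hh 0 h0) (hgw 0 h0)
    | succ j ih =>
      intro hj
      have hrate := hedgePotential_mono_rate hn (hh (j + 1) hj) (hanti j hj)
        (fun c => ∑ τ ∈ Finset.range (j + 1 + 1), g τ c)
      have hstep := hedgePotential_add_le hn (hh j (by lia))
        (fun c => ∑ τ ∈ Finset.range (j + 1), g τ c) (hg0 _ hj) (hgw _ hj)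
      rw [Finset.sum_range_succ]
      simp only [Finset.sum_range_succ _ (j + 1)] at hrate ⊢
      linarith [ih (by lia)]
  have hbest := le_hedgePotential_add hn (hh m le_rfl)
    (fun c => ∑ τ ∈ Finset.range (m + 1), g τ c) c
  linarith [hpotential m le_rfl]

end ExponentialWeights

section AdaptiveRate

theorem div_add_le_log_sub_log {S w : ℝ} (hS : 0 < S) (hw : 0 ≤ w) :
    w / (S + w) ≤ Real.log (S + w) - Real.log S := by
  have hSw : 0 < S + w := by linarith
  have hlog := Real.one_sub_inv_le_log_of_pos (div_pos hSw hS)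
  rw [Real.log_div hSw.ne' hS.ne', inv_div] at hlog
  refine le_trans (le_of_eq ?_) hlog
  field_simp
  ring

theorem min_max_div_mul_sq_le {S w B e : ℝ} (hS : 0 < S) (hw0 : 0 ≤ w) (hw1 : w ≤ 1) (hB : 1 ≤ B)
    (he : 0 ≤ e) :
    min w (max (B / S) e * w ^ 2) ≤ e * w + 2 * B * (Real.log (S + w) - Real.log S) := by
  have hB0 : 0 < B := by linarith
  have hSw : 0 < S + w := by linarith
  have hlog := mul_le_mul_of_nonneg_left (div_add_le_log_sub_log hS hw0) (by linarith : 0 ≤ 2 * B)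
  rcases le_total w S with hle | hle
  · have hmax : max (B / S) e ≤ B / S + e := max_le_add_of_nonneg (div_pos hB0 hS).le he
    have hfirst : B / S * w ^ 2 ≤ 2 * B * (w / (S + w)) := by
      rw [div_mul_eq_mul_div, mul_div_assoc', div_le_div_iff₀ hS hSw]
      have hsum : w * (S + w) ≤ 2 * S := by nlinarith
      nlinarith [mul_le_mul_of_nonneg_left hsum (mul_nonneg hB0.le hw0)]
    have hsecond : e * w ^ 2 ≤ e * w := mul_le_mul_of_nonneg_left (by nlinarith) he
    refine (min_le_right _ _).trans ?_
    linarith [mul_le_mul_of_nonneg_right hmax (sq_nonneg w)]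
  · have hhalf : 1 ≤ 2 * (w / (S + w)) := by
      rw [mul_div_assoc', le_div_iff₀ hSw]
      linarith
    refine (min_le_left _ _).trans ?_
    nlinarith [mul_nonneg he hw0]

theorem sum_one_div_sqrt_le (m : ℕ) :
    ∑ t ∈ Finset.range m, 1 / √((t + 1 : ℕ) : ℝ) ≤ 2 * √m := by
  induction m with
  | zero => simp
  | succ m ih =>
    have hpos : 0 < √((m + 1 : ℕ) : ℝ) := Real.sqrt_pos.2 (by positivity)
    have hsq : √((m + 1 : ℕ) : ℝ) ^ 2 = √(m : ℝ) ^ 2 + 1 := by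
      rw [Real.sq_sqrt (Nat.cast_nonneg _), Real.sq_sqrt (Nat.cast_nonneg _)]
      exact Nat.cast_succ m
    have hstep : 1 / √((m + 1 : ℕ) : ℝ) ≤ 2 * √((m + 1 : ℕ) : ℝ) - 2 * √m := by
      rw [div_le_iff₀ hpos]
      nlinarith [sq_nonneg (√((m + 1 : ℕ) : ℝ) - √m)]
    rw [Finset.sum_range_succ]
    linarith

theorem sum_sqrt_div_le {E : ℝ} (hE : 0 ≤ E) (m : ℕ) :
    ∑ t ∈ Finset.range m, √(E / (t + 1 : ℕ)) ≤ 2 * √(E * m) := by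
  simp only [Real.sqrt_div hE, ← mul_one_div √E]
  rw [← Finset.mul_sum, Real.sqrt_mul hE]
  linarith [mul_le_mul_of_nonneg_left (sum_one_div_sqrt_le m) (Real.sqrt_nonneg E)]

/-- The learning rate, after rounds `0, …, t`, of an expert whose gains in round `τ` are scaled by
`w τ`: the larger of `B / ∑_{τ ≤ t} w τ` and `√(E / (t + 1))`. -/
noncomputable def expertRate (B E : ℝ) (w : ℕ → ℝ) (t : ℕ) : ℝ :=
  max (B / ∑ τ ∈ Finset.range (t + 1), w τ) √(E / (t + 1 : ℕ))

variable {w : ℕ → ℝ} {m : ℕ} {p B E : ℝ}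

theorem le_sum_range_succ (hp : p ≤ w 0) (hw : ∀ t ≤ m, 0 ≤ w t) {t : ℕ} (ht : t ≤ m) :
    p ≤ ∑ τ ∈ Finset.range (t + 1), w τ :=
  hp.trans <| Finset.single_le_sum (f := w)
    (fun τ hτ => hw τ ((Finset.mem_range_succ_iff.1 hτ).trans ht))
    (Finset.mem_range.2 t.succ_pos)

theorem expertRate_pos (hp : 0 < p) (hB : 0 < B) (hpw : p ≤ w 0) (hw : ∀ t ≤ m, 0 ≤ w t) {t : ℕ}
    (ht : t ≤ m) : 0 < expertRate B E w t :=
  lt_max_of_lt_left (div_pos hB (hp.trans_le (le_sum_range_succ hpw hw ht)))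

theorem expertRate_succ_le (hp : 0 < p) (hB : 0 ≤ B) (hE : 0 ≤ E) (hpw : p ≤ w 0)
    (hw : ∀ t ≤ m, 0 ≤ w t) {t : ℕ} (ht : t < m) :
    expertRate B E w (t + 1) ≤ expertRate B E w t := by
  refine max_le_max ?_ (Real.sqrt_le_sqrt ?_)
  · refine div_le_div_of_nonneg_left hB (hp.trans_le (le_sum_range_succ hpw hw ht.le)) ?_
    rw [Finset.sum_range_succ _ (t + 1)]
    exact le_add_of_nonneg_right (hw (t + 1) ht)
  · exact div_le_div_of_nonneg_left hE (by positivity) (Nat.cast_le.2 t.succ.le_succ)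

theorem sum_log_sum_range_sub_le (hp : 0 < p) (hpw : p ≤ w 0) (hw : ∀ t ≤ m, w t ∈ Set.Icc 0 1) :
    ∑ t ∈ Finset.range m, (Real.log (∑ τ ∈ Finset.range (t + 1 + 1), w τ) -
      Real.log (∑ τ ∈ Finset.range (t + 1), w τ)) ≤ Real.log ((m + 1 : ℕ) / p) := by
  have hfinal : ∑ τ ∈ Finset.range (m + 1), w τ ≤ (m + 1 : ℕ) := by
    simpa using Finset.sum_le_card_nsmul (Finset.range (m + 1)) w 1 fun τ hτ =>
      (hw τ (Finset.mem_range_succ_iff.1 hτ)).2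
  have hpos := hp.trans_le (le_sum_range_succ hpw (fun t ht => (hw t ht).1) le_rfl)
  rw [Finset.sum_range_sub (fun t => Real.log (∑ τ ∈ Finset.range (t + 1), w τ)),
    Real.log_div (by positivity) hp.ne']
  exact sub_le_sub (Real.log_le_log hpos hfinal) (Real.log_le_log hp (by simpa using hpw))

theorem sum_div_sum_range_le (hp : 0 < p) (hpw : p ≤ w 0) (hw : ∀ t ≤ m, w t ∈ Set.Icc 0 1) :
    ∑ t ∈ Finset.range (m + 1), w t / ∑ τ ∈ Finset.range (t + 1), w τ ≤
      1 + Real.log ((m + 1 : ℕ) / p) := by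
  have hlater : ∑ t ∈ Finset.range m, w (t + 1) / ∑ τ ∈ Finset.range (t + 1 + 1), w τ ≤
      ∑ t ∈ Finset.range m, (Real.log (∑ τ ∈ Finset.range (t + 1 + 1), w τ) -
        Real.log (∑ τ ∈ Finset.range (t + 1), w τ)) := by
    refine Finset.sum_le_sum fun t ht => ?_
    have ht' : t < m := Finset.mem_range.1 ht
    rw [Finset.sum_range_succ _ (t + 1)]
    exact div_add_le_log_sub_log
      (hp.trans_le (le_sum_range_succ hpw (fun t ht => (hw t ht).1) ht'.le)) (hw (t + 1) ht').1
  rw [Finset.sum_range_succ', zero_add, Finset.sum_range_one, div_self (hp.trans_le hpw).ne']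
  linarith [sum_log_sum_range_sub_le hp hpw hw]

variable {n : ℕ}

theorem expert_regret (hn : 0 < n) (v : ℕ → Fin n → ℝ) (hp : 0 < p) (hB : 1 ≤ B) (hE : 0 ≤ E)
    (hpw : p ≤ w 0) (hw : ∀ t ≤ m, w t ∈ Set.Icc 0 1)
    (hv : ∀ t ≤ m, ∀ c, v t c ∈ Set.Icc (0 : ℝ) 1) (c : Fin n) :
    ∑ τ ∈ Finset.range (m + 1), v τ c * w τ ≤ w 0 + Real.log n / expertRate B E w m +
      ∑ t ∈ Finset.range m, ∑ a, softmax (expertRate B E w t)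
        (fun c => ∑ τ ∈ Finset.range (t + 1), v τ c * w τ) a * (v (t + 1) a * w (t + 1)) +
      ∑ t ∈ Finset.range m, √(E / (t + 1 : ℕ)) * w (t + 1) +
      2 * B * Real.log ((m + 1 : ℕ) / p) := by
  have hw0 (t : ℕ) (ht : t ≤ m) : 0 ≤ w t := (hw t ht).1
  have hregret := hedge_regret hn (fun t c => v t c * w t) w (expertRate B E w) m
    (fun t => expertRate_pos hp (by linarith) hpw hw0)
    (fun t => expertRate_succ_le hp (by linarith) hE hpw hw0)
    (fun t ht c => mul_nonneg (hv t ht c).1 (hw0 t ht))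
    (fun t ht c => mul_le_of_le_one_left (hw0 t ht) (hv t ht c).2) c
  have hstability : ∑ t ∈ Finset.range m, min (w (t + 1)) (expertRate B E w t * w (t + 1) ^ 2) ≤
      ∑ t ∈ Finset.range m, (√(E / (t + 1 : ℕ)) * w (t + 1) +
        2 * B * (Real.log (∑ τ ∈ Finset.range (t + 1 + 1), w τ) -
          Real.log (∑ τ ∈ Finset.range (t + 1), w τ))) := by
    refine Finset.sum_le_sum fun t ht => ?_
    have ht' : t < m := Finset.mem_range.1 ht
    rw [Finset.sum_range_succ _ (t + 1)]
    exact min_max_div_mul_sq_le (hp.trans_le (le_sum_range_succ hpw hw0 ht'.le))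
      (hw (t + 1) ht').1 (hw (t + 1) ht').2 hB (Real.sqrt_nonneg _)
  rw [Finset.sum_add_distrib] at hregret
  rw [Finset.sum_add_distrib, ← Finset.mul_sum] at hstability
  have htelescope := mul_le_mul_of_nonneg_left (sum_log_sum_range_sub_le hp hpw hw)
    (by linarith : 0 ≤ 2 * B)
  linarith

theorem log_div_le_sqrt_div {h : ℝ} (hn : 0 < n) (hE : 0 ≤ E) (hnE : n * Real.log n ≤ E)
    (hh : 0 < h) (hle : √(E / (m + 1 : ℕ)) ≤ h) :
    Real.log n / h ≤ √(E * (m + 1 : ℕ)) / n := by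
  have hsqrt : √(E * (m + 1 : ℕ)) * √(E / (m + 1 : ℕ)) = E := by
    have hscale : E * (m + 1 : ℕ) * (E / (m + 1 : ℕ)) = E * E := by field_simp
    rw [← Real.sqrt_mul (by positivity), hscale, Real.sqrt_mul_self hE]
  rw [div_le_div_iff₀ hh (Nat.cast_pos.2 hn), mul_comm]
  exact hnE.trans (hsqrt.ge.trans (mul_le_mul_of_nonneg_left hle (Real.sqrt_nonneg _)))

theorem sum_sum_sqrt_div_mul_le (hE : 0 ≤ E) {θ : ℕ → Fin n → ℝ}
    (hθ : ∀ t ≤ m, θ t ∈ stdSimplex ℝ (Fin n)) :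
    ∑ b, ∑ t ∈ Finset.range m, √(E / (t + 1 : ℕ)) * θ (t + 1) b ≤ 2 * √(E * (m + 1 : ℕ)) := by
  rw [Finset.sum_comm]
  calc ∑ t ∈ Finset.range m, ∑ b, √(E / (t + 1 : ℕ)) * θ (t + 1) b
      = ∑ t ∈ Finset.range m, √(E / (t + 1 : ℕ)) := Finset.sum_congr rfl fun t ht => by
        rw [← Finset.mul_sum, (hθ (t + 1) (Finset.mem_range.1 ht)).2, mul_one]
    _ ≤ 2 * √(E * m) := sum_sqrt_div_le hE m
    _ ≤ 2 * √(E * (m + 1 : ℕ)) := by gcongr; exact m.le_succ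

theorem swap_regret (hn : 0 < n) (θ v : ℕ → Fin n → ℝ) (m : ℕ) (hp : 0 < p) (hB : 1 ≤ B)
    (hE : 0 ≤ E) (hnE : n * Real.log n ≤ E) (hθ : ∀ t ≤ m, θ t ∈ stdSimplex ℝ (Fin n))
    (hpθ : ∀ b, p ≤ θ 0 b) (hv : ∀ t ≤ m, ∀ c, v t c ∈ Set.Icc (0 : ℝ) 1)
    (hfix : ∀ t < m, ∀ a, θ (t + 1) a = ∑ b, softmax (expertRate B E (fun τ => θ τ b) t)
      (fun c => ∑ τ ∈ Finset.range (t + 1), v τ c * θ τ b) a * θ (t + 1) b)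
    (φ : Fin n → Fin n) :
    ∑ t ∈ Finset.range (m + 1), ∑ b, θ t b * (v t (φ b) - v t b) ≤
      1 + 3 * √(E * (m + 1 : ℕ)) + 2 * n * B * Real.log ((m + 1 : ℕ) / p) := by
  have hregret := Finset.sum_le_sum fun b (_ : b ∈ Finset.univ) =>
    expert_regret hn v hp hB hE (hpθ b) (fun t ht => mem_Icc_of_mem_stdSimplex (hθ t ht) b) hv (φ b)
  simp only [Finset.sum_add_distrib, (hθ 0 m.zero_le).2, Finset.sum_const, Finset.card_univ,
    Fintype.card_fin, nsmul_eq_mul] at hregret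
  have hinitial : ∑ b, Real.log n / expertRate B E (fun τ => θ τ b) m ≤ √(E * (m + 1 : ℕ)) := by
    have hexpert (b : Fin n) : Real.log n / expertRate B E (fun τ => θ τ b) m ≤
        √(E * (m + 1 : ℕ)) / n :=
      log_div_le_sqrt_div hn hE hnE (expertRate_pos hp (zero_lt_one.trans_le hB) (hpθ b)
        (fun t ht => (hθ t ht).1 b) le_rfl) (le_max_right _ _)
    refine (Finset.sum_le_card_nsmul _ _ _ fun b _ => hexpert b).trans_eq ?_
    rw [Finset.card_univ, Fintype.card_fin, nsmul_eq_mul, mul_div_cancel₀ _ (by positivity)]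
  have hfixed : ∑ b, ∑ t ∈ Finset.range m, ∑ a, softmax (expertRate B E (fun τ => θ τ b) t)
      (fun c => ∑ τ ∈ Finset.range (t + 1), v τ c * θ τ b) a * (v (t + 1) a * θ (t + 1) b) =
      ∑ t ∈ Finset.range m, ∑ a, θ (t + 1) a * v (t + 1) a := by
    rw [Finset.sum_comm]
    refine Finset.sum_congr rfl fun t ht => ?_
    rw [Finset.sum_comm]
    refine Finset.sum_congr rfl fun a _ => ?_
    rw [hfix t (Finset.mem_range.1 ht) a, Finset.sum_mul]
    exact Finset.sum_congr rfl fun b _ => by ring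
  have hsqrt := sum_sum_sqrt_div_mul_le hE hθ
  have hfirst : 0 ≤ ∑ a, θ 0 a * v 0 a := Finset.sum_nonneg fun a _ =>
    mul_nonneg ((hθ 0 m.zero_le).1 a) (hv 0 m.zero_le a).1
  have hsplit : ∑ t ∈ Finset.range (m + 1), ∑ b, θ t b * (v t (φ b) - v t b) =
      (∑ b, ∑ τ ∈ Finset.range (m + 1), v τ (φ b) * θ τ b) -
        (∑ t ∈ Finset.range m, ∑ a, θ (t + 1) a * v (t + 1) a + ∑ a, θ 0 a * v 0 a) := by
    rw [← Finset.sum_range_succ' (fun t => ∑ a, θ t a * v t a) m,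
      Finset.sum_comm (s := Finset.univ)]
    simp only [mul_sub, Finset.sum_sub_distrib, mul_comm]
  linarith

end AdaptiveRate

/-! ### Parameters and sample complexity -/

/-- The standing assumptions of the theorem on the game and on the parameters. -/
structure Admissible {N : ℕ} (k : Fin N → ℕ) (ε Δ δ : ℝ) : Prop where
  N_pos : 0 < N
  k_pos : ∀ i, 0 < k i
  ε_pos : 0 < ε
  ε_le : ε ≤ 1
  Δ_pos : 0 < Δ
  Δ_le : Δ ≤ 1
  δ_pos : 0 < δ
  δ_lt : δ < 1

/-- The number `T` of rounds of adaptive Hedge, with explicit constants that make the analysis go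
through. -/
noncomputable abbrev numRounds {N : ℕ} (k : Fin N → ℕ) (ε Δ δ : ℝ) : ℕ := ceRounds 4096 2 k ε Δ δ

namespace Admissible

variable {N : ℕ} {k : Fin N → ℕ} {ε Δ δ : ℝ}

theorem one_le_N (h : Admissible k ε Δ δ) : (1 : ℝ) ≤ N := Nat.one_le_cast.2 h.N_pos

theorem one_le_maxActions (h : Admissible k ε Δ δ) : (1 : ℝ) ≤ maxActions k :=
  Nat.one_le_cast.2 ((h.k_pos ⟨0, h.N_pos⟩).trans_le (le_maxActions k _))

theorem one_le_N_mul_maxActions (h : Admissible k ε Δ δ) : (1 : ℝ) ≤ N * maxActions k :=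
  one_le_mul_of_one_le_of_one_le h.one_le_N h.one_le_maxActions

theorem min_pos (h : Admissible k ε Δ δ) : 0 < min ε Δ := lt_min h.ε_pos h.Δ_pos

theorem thr_pos (h : Admissible k ε Δ δ) : 0 < thr k ε Δ := by
  have hN := h.one_le_N
  have hA := h.one_le_maxActions
  exact div_pos h.min_pos (by positivity)

theorem mul_thr_eq (h : Admissible k ε Δ δ) : N * maxActions k * thr k ε Δ = min ε Δ / 8 := by
  have hN := h.one_le_N
  have hA := h.one_le_maxActions
  unfold thr
  field_simp

theorem card_mul_thr_le (h : Admissible k ε Δ δ) (i : Fin N) : k i * thr k ε Δ ≤ 1 / 8 := by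
  have hk : (k i : ℝ) ≤ N * maxActions k :=
    (Nat.cast_le.2 (le_maxActions k i)).trans (le_mul_of_one_le_left (Nat.cast_nonneg _) h.one_le_N)
  linarith [mul_le_mul_of_nonneg_right hk h.thr_pos.le, h.mul_thr_eq,
    (min_le_left ε Δ).trans h.ε_le]

theorem thr_le (h : Admissible k ε Δ δ) : thr k ε Δ ≤ 1 / 8 :=
  (le_mul_of_one_le_left h.thr_pos.le (Nat.one_le_cast.2 (h.k_pos ⟨0, h.N_pos⟩))).trans
    (h.card_mul_thr_le _)

theorem mul_mul_pos (h : Admissible k ε Δ δ) : 0 < ε * Δ * δ :=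
  mul_pos (mul_pos h.ε_pos h.Δ_pos) h.δ_pos

theorem mul_mul_le_δ (h : Admissible k ε Δ δ) : ε * Δ * δ ≤ δ :=
  mul_le_of_le_one_left h.δ_pos.le (mul_le_one₀ h.ε_le h.Δ_pos.le h.Δ_le)

theorem mul_mul_le_min (h : Admissible k ε Δ δ) : ε * Δ * δ ≤ min ε Δ :=
  (mul_le_of_le_one_right (mul_pos h.ε_pos h.Δ_pos).le h.δ_lt.le).trans
    (le_min (mul_le_of_le_one_right h.ε_pos.le h.Δ_le) (mul_le_of_le_one_left h.Δ_pos.le h.ε_le))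

theorem one_le_ratio (h : Admissible k ε Δ δ) : 1 ≤ N * maxActions k / (ε * Δ * δ) :=
  (one_le_div h.mul_mul_pos).2
    ((h.mul_mul_le_δ.trans h.δ_lt.le).trans h.one_le_N_mul_maxActions)

theorem one_le_logFactor (h : Admissible k ε Δ δ) : 1 ≤ logFactor k ε Δ δ :=
  le_add_of_nonneg_right (Real.log_nonneg h.one_le_ratio)

theorem log_le_of_le_mul_pow (h : Admissible k ε Δ δ) {y C : ℝ} {m : ℕ} (hy : 0 < y) (hC : 0 < C)
    (hle : y ≤ C * (N * maxActions k / (ε * Δ * δ)) ^ m) :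
    Real.log y ≤ Real.log C + m * (logFactor k ε Δ δ - 1) := by
  have hratio := h.one_le_ratio
  refine (Real.log_le_log hy hle).trans_eq ?_
  rw [Real.log_mul hC.ne' (by positivity), Real.log_pow, logFactor]
  ring

theorem log_one_div_thr_le (h : Admissible k ε Δ δ) :
    Real.log (1 / thr k ε Δ) ≤ 3 * logFactor k ε Δ δ := by
  have hNA := h.one_le_N_mul_maxActions
  have hle : 1 / thr k ε Δ ≤ 2 ^ 3 * (N * maxActions k / (ε * Δ * δ)) ^ 1 := by
    rw [pow_one, thr, one_div_div, mul_right_comm, mul_assoc, mul_div_assoc]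
    norm_num only
    gcongr
    exacts [h.mul_mul_pos, h.mul_mul_le_min]
  have hlog := h.log_le_of_le_mul_pow (one_div_pos.2 h.thr_pos) (by norm_num) hle
  rw [Real.log_pow] at hlog
  push_cast at hlog
  linarith [h.one_le_logFactor, Real.log_two_lt_d9]

theorem half_le_log_one_div_thr (h : Admissible k ε Δ δ) : 1 / 2 ≤ Real.log (1 / thr k ε Δ) := by
  have htwo : 2 ≤ 1 / thr k ε Δ := by
    rw [le_div_iff₀ h.thr_pos]
    linarith [h.thr_le]
  linarith [Real.log_le_log two_pos htwo, Real.log_two_gt_d9]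

theorem log_div_le (h : Admissible k ε Δ δ) :
    Real.log (N * maxActions k / δ) ≤ logFactor k ε Δ δ := by
  have hNA := h.one_le_N_mul_maxActions
  have hδ := h.δ_pos
  have hle : N * maxActions k / δ ≤ 1 * (N * maxActions k / (ε * Δ * δ)) ^ 1 := by
    rw [pow_one, one_mul]
    exact div_le_div_of_nonneg_left (by positivity) h.mul_mul_pos h.mul_mul_le_δ
  have hlog := h.log_le_of_le_mul_pow (by positivity) one_pos hle
  rw [Real.log_one, Nat.cast_one] at hlog
  linarith

theorem log_maxActions_le (h : Admissible k ε Δ δ) :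
    Real.log (maxActions k) ≤ logFactor k ε Δ δ := by
  have hA := h.one_le_maxActions
  have hle : (maxActions k : ℝ) ≤ N * maxActions k / δ :=
    (le_mul_of_one_le_left (Nat.cast_nonneg _) h.one_le_N).trans
      (le_div_self (by positivity) h.δ_pos h.δ_lt.le)
  exact (Real.log_le_log (by positivity) hle).trans h.log_div_le

theorem div_sq_add_div_sq_le (h : Admissible k ε Δ δ) :
    (maxActions k : ℝ) / ε ^ 2 + maxActions k / Δ ^ 2 ≤ 2 * (maxActions k / min ε Δ ^ 2) := by
  have hmin := h.min_pos
  have hε : (maxActions k : ℝ) / ε ^ 2 ≤ maxActions k / min ε Δ ^ 2 := by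
    gcongr
    exact min_le_left _ _
  have hΔ : (maxActions k : ℝ) / Δ ^ 2 ≤ maxActions k / min ε Δ ^ 2 := by
    gcongr
    exact min_le_right _ _
  linarith

theorem one_le_div_sq_add_div_sq (h : Admissible k ε Δ δ) :
    1 ≤ (maxActions k : ℝ) / ε ^ 2 + maxActions k / Δ ^ 2 := by
  have hε := h.ε_pos
  have hfirst : 1 ≤ (maxActions k : ℝ) / ε ^ 2 :=
    (one_le_div (by positivity)).2 ((pow_le_one₀ hε.le h.ε_le).trans h.one_le_maxActions)
  exact hfirst.trans (le_add_of_nonneg_right (by positivity))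

theorem numRounds_pos (h : Admissible k ε Δ δ) : 0 < numRounds k ε Δ δ := by
  have hsum := h.one_le_div_sq_add_div_sq
  have hΛ := h.one_le_logFactor
  exact Nat.ceil_pos.2 (by positivity)

theorem numRounds_le (h : Admissible k ε Δ δ) :
    (numRounds k ε Δ δ : ℝ) ≤ 16384 * (maxActions k / min ε Δ ^ 2) * logFactor k ε Δ δ ^ 2 := by
  set s : ℝ := maxActions k / ε ^ 2 + maxActions k / Δ ^ 2
  have hone : 1 ≤ s * logFactor k ε Δ δ ^ 2 := one_le_mul_of_one_le_of_one_le
    h.one_le_div_sq_add_div_sq (one_le_pow₀ h.one_le_logFactor)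
  calc (numRounds k ε Δ δ : ℝ) ≤ 4096 * s * logFactor k ε Δ δ ^ 2 + 1 :=
        (Nat.ceil_lt_add_one (by linarith)).le
    _ ≤ 8192 * s * logFactor k ε Δ δ ^ 2 := by linarith
    _ ≤ 8192 * (2 * (maxActions k / min ε Δ ^ 2)) * logFactor k ε Δ δ ^ 2 := by
        gcongr
        exact h.div_sq_add_div_sq_le
    _ = 16384 * (maxActions k / min ε Δ ^ 2) * logFactor k ε Δ δ ^ 2 := by ring

theorem maxActions_div_sq_le (h : Admissible k ε Δ δ) :
    maxActions k / min ε Δ ^ 2 ≤ (N * maxActions k / (ε * Δ * δ)) ^ 2 := by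
  have hA : (maxActions k : ℝ) ≤ N * maxActions k :=
    le_mul_of_one_le_left (Nat.cast_nonneg _) h.one_le_N
  have hNA := h.one_le_N_mul_maxActions
  rw [div_pow]
  exact div_le_div₀ (sq_nonneg _) (hA.trans (le_self_pow₀ hNA two_ne_zero))
    (pow_pos h.mul_mul_pos 2) (pow_le_pow_left₀ h.mul_mul_pos.le h.mul_mul_le_min 2)

theorem log_numRounds_le (h : Admissible k ε Δ δ) :
    Real.log (numRounds k ε Δ δ) ≤ 10 * logFactor k ε Δ δ := by
  have hΛ : 0 < logFactor k ε Δ δ := zero_lt_one.trans_le h.one_le_logFactor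
  have hle : (numRounds k ε Δ δ : ℝ) ≤
      (2 ^ 14 * logFactor k ε Δ δ ^ 2) * (N * maxActions k / (ε * Δ * δ)) ^ 2 := by
    calc (numRounds k ε Δ δ : ℝ)
        ≤ 16384 * (maxActions k / min ε Δ ^ 2) * logFactor k ε Δ δ ^ 2 := h.numRounds_le
      _ = (2 ^ 14 * logFactor k ε Δ δ ^ 2) * (maxActions k / min ε Δ ^ 2) := by ring
      _ ≤ _ := mul_le_mul_of_nonneg_left h.maxActions_div_sq_le (by positivity)
  have hlog := h.log_le_of_le_mul_pow (Nat.cast_pos.2 h.numRounds_pos) (by positivity) hle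
  rw [Real.log_mul (by positivity) (by positivity), Real.log_pow, Real.log_pow] at hlog
  push_cast at hlog
  linarith [h.one_le_logFactor, Real.log_two_lt_d9, Real.log_le_sub_one_of_pos hΛ]

theorem log_numRounds_div_thr_le (h : Admissible k ε Δ δ) :
    Real.log (numRounds k ε Δ δ / thr k ε Δ) ≤ 13 * logFactor k ε Δ δ := by
  rw [div_eq_mul_one_div, Real.log_mul (Nat.cast_pos.2 h.numRounds_pos).ne'
    (one_div_pos.2 h.thr_pos).ne']
  linarith [h.log_numRounds_le, h.log_one_div_thr_le]

theorem log_numRounds_div_thr_nonneg (h : Admissible k ε Δ δ) :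
    0 ≤ Real.log (numRounds k ε Δ δ / thr k ε Δ) :=
  Real.log_nonneg ((one_le_div h.thr_pos).2 (by
    linarith [h.thr_le, (Nat.one_le_cast (α := ℝ)).2 h.numRounds_pos]))

theorem log_batch_arg_pos (h : Admissible k ε Δ δ) {T : ℕ} (hT : 0 < T) :
    0 < Real.log (maxActions k * N * T / δ) := by
  have hAN : (1 : ℝ) ≤ maxActions k * N :=
    one_le_mul_of_one_le_of_one_le h.one_le_maxActions h.one_le_N
  exact Real.log_pos ((one_lt_div h.δ_pos).2
    (h.δ_lt.trans_le (one_le_mul_of_one_le_of_one_le hAN (Nat.one_le_cast.2 hT))))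

theorem log_batch_arg_le (h : Admissible k ε Δ δ) :
    Real.log (maxActions k * N * numRounds k ε Δ δ / δ) ≤ 11 * logFactor k ε Δ δ := by
  have hNA := h.one_le_N_mul_maxActions
  have hδ := h.δ_pos
  rw [mul_comm (maxActions k : ℝ) N, mul_div_right_comm,
    Real.log_mul (by positivity) (Nat.cast_pos.2 h.numRounds_pos).ne']
  linarith [h.log_numRounds_le, h.log_div_le]

end Admissible

section Batches

variable {N : ℕ} {k : Fin N → ℕ} {ε Δ δ : ℝ} {T : ℕ} {θ : ℕ → Weights k} {t : ℕ} {i : Fin N}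

theorem cumWeight_pos {a : Fin (k i)} (hpos : ∀ τ ≤ t, 0 < θ τ i a) : 0 < cumWeight θ t i a :=
  Finset.sum_pos (fun τ hτ => hpos τ (Finset.mem_range_succ_iff.1 hτ))
    ⟨0, Finset.mem_range.2 t.succ_pos⟩

theorem le_cumWeight {a : Fin (k i)} (hpos : ∀ τ ≤ t, 0 < θ τ i a) {τ : ℕ} (hτ : τ ≤ t) :
    θ τ i a ≤ cumWeight θ t i a :=
  Finset.single_le_sum (f := fun τ => θ τ i a)
    (fun τ hτ => (hpos τ (Finset.mem_range_succ_iff.1 hτ)).le) (Finset.mem_range_succ_iff.2 hτ)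

theorem le_ceBatch (θ : ℕ → Weights k) (t : ℕ) (i : Fin N) (a : Fin (k i)) :
    64 * Real.log (maxActions k * N * T / δ) * θ t i a / (Δ ^ 2 * cumWeight θ t i a) ≤
      ceBatch Δ δ T θ t i :=
  (le_ciSup (f := fun a => 64 * Real.log (maxActions k * N * T / δ) * θ t i a /
    (Δ ^ 2 * cumWeight θ t i a)) (Set.finite_range _).bddAbove a).trans (Nat.le_ceil _)

theorem ceBatch_pos (h : Admissible k ε Δ δ) (hT : 0 < T) (hpos : ∀ τ ≤ t, ∀ a, 0 < θ τ i a) :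
    0 < ceBatch Δ δ T θ t i := by
  let a : Fin (k i) := ⟨0, h.k_pos i⟩
  have hbound : 0 < 64 * Real.log (maxActions k * N * T / δ) * θ t i a /
      (Δ ^ 2 * cumWeight θ t i a) :=
    div_pos (mul_pos (mul_pos (by norm_num) (h.log_batch_arg_pos hT)) (hpos t le_rfl a))
      (mul_pos (pow_pos h.Δ_pos 2) (cumWeight_pos fun τ hτ => hpos τ hτ a))
  exact Nat.cast_pos.1 (hbound.trans_le (le_ceBatch θ t i a))

theorem ceBatch_le (h : Admissible k ε Δ δ) (hT : 0 < T) (hnonneg : ∀ τ ≤ t, ∀ a, 0 ≤ θ τ i a) :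
    (ceBatch Δ δ T θ t i : ℝ) ≤ 1 + 64 * Real.log (maxActions k * N * T / δ) / Δ ^ 2 *
      ∑ a, θ t i a / cumWeight θ t i a := by
  have hlog := h.log_batch_arg_pos hT
  have hratio (a : Fin (k i)) : 0 ≤ θ t i a / cumWeight θ t i a :=
    div_nonneg (hnonneg t le_rfl a)
      (Finset.sum_nonneg fun τ hτ => hnonneg τ (Finset.mem_range_succ_iff.1 hτ) a)
  have hsum : 0 ≤ ∑ a, θ t i a / cumWeight θ t i a := Finset.sum_nonneg fun a _ => hratio a
  have hsup : (⨆ a : Fin (k i), 64 * Real.log (maxActions k * N * T / δ) * θ t i a /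
      (Δ ^ 2 * cumWeight θ t i a)) ≤ 64 * Real.log (maxActions k * N * T / δ) / Δ ^ 2 *
      ∑ a, θ t i a / cumWeight θ t i a := by
    refine Real.iSup_le (fun a => ?_) (by positivity)
    rw [mul_div_mul_comm]
    exact mul_le_mul_of_nonneg_left (Finset.single_le_sum (fun a _ => hratio a)
      (Finset.mem_univ a)) (by positivity)
  calc (ceBatch Δ δ T θ t i : ℝ)
      ≤ (⌈64 * Real.log (maxActions k * N * T / δ) / Δ ^ 2 *
          ∑ a, θ t i a / cumWeight θ t i a⌉₊ : ℝ) := Nat.cast_le.2 (Nat.ceil_le_ceil hsup)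
    _ ≤ _ := (Nat.ceil_lt_add_one (by positivity)).le.trans_eq (add_comm _ _)

theorem sum_ceBatch_le (h : Admissible k ε Δ δ) (hT : 0 < T) {p : ℝ} (hp : 0 < p)
    (hinit : ∀ a, p ≤ θ 0 i a) (hθ : ∀ τ < T, θ τ i ∈ stdSimplex ℝ (Fin (k i))) :
    ∑ t ∈ Finset.range T, (ceBatch Δ δ T θ t i : ℝ) ≤ T +
      64 * Real.log (maxActions k * N * T / δ) / Δ ^ 2 *
        (maxActions k * (1 + Real.log (T / p))) := by
  have hlog := h.log_batch_arg_pos hT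
  obtain ⟨m, rfl⟩ : ∃ m, T = m + 1 := Nat.exists_eq_add_one.2 hT
  have hp1 : p ≤ 1 := (hinit ⟨0, h.k_pos i⟩).trans (mem_Icc_of_mem_stdSimplex (hθ 0 hT) _).2
  have hlogp : 0 ≤ Real.log ((m + 1 : ℕ) / p) :=
    Real.log_nonneg ((one_le_div hp).2 (hp1.trans (Nat.one_le_cast.2 hT)))
  have hratios (a : Fin (k i)) : ∑ t ∈ Finset.range (m + 1), θ t i a / cumWeight θ t i a ≤
      1 + Real.log ((m + 1 : ℕ) / p) :=
    sum_div_sum_range_le hp (hinit a) fun t ht =>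
      mem_Icc_of_mem_stdSimplex (hθ t (Nat.lt_succ_of_le ht)) a
  calc ∑ t ∈ Finset.range (m + 1), (ceBatch Δ δ (m + 1) θ t i : ℝ)
      ≤ ∑ t ∈ Finset.range (m + 1),
          (1 + 64 * Real.log (maxActions k * N * (m + 1 : ℕ) / δ) / Δ ^ 2 *
            ∑ a, θ t i a / cumWeight θ t i a) := Finset.sum_le_sum fun t ht =>
        ceBatch_le h hT fun τ hτ => (hθ τ (hτ.trans_lt (Finset.mem_range.1 ht))).1
    _ = (m + 1 : ℕ) + 64 * Real.log (maxActions k * N * (m + 1 : ℕ) / δ) / Δ ^ 2 *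
          ∑ a, ∑ t ∈ Finset.range (m + 1), θ t i a / cumWeight θ t i a := by
        rw [Finset.sum_add_distrib, ← Finset.mul_sum, Finset.sum_comm]
        simp only [Finset.sum_const, Finset.card_range, nsmul_eq_mul, mul_one]
    _ ≤ (m + 1 : ℕ) + 64 * Real.log (maxActions k * N * (m + 1 : ℕ) / δ) / Δ ^ 2 *
          (k i * (1 + Real.log ((m + 1 : ℕ) / p))) := by
        gcongr
        simpa only [Finset.card_univ, Fintype.card_fin, nsmul_eq_mul] using
          Finset.sum_le_card_nsmul Finset.univ _ _ fun a _ => hratios a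
    _ ≤ _ := by
        gcongr
        exact le_maxActions k i

end Batches

section BestResponseBatch

variable {N : ℕ} {k : Fin N → ℕ} {u : Fin N → Profile k → ℝ} {ε Δ δ : ℝ}

theorem log_ibrBatch_arg_pos (h : Admissible k ε Δ δ) (hL : 0 < elimLength u Δ) :
    0 < Real.log (elimLength u Δ * N * maxActions k / δ) := by
  have hprod : (1 : ℝ) ≤ elimLength u Δ * N * maxActions k :=
    one_le_mul_of_one_le_of_one_le
      (one_le_mul_of_one_le_of_one_le (Nat.one_le_cast.2 hL) h.one_le_N) h.one_le_maxActions
  exact Real.log_pos ((one_lt_div h.δ_pos).2 (h.δ_lt.trans_le hprod))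

theorem ibrBatch_pos (h : Admissible k ε Δ δ) (hL : 0 < elimLength u Δ) : 0 < ibrBatch u Δ δ :=
  Nat.ceil_pos.2 (div_pos (mul_pos (by norm_num) (log_ibrBatch_arg_pos h hL)) (pow_pos h.Δ_pos 2))

theorem log_ibrBatch_arg_le (h : Admissible k ε Δ δ) (hL : 0 < elimLength u Δ) :
    Real.log (elimLength u Δ * N * maxActions k / δ) ≤ 2 * logFactor k ε Δ δ := by
  have hNA := h.one_le_N_mul_maxActions
  have hδ := h.δ_pos
  have : (0 : ℝ) < elimLength u Δ := Nat.cast_pos.2 hL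
  have hLNA : (elimLength u Δ : ℝ) ≤ N * maxActions k := by
    exact_mod_cast elimLength_le
  have hmul : (elimLength u Δ : ℝ) * N * maxActions k ≤ (N * maxActions k) ^ 2 := by
    rw [sq, mul_assoc]
    exact mul_le_mul_of_nonneg_right hLNA (by positivity)
  have hsq : (ε * Δ * δ) ^ 2 ≤ δ :=
    (pow_le_pow_left₀ h.mul_mul_pos.le h.mul_mul_le_δ 2).trans
      (pow_le_of_le_one hδ.le h.δ_lt.le two_ne_zero)
  have hle : (elimLength u Δ : ℝ) * N * maxActions k / δ ≤
      1 * (N * maxActions k / (ε * Δ * δ)) ^ 2 := by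
    rw [one_mul, div_pow]
    exact div_le_div₀ (sq_nonneg _) hmul (pow_pos h.mul_mul_pos 2) hsq
  have hlog := h.log_le_of_le_mul_pow (by rw [mul_assoc]; positivity) one_pos hle
  rw [Real.log_one] at hlog
  push_cast at hlog
  linarith

theorem ibrBatch_le (h : Admissible k ε Δ δ) (hL : 0 < elimLength u Δ) :
    (ibrBatch u Δ δ : ℝ) ≤ 129 * logFactor k ε Δ δ / Δ ^ 2 := by
  have hΔ := h.Δ_pos
  have hlog := log_ibrBatch_arg_pos h hL
  calc (ibrBatch u Δ δ : ℝ)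
      ≤ 64 * Real.log (elimLength u Δ * N * maxActions k / δ) / Δ ^ 2 + 1 :=
        (Nat.ceil_lt_add_one (by positivity)).le
    _ ≤ 64 * (2 * logFactor k ε Δ δ) / Δ ^ 2 + logFactor k ε Δ δ / Δ ^ 2 := by
        gcongr
        · exact log_ibrBatch_arg_le h hL
        · rw [one_le_div (by positivity)]
          exact (pow_le_one₀ hΔ.le h.Δ_le).trans h.one_le_logFactor
    _ = 129 * logFactor k ε Δ δ / Δ ^ 2 := by ring

end BestResponseBatch

namespace IsAdaptiveHedgeRun

variable {N : ℕ} {k : Fin N → ℕ} {Ω : Type*} [MeasurableSpace Ω] {u : Fin N → Profile k → ℝ}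
  {ε Δ δ : ℝ} {T : ℕ} {I : Interaction k Ω} {br : ℕ → Ω → Profile k}

theorem thr_le_strat_init (hrun : IsAdaptiveHedgeRun u ε Δ δ T I br) (h : Admissible k ε Δ δ)
    (ω : Ω) (i : Fin N) (a : Fin (k i)) : thr k ε Δ ≤ I.strat (elimLength u Δ) ω i a := by
  rw [hrun.init]
  have hmass := h.card_mul_thr_le i
  split_ifs <;> linarith

theorem ce_strat_mem (hrun : IsAdaptiveHedgeRun u ε Δ δ T I br) (h : Admissible k ε Δ δ)
    {t : ℕ} (ht : t < T) (ω : Ω) (i : Fin N) :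
    I.strat (elimLength u Δ + t) ω i ∈ stdSimplex ℝ (Fin (k i)) := by
  cases t with
  | zero =>
    refine ⟨fun a => h.thr_pos.le.trans (hrun.thr_le_strat_init h ω i a), ?_⟩
    simp only [add_zero, hrun.init, Finset.sum_add_distrib, ← Finset.mul_sum]
    simp
  | succ t => exact hrun.ce_simplex t ht ω i

theorem strat_mem (hrun : IsAdaptiveHedgeRun u ε Δ δ T I br) (h : Admissible k ε Δ δ)
    {r : ℕ} (hr : r < elimLength u Δ + T) (ω : Ω) (i : Fin N) :
    I.strat r ω i ∈ stdSimplex ℝ (Fin (k i)) := by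
  rcases lt_or_ge r (elimLength u Δ) with hlt | hge
  · rw [hrun.ibr_strat r hlt]
    exact single_mem_stdSimplex ℝ _
  · obtain ⟨t, rfl⟩ := Nat.exists_eq_add_of_le hge
    exact hrun.ce_strat_mem h (by lia) ω i

theorem ce_strat_pos (hrun : IsAdaptiveHedgeRun u ε Δ δ T I br) (h : Admissible k ε Δ δ)
    {t : ℕ} (ht : t < T) (ω : Ω) (i : Fin N) (a : Fin (k i)) :
    0 < I.strat (elimLength u Δ + t) ω i a := by
  cases t with
  | zero => exact h.thr_pos.trans_le (hrun.thr_le_strat_init h ω i a)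
  | succ t =>
    have hs := hrun.ce_simplex t ht ω i
    obtain ⟨b, -, hb⟩ : ∃ b ∈ Finset.univ, 0 < I.strat (elimLength u Δ + (t + 1)) ω i b :=
      Finset.exists_lt_of_sum_lt (f := fun _ => (0 : ℝ)) (by simp [hs.2])
    rw [hrun.ce_fixed t ht ω i a]
    exact Finset.sum_pos' (fun b _ => mul_nonneg (softmax_pos (h.k_pos i) _ _ a).le (hs.1 b))
      ⟨b, Finset.mem_univ b, mul_pos (softmax_pos (h.k_pos i) _ _ a) hb⟩

theorem ce_batch_pos (hrun : IsAdaptiveHedgeRun u ε Δ δ T I br) (h : Admissible k ε Δ δ)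
    {t : ℕ} (ht : t < T) (ω : Ω) (i : Fin N) : 0 < I.batch (elimLength u Δ + t) ω i := by
  rw [hrun.ce_batch t ht]
  exact ceBatch_pos h (by lia) fun τ hτ a => hrun.ce_strat_pos h (by lia) ω i a

theorem ibr_samples_le (hrun : IsAdaptiveHedgeRun u ε Δ δ T I br) (h : Admissible k ε Δ δ)
    (ω : Ω) :
    (I.samples (elimLength u Δ) ω : ℝ) ≤
      129 * (elimLength u Δ * N * maxActions k / Δ ^ 2) * logFactor k ε Δ δ := by
  have hround (r : ℕ) (hr : r ∈ Finset.range (elimLength u Δ)) :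
      ∑ i, k i * I.batch r ω i ≤ N * maxActions k * ibrBatch u Δ δ := by
    have hr' : r < elimLength u Δ := Finset.mem_range.1 hr
    simp only [hrun.ibr_batch r hr', ← Finset.sum_mul]
    exact Nat.mul_le_mul_right _ (sum_le_mul_maxActions k)
  have hrounds := Finset.sum_le_card_nsmul _ _ _ hround
  rw [Finset.card_range, smul_eq_mul] at hrounds
  rcases (elimLength u Δ).eq_zero_or_pos with hL | hL
  · simp [Interaction.samples, hL]
  calc (I.samples (elimLength u Δ) ω : ℝ)
      ≤ elimLength u Δ * (N * maxActions k * ibrBatch u Δ δ) := by exact_mod_cast hrounds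
    _ ≤ elimLength u Δ * (N * maxActions k * (129 * logFactor k ε Δ δ / Δ ^ 2)) := by
        gcongr
        exact ibrBatch_le h hL
    _ = 129 * (elimLength u Δ * N * maxActions k / Δ ^ 2) * logFactor k ε Δ δ := by ring

theorem sum_ce_batch_le (hrun : IsAdaptiveHedgeRun u ε Δ δ (numRounds k ε Δ δ) I br)
    (h : Admissible k ε Δ δ) (ω : Ω) (i : Fin N) :
    ∑ t ∈ Finset.range (numRounds k ε Δ δ), (I.batch (elimLength u Δ + t) ω i : ℝ) ≤
      26240 * (maxActions k / min ε Δ ^ 2) * logFactor k ε Δ δ ^ 2 := by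
  have hT := h.numRounds_pos
  have hΛ := h.one_le_logFactor
  have hmin := h.min_pos
  have hbatches := sum_ceBatch_le h hT (θ := fun τ => I.strat (elimLength u Δ + τ) ω) (i := i)
    h.thr_pos (fun a => hrun.thr_le_strat_init h ω i a) fun τ hτ => hrun.ce_strat_mem h hτ ω i
  have hlog := h.log_numRounds_div_thr_nonneg
  have hlogs : 64 * Real.log (maxActions k * N * numRounds k ε Δ δ / δ) / Δ ^ 2 *
      (maxActions k * (1 + Real.log (numRounds k ε Δ δ / thr k ε Δ))) ≤
      9856 * (maxActions k / min ε Δ ^ 2) * logFactor k ε Δ δ ^ 2 := by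
    calc _ ≤ 64 * (11 * logFactor k ε Δ δ) / min ε Δ ^ 2 *
          (maxActions k * (14 * logFactor k ε Δ δ)) := by
          gcongr
          · exact h.log_batch_arg_le
          · exact min_le_right _ _
          · linarith [h.log_numRounds_div_thr_le]
      _ = _ := by ring
  rw [Finset.sum_congr rfl fun t ht => by rw [hrun.ce_batch t (Finset.mem_range.1 ht)]]
  linarith [h.numRounds_le]

theorem ce_samples_le (hrun : IsAdaptiveHedgeRun u ε Δ δ (numRounds k ε Δ δ) I br)
    (h : Admissible k ε Δ δ) (ω : Ω) :
    ∑ t ∈ Finset.range (numRounds k ε Δ δ), ∑ i, (k i : ℝ) * I.batch (elimLength u Δ + t) ω i ≤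
      26240 * (N * maxActions k ^ 2 / min ε Δ ^ 2) * logFactor k ε Δ δ ^ 2 := by
  rw [Finset.sum_comm]
  calc ∑ i, ∑ t ∈ Finset.range (numRounds k ε Δ δ), (k i : ℝ) * I.batch (elimLength u Δ + t) ω i
      ≤ ∑ _i : Fin N,
          maxActions k * (26240 * (maxActions k / min ε Δ ^ 2) * logFactor k ε Δ δ ^ 2) := by
        refine Finset.sum_le_sum fun i _ => ?_
        rw [← Finset.mul_sum]
        gcongr
        exacts [le_maxActions k i, hrun.sum_ce_batch_le h ω i]
    _ = 26240 * (N * maxActions k ^ 2 / min ε Δ ^ 2) * logFactor k ε Δ δ ^ 2 := by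
        simp only [Finset.sum_const, Finset.card_univ, Fintype.card_fin, nsmul_eq_mul]
        ring

theorem samples_le (hrun : IsAdaptiveHedgeRun u ε Δ δ (numRounds k ε Δ δ) I br)
    (h : Admissible k ε Δ δ) (ω : Ω) :
    (I.samples (elimLength u Δ + numRounds k ε Δ δ) ω : ℝ) ≤
      30000 * (elimLength u Δ * N * maxActions k / Δ ^ 2 +
        N * maxActions k ^ 2 / min (ε ^ 2) (Δ ^ 2)) * logFactor k ε Δ δ ^ 2 := by
  have hΛ := h.one_le_logFactor
  have hmin := h.min_pos
  have hΔ := h.Δ_pos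
  have hmin_sq : min (ε ^ 2) (Δ ^ 2) = min ε Δ ^ 2 :=
    ((pow_left_monotoneOn (n := 2)).map_min h.ε_pos.le h.Δ_pos.le).symm
  have hsplit : (I.samples (elimLength u Δ + numRounds k ε Δ δ) ω : ℝ) =
      I.samples (elimLength u Δ) ω + ∑ t ∈ Finset.range (numRounds k ε Δ δ),
        ∑ i, (k i : ℝ) * I.batch (elimLength u Δ + t) ω i := by
    simp only [Interaction.samples, Finset.sum_range_add]
    push_cast
    rfl
  have hibr : 129 * (elimLength u Δ * N * maxActions k / Δ ^ 2) * logFactor k ε Δ δ ≤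
      30000 * (elimLength u Δ * N * maxActions k / Δ ^ 2) * logFactor k ε Δ δ ^ 2 := by
    gcongr
    · norm_num
    · exact le_self_pow₀ hΛ two_ne_zero
  have hce : 0 ≤ N * maxActions k ^ 2 / min ε Δ ^ 2 * logFactor k ε Δ δ ^ 2 := by positivity
  rw [hsplit, hmin_sq]
  linarith [hrun.ibr_samples_le h ω, hrun.ce_samples_le h ω]

end IsAdaptiveHedgeRun

/-! ### Concentration of average payoffs -/

section Simplex

variable {n : ℕ}

theorem sum_sq_sub_le_two {x y : Fin n → ℝ} (hx : x ∈ stdSimplex ℝ (Fin n))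
    (hy : y ∈ stdSimplex ℝ (Fin n)) : ∑ c, (x c - y c) ^ 2 ≤ 2 := by
  calc ∑ c, (x c - y c) ^ 2 ≤ ∑ c, (x c + y c) := Finset.sum_le_sum fun c _ => by
        obtain ⟨hx0, hx1⟩ := mem_Icc_of_mem_stdSimplex hx c
        obtain ⟨hy0, hy1⟩ := mem_Icc_of_mem_stdSimplex hy c
        nlinarith [mul_nonneg hx0 hy0]
    _ = 2 := by rw [Finset.sum_add_distrib, hx.2, hy.2]; norm_num

theorem abs_sub_le_one {x y : Fin n → ℝ} (hx : x ∈ stdSimplex ℝ (Fin n))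
    (hy : y ∈ stdSimplex ℝ (Fin n)) (c : Fin n) : |x c - y c| ≤ 1 := by
  simpa only [sub_zero] using
    abs_sub_le_of_le_of_le (mem_Icc_of_mem_stdSimplex hx c).1 (mem_Icc_of_mem_stdSimplex hx c).2
      (mem_Icc_of_mem_stdSimplex hy c).1 (mem_Icc_of_mem_stdSimplex hy c).2

theorem mul_sum_sub_le_sum {x y : Fin n → ℝ} (hx : x ∈ stdSimplex ℝ (Fin n))
    (hy : y ∈ stdSimplex ℝ (Fin n)) (g : Fin n → ℝ) (s : ℝ) {M : ℝ} (hM : 0 ≤ M) :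
    s * ∑ c, (x c - y c) * g c - s ^ 2 / (4 * M) ≤
      ∑ c, (s * (x c - y c) * g c - (s * (x c - y c)) ^ 2 / (8 * M)) := by
  have hlinear : ∑ c, s * (x c - y c) * g c = s * ∑ c, (x c - y c) * g c := by
    simp only [Finset.mul_sum, mul_assoc]
  have hsquare : ∑ c, (s * (x c - y c)) ^ 2 / (8 * M) =
      s ^ 2 / (8 * M) * ∑ c, (x c - y c) ^ 2 := by
    simp only [Finset.mul_sum, mul_pow, div_mul_eq_mul_div]
  have hscale : s ^ 2 / (8 * M) * 2 = s ^ 2 / (4 * M) := by ring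
  rw [Finset.sum_sub_distrib, hlinear, hsquare, ← hscale]
  gcongr
  exact sum_sq_sub_le_two hx hy

theorem sum_linearMap_mul (φ : Fin n → Fin n) (x g : Fin n → ℝ) :
    ∑ c, FunOnFinite.linearMap ℝ ℝ φ x c * g c = ∑ b, x b * g (φ b) := by
  simp only [FunOnFinite.linearMap_apply_apply, Finset.sum_mul]
  rw [← Finset.sum_fiberwise Finset.univ φ fun b => x b * g (φ b)]
  refine Finset.sum_congr rfl fun c _ => Finset.sum_congr rfl fun b hb => ?_
  rw [(Finset.mem_filter.1 hb).2]

end Simplex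

section Concentration

variable {N : ℕ} {k : Fin N → ℕ} {Ω : Type*} [mΩ : MeasurableSpace Ω] {u : Fin N → Profile k → ℝ}
  {ε Δ δ : ℝ} {T : ℕ} {I : Interaction k Ω} {br : ℕ → Ω → Profile k} {μ : Measure Ω}

/-- The error of player `i`'s average payoffs in round `r`: their deviation from the expected
payoffs of `i`'s actions against the opponents' current mixed strategies. -/
noncomputable def Interaction.noise (I : Interaction k Ω) (u : Fin N → Profile k → ℝ) (r : ℕ)
    (ω : Ω) (i : Fin N) (c : Fin (k i)) : ℝ :=
  I.avg r ω i c - deviationMean (I.strat r ω) i c (u i)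

theorem Interaction.IsBandit.measureReal_sum_gap_ge_le [IsProbabilityMeasure μ] {R : ℕ}
    (hI : I.IsBandit u μ R) {i : Fin N} (hu : ∀ x, u i x ∈ Set.Icc (0 : ℝ) 1) (rounds : Finset ℕ)
    (hrounds : ∀ r ∈ rounds, r < R)
    (hstrat : ∀ r ∈ rounds, ∀ ω j, I.strat r ω j ∈ stdSimplex ℝ (Fin (k j)))
    {K : ℕ} (hpos : ∀ r ∈ rounds, ∀ ω, 0 < I.batch r ω i)
    (hK : ∀ r ∈ rounds, ∀ ω, I.batch r ω i ≤ K)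
    {s : ℕ → Ω → ℝ} {x y : ℕ → Ω → Fin (k i) → ℝ} {B : ℝ}
    (hs : ∀ r ∈ rounds, Measurable[I.hist (slot r 0 0 0)] (s r))
    (hx : ∀ r ∈ rounds, ∀ c, Measurable[I.hist (slot r 0 0 0)] fun ω => x r ω c)
    (hy : ∀ r ∈ rounds, ∀ c, Measurable[I.hist (slot r 0 0 0)] fun ω => y r ω c)
    (hsB : ∀ r ∈ rounds, ∀ ω, |s r ω| ≤ B)
    (hx_mem : ∀ r ∈ rounds, ∀ ω, x r ω ∈ stdSimplex ℝ (Fin (k i)))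
    (hy_mem : ∀ r ∈ rounds, ∀ ω, y r ω ∈ stdSimplex ℝ (Fin (k i))) (z : ℝ) :
    μ.real {ω | z ≤ ∑ r ∈ rounds, (s r ω * ∑ c, (x r ω c - y r ω c) * I.noise u r ω i c -
      s r ω ^ 2 / (4 * I.batch r ω i))} ≤ Real.exp (-z) := by
  have hexp := hI.integral_exp_avg_sub_le_one hu rounds hrounds hstrat hpos hK
    (fun r ω c => s r ω * (x r ω c - y r ω c)) (B := B)
    (fun r hr c => (hs r hr).mul ((hx r hr c).sub (hy r hr c)))
    fun r hr ω c => by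
      rw [abs_mul]
      exact (mul_le_of_le_one_right (abs_nonneg _)
        (abs_sub_le_one (hx_mem r hr ω) (hy_mem r hr ω) c)).trans (hsB r hr ω)
  refine (measureReal_mono fun ω hω => ?_).trans (measureReal_ge_le_exp_neg hexp.1 hexp.2 z)
  exact hω.trans (Finset.sum_le_sum fun r hr =>
    mul_sum_sub_le_sum (hx_mem r hr ω) (hy_mem r hr ω) _ _ (Nat.cast_nonneg _))

namespace IsAdaptiveHedgeRun

theorem ibr_tail_bound [IsProbabilityMeasure μ] (hrun : IsAdaptiveHedgeRun u ε Δ δ T I br)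
    (h : Admissible k ε Δ δ) (hI : I.IsBandit u μ (elimLength u Δ + T))
    {r : ℕ} (hr : r < elimLength u Δ) {i : Fin N} (hu : ∀ x, u i x ∈ Set.Icc (0 : ℝ) 1)
    {x y : Fin (k i) → ℝ} (hx : x ∈ stdSimplex ℝ (Fin (k i))) (hy : y ∈ stdSimplex ℝ (Fin (k i))) :
    μ.real {ω | Δ ≤ ∑ c, (x c - y c) * I.noise u r ω i c} ≤
      δ / (elimLength u Δ * N * maxActions k) := by
  have hL : 0 < elimLength u Δ := by lia
  have hN := h.one_le_N
  have hA := h.one_le_maxActions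
  have hδ := h.δ_pos
  have hlog := log_ibrBatch_arg_pos h hL
  have hM : (0 : ℝ) < ibrBatch u Δ δ := Nat.cast_pos.2 (ibrBatch_pos h hL)
  have hM_ge : 64 * Real.log (elimLength u Δ * N * maxActions k / δ) ≤ ibrBatch u Δ δ * Δ ^ 2 :=
    (div_le_iff₀ (pow_pos h.Δ_pos 2)).1 (Nat.le_ceil _)
  have hbatch (ω : Ω) : I.batch r ω i = ibrBatch u Δ δ := hrun.ibr_batch r hr ω i
  -- The slope `2 * Δ * M` maximizes `s ↦ s * Δ - s ^ 2 / (4 * M)`.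
  have htail := hI.measureReal_sum_gap_ge_le hu {r} (K := ibrBatch u Δ δ)
    (s := fun _ _ => 2 * Δ * ibrBatch u Δ δ) (x := fun _ _ => x) (y := fun _ _ => y)
    (B := |2 * Δ * ibrBatch u Δ δ|) (by simpa only [Finset.mem_singleton, forall_eq] using by lia)
    (fun r' hr' ω j => hrun.strat_mem h (by rw [Finset.mem_singleton.1 hr']; lia) ω j)
    (fun r' hr' ω => by rw [Finset.mem_singleton.1 hr', hbatch]; exact ibrBatch_pos h hL)
    (fun r' hr' ω => by rw [Finset.mem_singleton.1 hr', hbatch])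
    (fun _ _ => measurable_const) (fun _ _ _ => measurable_const) (fun _ _ _ => measurable_const)
    (fun _ _ _ => le_rfl) (fun _ _ _ => hx) (fun _ _ _ => hy)
    (Real.log (elimLength u Δ * N * maxActions k / δ))
  rw [Real.exp_neg, Real.exp_log (by positivity), inv_div] at htail
  refine (measureReal_mono fun ω hω => ?_).trans htail
  simp only [Set.mem_ofPred_eq, Finset.sum_singleton, hbatch] at hω ⊢
  have hscaled : 2 * Δ * ibrBatch u Δ δ * Δ ≤
      2 * Δ * ibrBatch u Δ δ * ∑ c, (x c - y c) * I.noise u r ω i c :=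
    mul_le_mul_of_nonneg_left hω (by have := h.Δ_pos; positivity)
  have hsquare : (2 * Δ * ibrBatch u Δ δ) ^ 2 / (4 * (ibrBatch u Δ δ : ℝ)) =
      ibrBatch u Δ δ * Δ ^ 2 := by
    field_simp; ring
  linarith

theorem ce_batch_le_ceil (hrun : IsAdaptiveHedgeRun u ε Δ δ T I br) (h : Admissible k ε Δ δ)
    {t : ℕ} (ht : t < T) (ω : Ω) (i : Fin N) :
    I.batch (elimLength u Δ + t) ω i ≤
      ⌈1 + 64 * Real.log (maxActions k * N * T / δ) / Δ ^ 2 * k i⌉₊ := by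
  have hpos : ∀ τ ≤ t, ∀ a, 0 < I.strat (elimLength u Δ + τ) ω i a := fun τ hτ a =>
    hrun.ce_strat_pos h (by lia) ω i a
  have hlog := h.log_batch_arg_pos (T := T) (by lia)
  have hratio (a : Fin (k i)) : I.strat (elimLength u Δ + t) ω i a /
      cumWeight (fun τ => I.strat (elimLength u Δ + τ) ω) t i a ≤ 1 :=
    (div_le_one (cumWeight_pos fun τ hτ => hpos τ hτ a)).2
      (le_cumWeight (θ := fun τ => I.strat (elimLength u Δ + τ) ω)
        (fun τ hτ => hpos τ hτ a) le_rfl)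
  rw [hrun.ce_batch t ht, ← @Nat.cast_le ℝ]
  refine ((ceBatch_le h (by lia) (θ := fun τ => I.strat (elimLength u Δ + τ) ω)
    fun τ hτ a => (hpos τ hτ a).le).trans ?_).trans (Nat.le_ceil _)
  gcongr
  exact (Finset.sum_le_sum fun a _ => hratio a).trans_eq (by simp)

theorem ce_tail_bound [IsProbabilityMeasure μ] (hrun : IsAdaptiveHedgeRun u ε Δ δ T I br)
    (h : Admissible k ε Δ δ) (hI : I.IsBandit u μ (elimLength u Δ + T))
    {i : Fin N} (hu : ∀ x, u i x ∈ Set.Icc (0 : ℝ) 1) {n : ℕ} (hn : n ≤ T)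
    {s : ℕ → Ω → ℝ} {x y : ℕ → Ω → Fin (k i) → ℝ} {B : ℝ}
    (hs : ∀ r < elimLength u Δ + T, Measurable[I.hist (slot r 0 0 0)] (s r))
    (hx : ∀ r < elimLength u Δ + T, ∀ c, Measurable[I.hist (slot r 0 0 0)] fun ω => x r ω c)
    (hy : ∀ r < elimLength u Δ + T, ∀ c, Measurable[I.hist (slot r 0 0 0)] fun ω => y r ω c)
    (hsB : ∀ r < elimLength u Δ + T, ∀ ω, |s r ω| ≤ B)
    (hx_mem : ∀ r < elimLength u Δ + T, ∀ ω, x r ω ∈ stdSimplex ℝ (Fin (k i)))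
    (hy_mem : ∀ r < elimLength u Δ + T, ∀ ω, y r ω ∈ stdSimplex ℝ (Fin (k i))) (z : ℝ) :
    μ.real {ω | z ≤ ∑ t ∈ Finset.range n,
      (s (elimLength u Δ + t) ω * ∑ c, (x (elimLength u Δ + t) ω c - y (elimLength u Δ + t) ω c) *
          I.noise u (elimLength u Δ + t) ω i c -
        s (elimLength u Δ + t) ω ^ 2 / (4 * I.batch (elimLength u Δ + t) ω i))} ≤
      Real.exp (-z) := by
  let rounds : Finset ℕ := (Finset.range n).map (addLeftEmbedding (elimLength u Δ))
  have hmem : ∀ r ∈ rounds, ∃ t < T, r = elimLength u Δ + t := by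
    intro r hr
    obtain ⟨t, ht, rfl⟩ := Finset.mem_map.1 hr
    exact ⟨t, (Finset.mem_range.1 ht).trans_le hn, rfl⟩
  have hlt : ∀ r ∈ rounds, r < elimLength u Δ + T := fun r hr => by
    obtain ⟨t, ht, rfl⟩ := hmem r hr
    lia
  have htail := hI.measureReal_sum_gap_ge_le hu rounds hlt
    (fun r hr ω j => hrun.strat_mem h (hlt r hr) ω j)
    (fun r hr ω => by
      obtain ⟨t, ht, rfl⟩ := hmem r hr
      exact hrun.ce_batch_pos h ht ω i)
    (fun r hr ω => by
      obtain ⟨t, ht, rfl⟩ := hmem r hr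
      exact hrun.ce_batch_le_ceil h ht ω i)
    (fun r hr => hs r (hlt r hr)) (fun r hr => hx r (hlt r hr)) (fun r hr => hy r (hlt r hr))
    (fun r hr => hsB r (hlt r hr)) (fun r hr => hx_mem r (hlt r hr))
    (fun r hr => hy_mem r (hlt r hr)) z
  simpa only [rounds, Finset.sum_map, addLeftEmbedding_apply] using htail

end IsAdaptiveHedgeRun

end Concentration

/-! ### Eliminated actions stay below the threshold -/

theorem softmax_le_exp_neg {n : ℕ} {x : Fin n → ℝ} (hx : x ∈ stdSimplex ℝ (Fin n)) (η : ℝ)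
    (U : Fin n → ℝ) (a : Fin n) :
    softmax η U a ≤ Real.exp (-(η * ((∑ c, x c * U c) - U a))) := by
  have hmean : Real.exp (η * ∑ c, x c * U c) ≤ ∑ c, Real.exp (η * U c) := by
    have jensen := convexOn_exp.map_sum_le (t := Finset.univ) (p := fun c => η * U c)
      (fun c _ => hx.1 c) hx.2 fun c _ => Set.mem_univ _
    simp only [smul_eq_mul, mul_left_comm _ η, ← Finset.mul_sum] at jensen
    exact jensen.trans (Finset.sum_le_sum fun c _ =>
      mul_le_of_le_one_left (Real.exp_pos _).le (mem_Icc_of_mem_stdSimplex hx c).2)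
  calc softmax η U a ≤ Real.exp (η * U a) / Real.exp (η * ∑ c, x c * U c) :=
        div_le_div_of_nonneg_left (Real.exp_pos _).le (Real.exp_pos _) hmean
    _ = _ := by rw [← Real.exp_sub]; ring_nf

section Accuracy

variable {N : ℕ} {k : Fin N → ℕ} {Ω : Type*} [MeasurableSpace Ω]

/-- The amount by which the payoff gap estimated in round `r`, between the action `a` and the
strategy that dominates it in step `l + 1` of the elimination, falls short of the actual gap. -/
noncomputable def dominanceError (I : Interaction k Ω) (u : Fin N → Profile k → ℝ) (Δ : ℝ)
    (l r : ℕ) (ω : Ω) (i : Fin N) (a : Fin (k i)) : ℝ :=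
  I.noise u r ω i a - ∑ c, dominator u Δ l i a c * I.noise u r ω i c

/-- The amount by which the estimate, in round `r`, of player `i`'s gain from the deviation `φ`
falls short of the actual gain. -/
noncomputable def swapError (I : Interaction k Ω) (u : Fin N → Profile k → ℝ) (r : ℕ) (ω : Ω)
    (i : Fin N) (φ : Fin (k i) → Fin (k i)) : ℝ :=
  ∑ c, I.strat r ω i c * (I.noise u r ω i c - I.noise u r ω i (φ c))

/-- The payoff gaps that iterative best response has to see are estimated with an error less than
`Δ`. -/
def IBRAccurate (I : Interaction k Ω) (u : Fin N → Profile k → ℝ) (Δ : ℝ) (ω : Ω) : Prop :=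
  ∀ r < elimLength u Δ, ∀ i a, dominanceError I u Δ r r ω i a < Δ

/-- The payoff gaps between actions and the strategies that dominate them are estimated in adaptive
Hedge with an average error of at most `Δ / 4`, where the expert `b` gives round `τ` the weight
`θ_i^{(τ)}(b)`. -/
def ExpertAccurate (I : Interaction k Ω) (u : Fin N → Profile k → ℝ) (Δ : ℝ) (T : ℕ) (ω : Ω) :
    Prop :=
  ∀ t < T, ∀ i a b, ∑ τ ∈ Finset.range (t + 1), I.strat (elimLength u Δ + τ) ω i b *
      dominanceError I u Δ (elimLength u Δ) (elimLength u Δ + τ) ω i a ≤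
    Δ / 4 * cumWeight (fun τ => I.strat (elimLength u Δ + τ) ω) t i b

/-- The gains from deviations are estimated in adaptive Hedge with an average error of at most
`ε / 4`. -/
def SwapAccurate (I : Interaction k Ω) (u : Fin N → Profile k → ℝ) (ε Δ : ℝ) (T : ℕ) (ω : Ω) :
    Prop :=
  ∀ i φ, ∑ t ∈ Finset.range T, swapError I u (elimLength u Δ + t) ω i φ ≤ ε / 4 * T

variable {u : Fin N → Profile k → ℝ} {ε Δ δ : ℝ} {T : ℕ} {I : Interaction k Ω}
  {br : ℕ → Ω → Profile k} {μ : Measure Ω}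

theorem avg_le_of_mem_elim_succ (hu : ∀ i x, u i x ∈ Set.Icc (0 : ℝ) 1) (hΔ : 0 ≤ Δ)
    {r : ℕ} {ω : Ω} (hstrat : ∀ j, I.strat r ω j ∈ stdSimplex ℝ (Fin (k j)))
    {l : ℕ} {i : Fin N} {a : Fin (k i)} (ha : a ∈ elim u Δ (l + 1) i) :
    I.avg r ω i a ≤ (∑ c, dominator u Δ l i a c * I.avg r ω i c) - Δ +
      (1 + Δ) * (∑ j, ∑ c, (elim u Δ l j).indicator (I.strat r ω j) c) +
        dominanceError I u Δ l r ω i a := by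
  have hdev := deviationMean_le_of_dominated hstrat (hu i) hΔ (elim u Δ l)
    (dominator_mem_stdSimplex u Δ l i a).1 fun y hy => le_sum_dominator_sub ha hy
  simp only [dominanceError, Interaction.noise, mul_sub, Finset.sum_sub_distrib]
  linarith

namespace IsAdaptiveHedgeRun

theorem br_notMem_elim (hrun : IsAdaptiveHedgeRun u ε Δ δ T I br) (h : Admissible k ε Δ δ)
    (hu : ∀ i x, u i x ∈ Set.Icc (0 : ℝ) 1) {ω : Ω} (hacc : IBRAccurate I u Δ ω) :
    ∀ r ≤ elimLength u Δ, ∀ i, br r ω i ∉ elim u Δ r i := by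
  intro r
  induction r with
  | zero => exact fun _ i => Set.notMem_empty _
  | succ r ih =>
    intro hr i hmem
    have hr' : r < elimLength u Δ := hr
    have hmass : ∑ j, ∑ c, (elim u Δ r j).indicator (I.strat r ω j) c = 0 := by
      refine Finset.sum_eq_zero fun j _ => Finset.sum_eq_zero fun c _ => ?_
      rw [Set.indicator_apply_eq_zero, hrun.ibr_strat r hr']
      refine fun hc => Pi.single_eq_of_ne ?_ _
      rintro rfl
      exact ih hr'.le j hc
    have hgap := avg_le_of_mem_elim_succ hu h.Δ_pos.le
      (fun j => hrun.strat_mem h (Nat.lt_add_right T hr') ω j) hmem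
    have hmix := dominator_mem_stdSimplex u Δ r i (br (r + 1) ω i)
    have hbest : ∑ c, dominator u Δ r i (br (r + 1) ω i) c * I.avg r ω i c ≤
        I.avg r ω i (br (r + 1) ω i) := by
      refine (Finset.sum_le_sum fun c _ =>
        mul_le_mul_of_nonneg_left (hrun.ibr_best r hr' ω i c) (hmix.1 c)).trans_eq ?_
      rw [← Finset.sum_mul, hmix.2, one_mul]
    have herr := hacc r hr' i (br (r + 1) ω i)
    rw [hmass, mul_zero, add_zero] at hgap
    linarith

theorem avg_le_of_strat_le_thr (hrun : IsAdaptiveHedgeRun u ε Δ δ T I br)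
    (h : Admissible k ε Δ δ) (hu : ∀ i x, u i x ∈ Set.Icc (0 : ℝ) 1) {ω : Ω} {t : ℕ} (ht : t < T)
    (hsmall : ∀ j, ∀ c ∈ elim u Δ (elimLength u Δ) j,
      I.strat (elimLength u Δ + t) ω j c ≤ thr k ε Δ)
    {i : Fin N} {a : Fin (k i)} (ha : a ∈ elim u Δ (elimLength u Δ) i) :
    I.avg (elimLength u Δ + t) ω i a ≤
      (∑ c, dominator u Δ (elimLength u Δ) i a c * I.avg (elimLength u Δ + t) ω i c) -
        3 / 4 * Δ + dominanceError I u Δ (elimLength u Δ) (elimLength u Δ + t) ω i a := by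
  have hmass : ∑ j, ∑ c, (elim u Δ (elimLength u Δ) j).indicator
      (I.strat (elimLength u Δ + t) ω j) c ≤ Δ / 8 := by
    have hactions : ((∑ j, k j : ℕ) : ℝ) ≤ N * maxActions k := by
      exact_mod_cast sum_le_mul_maxActions k
    have hcount := sum_indicator_le_sum_card_mul h.thr_pos.le hsmall
    simp only [Fintype.card_fin] at hcount
    linarith [mul_le_mul_of_nonneg_right hactions h.thr_pos.le, h.mul_thr_eq, min_le_right ε Δ]
  have hgap := avg_le_of_mem_elim_succ hu h.Δ_pos.le
    (fun j => hrun.ce_strat_mem h ht ω j) (l := elimLength u Δ) (i := i) (a := a)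
    (by rwa [elim_elimLength_succ])
  nlinarith [h.Δ_pos, h.Δ_le]

theorem expert_gap_ge (hrun : IsAdaptiveHedgeRun u ε Δ δ T I br) (h : Admissible k ε Δ δ)
    (hu : ∀ i x, u i x ∈ Set.Icc (0 : ℝ) 1) {ω : Ω} (hacc : ExpertAccurate I u Δ T ω)
    {t : ℕ} (ht : t < T)
    (hsmall : ∀ τ ≤ t, ∀ j, ∀ c ∈ elim u Δ (elimLength u Δ) j,
      I.strat (elimLength u Δ + τ) ω j c ≤ thr k ε Δ)
    {i : Fin N} {a : Fin (k i)} (ha : a ∈ elim u Δ (elimLength u Δ) i) (b : Fin (k i)) :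
    Δ / 2 * cumWeight (fun τ => I.strat (elimLength u Δ + τ) ω) t i b ≤
      (∑ c, dominator u Δ (elimLength u Δ) i a c * ∑ τ ∈ Finset.range (t + 1),
        I.avg (elimLength u Δ + τ) ω i c * I.strat (elimLength u Δ + τ) ω i b) -
      ∑ τ ∈ Finset.range (t + 1),
        I.avg (elimLength u Δ + τ) ω i a * I.strat (elimLength u Δ + τ) ω i b := by
  set L := elimLength u Δ
  have hround (τ : ℕ) (hτ : τ ∈ Finset.range (t + 1)) :
      I.avg (L + τ) ω i a * I.strat (L + τ) ω i b ≤
        (∑ c, dominator u Δ L i a c * I.avg (L + τ) ω i c * I.strat (L + τ) ω i b) -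
          3 / 4 * Δ * I.strat (L + τ) ω i b +
            I.strat (L + τ) ω i b * dominanceError I u Δ L (L + τ) ω i a := by
    have hτ' : τ ≤ t := Nat.lt_succ_iff.1 (Finset.mem_range.1 hτ)
    have hgap := hrun.avg_le_of_strat_le_thr h hu (hτ'.trans_lt ht) (hsmall τ hτ') ha
    rw [← Finset.sum_mul]
    linarith [mul_le_mul_of_nonneg_right hgap (hrun.ce_strat_pos h (hτ'.trans_lt ht) ω i b).le]
  have hsum := Finset.sum_le_sum hround
  rw [Finset.sum_add_distrib, Finset.sum_sub_distrib, ← Finset.mul_sum, Finset.sum_comm] at hsum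
  have herr := hacc t ht i a b
  simp only [Finset.mul_sum, ← mul_assoc]
  simp only [cumWeight] at herr ⊢
  linarith

theorem expert_softmax_le_thr (hrun : IsAdaptiveHedgeRun u ε Δ δ T I br)
    (h : Admissible k ε Δ δ) {ω : Ω} {t : ℕ} (ht : t < T) {i : Fin N} {a b : Fin (k i)}
    {x U : Fin (k i) → ℝ} (hx : x ∈ stdSimplex ℝ (Fin (k i)))
    (hgap : Δ / 2 * cumWeight (fun τ => I.strat (elimLength u Δ + τ) ω) t i b ≤
      (∑ c, x c * U c) - U a) :
    softmax (ceRate ε Δ (fun τ => I.strat (elimLength u Δ + τ) ω) t i b) U a ≤ thr k ε Δ := by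
  have hΔ := h.Δ_pos
  have hlog := h.half_le_log_one_div_thr
  have hweight : 0 < cumWeight (fun τ => I.strat (elimLength u Δ + τ) ω) t i b :=
    cumWeight_pos fun τ hτ => hrun.ce_strat_pos h (by lia) ω i b
  set W := cumWeight (fun τ => I.strat (elimLength u Δ + τ) ω) t i b
  have hrate : 2 * Real.log (1 / thr k ε Δ) / (Δ * W) ≤
      ceRate ε Δ (fun τ => I.strat (elimLength u Δ + τ) ω) t i b := le_max_left _ _
  have hexponent : Real.log (1 / thr k ε Δ) ≤
      ceRate ε Δ (fun τ => I.strat (elimLength u Δ + τ) ω) t i b * ((∑ c, x c * U c) - U a) := by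
    calc Real.log (1 / thr k ε Δ)
        = 2 * Real.log (1 / thr k ε Δ) / (Δ * W) * (Δ / 2 * W) := by field_simp
      _ ≤ _ := mul_le_mul hrate hgap (by positivity) (le_trans (by positivity) hrate)
  refine (softmax_le_exp_neg hx _ U a).trans ?_
  rwa [← Real.le_log_iff_exp_le h.thr_pos, neg_le, ← Real.log_inv, ← one_div]

theorem ce_strat_le_thr (hrun : IsAdaptiveHedgeRun u ε Δ δ T I br) (h : Admissible k ε Δ δ)
    (hu : ∀ i x, u i x ∈ Set.Icc (0 : ℝ) 1) {ω : Ω} (hibr : IBRAccurate I u Δ ω)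
    (hexpert : ExpertAccurate I u Δ T ω) :
    ∀ t < T, ∀ i, ∀ a ∈ elim u Δ (elimLength u Δ) i,
      I.strat (elimLength u Δ + t) ω i a ≤ thr k ε Δ := by
  intro t
  induction t using Nat.strong_induction_on with
  | _ t ih =>
    intro ht i a ha
    cases t with
    | zero =>
      have hne : a ≠ br (elimLength u Δ) ω i := by
        rintro rfl
        exact hrun.br_notMem_elim h hu hibr _ le_rfl i ha
      rw [add_zero, hrun.init, if_neg hne, mul_zero, zero_add]
    | succ t =>
      have hs := hrun.ce_simplex t ht ω i
      rw [hrun.ce_fixed t ht ω i a]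
      refine (Finset.sum_le_sum fun b _ => mul_le_mul_of_nonneg_right
        (hrun.expert_softmax_le_thr h (by lia) (dominator_mem_stdSimplex u Δ _ i a) <|
          hrun.expert_gap_ge h hu hexpert (by lia) (fun τ hτ => ih τ (by lia) (by lia)) ha b)
        (hs.1 b)).trans_eq ?_
      rw [← Finset.mul_sum, hs.2, mul_one]

end IsAdaptiveHedgeRun

end Accuracy

/-! ### From swap regret to correlated equilibrium -/

section Equilibrium

variable {N : ℕ} {k : Fin N → ℕ} {ε Δ δ : ℝ}

theorem Admissible.maxActions_mul_sq_logFactor_le (h : Admissible k ε Δ δ) :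
    4096 * (maxActions k * logFactor k ε Δ δ ^ 2) ≤ ε ^ 2 * numRounds k ε Δ δ := by
  have hε := h.ε_pos
  calc 4096 * (maxActions k * logFactor k ε Δ δ ^ 2)
      = ε ^ 2 * (4096 * (maxActions k / ε ^ 2) * logFactor k ε Δ δ ^ 2) := by field_simp
    _ ≤ ε ^ 2 * (4096 * (maxActions k / ε ^ 2 + maxActions k / Δ ^ 2) *
          logFactor k ε Δ δ ^ 2) := by
        gcongr
        exact le_add_of_nonneg_right (by positivity)
    _ ≤ ε ^ 2 * numRounds k ε Δ δ := by
        gcongr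
        exact Nat.le_ceil _

theorem Admissible.maxActions_mul_sq_logFactor_div_le (h : Admissible k ε Δ δ) :
    8192 * (maxActions k * logFactor k ε Δ δ ^ 2 / Δ) ≤ ε * numRounds k ε Δ δ := by
  have hε := h.ε_pos
  have hΔ := h.Δ_pos
  calc 8192 * (maxActions k * logFactor k ε Δ δ ^ 2 / Δ)
      = ε * (4096 * (maxActions k * (2 * (1 / ε) * (1 / Δ))) * logFactor k ε Δ δ ^ 2) := by
        field_simp
        ring
    _ ≤ ε * (4096 * (maxActions k * ((1 / ε) ^ 2 + (1 / Δ) ^ 2)) * logFactor k ε Δ δ ^ 2) := by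
        gcongr
        exact two_mul_le_add_sq _ _
    _ = ε * (4096 * (maxActions k / ε ^ 2 + maxActions k / Δ ^ 2) * logFactor k ε Δ δ ^ 2) := by
        ring
    _ ≤ ε * numRounds k ε Δ δ := by
        gcongr
        exact Nat.le_ceil _

theorem Admissible.sqrt_regret_le (h : Admissible k ε Δ δ) :
    √(maxActions k * Real.log (maxActions k) * numRounds k ε Δ δ) ≤
      1 / 24 * ε * numRounds k ε Δ δ := by
  have hε := h.ε_pos
  have hΛ : logFactor k ε Δ δ ≤ logFactor k ε Δ δ ^ 2 := le_self_pow₀ h.one_le_logFactor two_ne_zero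
  have hentropy : maxActions k * Real.log (maxActions k) ≤
      maxActions k * logFactor k ε Δ δ ^ 2 :=
    mul_le_mul_of_nonneg_left (h.log_maxActions_le.trans hΛ) (Nat.cast_nonneg _)
  have hbudget : maxActions k * Real.log (maxActions k) ≤
      (1 / 24 * ε) ^ 2 * numRounds k ε Δ δ := by
    have hΛ0 := h.one_le_logFactor
    have hA : 0 ≤ (maxActions k : ℝ) * logFactor k ε Δ δ ^ 2 := by positivity
    linarith [h.maxActions_mul_sq_logFactor_le]
  rw [Real.sqrt_le_left (by positivity)]
  linarith [mul_le_mul_of_nonneg_right hbudget (Nat.cast_nonneg (α := ℝ) (numRounds k ε Δ δ))]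

theorem Admissible.regret_budget (h : Admissible k ε Δ δ) :
    1 + 3 * √(maxActions k * Real.log (maxActions k) * numRounds k ε Δ δ) +
      2 * maxActions k * (2 * Real.log (1 / thr k ε Δ) / Δ) *
        Real.log (numRounds k ε Δ δ / thr k ε Δ) ≤
      3 / 8 * ε * numRounds k ε Δ δ := by
  have hΔ := h.Δ_pos
  have hΛ := h.one_le_logFactor
  have hratio : 1 ≤ maxActions k * logFactor k ε Δ δ ^ 2 / Δ :=
    (one_le_div hΔ).2 (h.Δ_le.trans
      (one_le_mul_of_one_le_of_one_le h.one_le_maxActions (one_le_pow₀ hΛ)))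
  have hlogs : 2 * maxActions k * (2 * Real.log (1 / thr k ε Δ) / Δ) *
      Real.log (numRounds k ε Δ δ / thr k ε Δ) ≤
        156 * (maxActions k * logFactor k ε Δ δ ^ 2 / Δ) := by
    calc _ ≤ 2 * maxActions k * (2 * (3 * logFactor k ε Δ δ) / Δ) *
          (13 * logFactor k ε Δ δ) := by
          gcongr
          exacts [h.log_numRounds_div_thr_nonneg, h.log_one_div_thr_le, h.log_numRounds_div_thr_le]
      _ = _ := by ring
  linarith [h.maxActions_mul_sq_logFactor_div_le, h.sqrt_regret_le]

theorem sum_ceOutput_mul (p : ℝ) (T : ℕ) (θ : ℕ → Weights k) (f : Profile k → ℝ) :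
    ∑ x, ceOutput p T θ x * f x =
      (∑ t ∈ Finset.range T, jointMean (fun i => clip p (θ t i)) f) / T := by
  simp only [ceOutput, jointMean_apply, div_mul_eq_mul_div, ← Finset.sum_div, Finset.sum_mul]
  rw [Finset.sum_comm]

theorem ceOutput_mem_stdSimplex {p : ℝ} {T : ℕ} (hT : 0 < T) {θ : ℕ → Weights k}
    (hθ : ∀ t < T, ∀ i, θ t i ∈ stdSimplex ℝ (Fin (k i))) (hp : ∀ i, k i * p < 1) :
    ceOutput p T θ ∈ stdSimplex ℝ (Profile k) := by
  have hclip (t : ℕ) (ht : t ∈ Finset.range T) (i : Fin N) :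
      clip p (θ t i) ∈ stdSimplex ℝ (Fin (k i)) :=
    clip_mem_stdSimplex (hθ t (Finset.mem_range.1 ht) i) (hp i)
  refine ⟨fun x => div_nonneg (Finset.sum_nonneg fun t ht => Finset.prod_nonneg fun i _ =>
    (hclip t ht i).1 (x i)) (Nat.cast_nonneg T), ?_⟩
  have htotal := sum_ceOutput_mul p T θ fun _ => 1
  rw [Finset.sum_congr rfl fun t ht => jointMean_const (fun i => (hclip t ht i).2) 1,
    Finset.sum_const, Finset.card_range, nsmul_one, div_self (Nat.cast_ne_zero.2 hT.ne')] at htotal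
  simpa only [mul_one] using htotal

variable {Ω : Type*} [MeasurableSpace Ω] {u : Fin N → Profile k → ℝ} {I : Interaction k Ω}
  {br : ℕ → Ω → Profile k} {μ : Measure Ω}

theorem Interaction.IsBandit.avg_mem_Icc {R : ℕ} (hI : I.IsBandit u μ R) (r : ℕ) (ω : Ω)
    (i : Fin N) (c : Fin (k i)) : I.avg r ω i c ∈ Set.Icc (0 : ℝ) 1 := by
  have htotal : ∑ m ∈ Finset.range (I.batch r ω i), I.fb (slot r i c m) ω i ≤
      I.batch r ω i := by
    simpa using Finset.sum_le_card_nsmul (Finset.range (I.batch r ω i)) _ 1 fun m _ =>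
      (hI.fb_mem (slot r i c m) ω i).2
  exact ⟨div_nonneg (Finset.sum_nonneg fun m _ => (hI.fb_mem _ ω i).1) (Nat.cast_nonneg _),
    div_le_one_of_le₀ htotal (Nat.cast_nonneg _)⟩

theorem IsAdaptiveHedgeRun.estimated_swap_regret_le
    (hrun : IsAdaptiveHedgeRun u ε Δ δ (numRounds k ε Δ δ) I br) (h : Admissible k ε Δ δ)
    (hI : I.IsBandit u μ (elimLength u Δ + numRounds k ε Δ δ)) (ω : Ω) (i : Fin N)
    (φ : Fin (k i) → Fin (k i)) :
    ∑ t ∈ Finset.range (numRounds k ε Δ δ), ∑ c, I.strat (elimLength u Δ + t) ω i c *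
        (I.avg (elimLength u Δ + t) ω i (φ c) - I.avg (elimLength u Δ + t) ω i c) ≤
      3 / 8 * ε * numRounds k ε Δ δ := by
  have hΔ := h.Δ_pos
  have hlogp := h.half_le_log_one_div_thr
  have hrate : 1 ≤ 2 * Real.log (1 / thr k ε Δ) / Δ := by
    rw [one_le_div hΔ]
    linarith [h.Δ_le]
  have hk : (k i : ℝ) ≤ maxActions k := Nat.cast_le.2 (le_maxActions k i)
  have hk0 : (0 : ℝ) < k i := Nat.cast_pos.2 (h.k_pos i)
  have hentropy : k i * Real.log (k i) ≤ maxActions k * Real.log (maxActions k) := by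
    gcongr
  have hentropy_nonneg : 0 ≤ maxActions k * Real.log (maxActions k) :=
    mul_nonneg (Nat.cast_nonneg _) (Real.log_natCast_nonneg _)
  have hlog := h.log_numRounds_div_thr_nonneg
  have hbudget := h.regret_budget
  have hpos := h.numRounds_pos
  obtain ⟨m, hm⟩ : ∃ m, numRounds k ε Δ δ = m + 1 := ⟨_, (Nat.sub_add_cancel hpos).symm⟩
  simp only [hm] at hlog hbudget hrun ⊢
  refine (swap_regret (h.k_pos i) (fun t => I.strat (elimLength u Δ + t) ω i)
    (fun t => I.avg (elimLength u Δ + t) ω i) m h.thr_pos hrate hentropy_nonneg hentropy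
    (fun t ht => hrun.ce_strat_mem h (Nat.lt_succ_of_le ht) ω i)
    (fun b => hrun.thr_le_strat_init h ω i b) (fun t _ c => hI.avg_mem_Icc _ ω i c)
    (fun t ht a => ?_) φ).trans (le_trans ?_ hbudget)
  · simpa only [expertRate, ceRate, cumWeight, ← div_div] using
      hrun.ce_fixed t (Nat.succ_lt_succ ht) ω i a
  · gcongr

theorem jointMean_swap_gain_eq (I : Interaction k Ω) (u : Fin N → Profile k → ℝ) (r : ℕ) (ω : Ω)
    (i : Fin N) (φ : Fin (k i) → Fin (k i)) :
    jointMean (I.strat r ω) (fun x => u i (Function.update x i (φ (x i))) - u i x) =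
      (∑ c, I.strat r ω i c * (I.avg r ω i (φ c) - I.avg r ω i c)) + swapError I u r ω i φ := by
  have hsub : jointMean (I.strat r ω) (fun x => u i (Function.update x i (φ (x i))) - u i x) =
      jointMean (I.strat r ω) (fun x => u i (Function.update x i (φ (x i)))) -
        jointMean (I.strat r ω) (u i) := map_sub (jointMean (I.strat r ω)) _ _
  rw [hsub, jointMean_comp_update _ i φ (u i), jointMean_eq_sum_deviationMean _ i, swapError,
    ← Finset.sum_sub_distrib, ← Finset.sum_add_distrib]
  refine Finset.sum_congr rfl fun c _ => ?_
  simp only [Interaction.noise]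
  ring

theorem IsAdaptiveHedgeRun.isApproxCE_ceOutput
    (hrun : IsAdaptiveHedgeRun u ε Δ δ (numRounds k ε Δ δ) I br) (h : Admissible k ε Δ δ)
    (hu : ∀ i x, u i x ∈ Set.Icc (0 : ℝ) 1)
    (hI : I.IsBandit u μ (elimLength u Δ + numRounds k ε Δ δ)) {ω : Ω}
    (hacc : SwapAccurate I u ε Δ (numRounds k ε Δ δ) ω) :
    IsApproxCE u ε (ceOutput (thr k ε Δ) (numRounds k ε Δ δ)
      (fun t => I.strat (elimLength u Δ + t) ω)) := by
  have hT : (0 : ℝ) < numRounds k ε Δ δ := Nat.cast_pos.2 h.numRounds_pos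
  have hmass := h.mul_thr_eq
  have hmin := min_le_left ε Δ
  refine ⟨ceOutput_mem_stdSimplex h.numRounds_pos (fun t ht => hrun.ce_strat_mem h ht ω)
    fun i => by linarith [h.card_mul_thr_le i], fun i φ => ?_⟩
  set gain : Profile k → ℝ := fun x => u i (Function.update x i (φ (x i))) - u i x with hgain
  have hgain_abs (x : Profile k) : |gain x| ≤ 1 := by
    simpa only [sub_zero] using abs_sub_le_of_le_of_le (hu i (Function.update x i (φ (x i)))).1
      (hu i (Function.update x i (φ (x i)))).2 (hu i x).1 (hu i x).2
  have hround (t : ℕ) (ht : t ∈ Finset.range (numRounds k ε Δ δ)) :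
      jointMean (fun j => clip (thr k ε Δ) (I.strat (elimLength u Δ + t) ω j)) gain ≤
        (∑ c, I.strat (elimLength u Δ + t) ω i c * (I.avg (elimLength u Δ + t) ω i (φ c) -
          I.avg (elimLength u Δ + t) ω i c)) + swapError I u (elimLength u Δ + t) ω i φ +
            ε / 4 := by
    rw [← jointMean_swap_gain_eq]
    refine (jointMean_clip_le (hrun.ce_strat_mem h (Finset.mem_range.1 ht) ω) h.thr_pos.le
      (by linarith [h.ε_le]) hgain_abs).trans ?_
    gcongr
    linarith
  have htotal := Finset.sum_le_sum hround
  simp only [Finset.sum_add_distrib, Finset.sum_const, Finset.card_range, nsmul_eq_mul] at htotal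
  have hmean : ∑ x, ceOutput (thr k ε Δ) (numRounds k ε Δ δ)
      (fun t => I.strat (elimLength u Δ + t) ω) x * gain x ≤ ε := by
    have hεT := mul_nonneg h.ε_pos.le hT.le
    rw [sum_ceOutput_mul, div_le_iff₀ hT]
    linarith [hrun.estimated_swap_regret_le h hI ω i φ, hacc i φ]
  simp only [hgain, mul_sub, Finset.sum_sub_distrib] at hmean
  linarith

end Equilibrium

/-! ### Probability of accurate estimates -/

section Peeling

variable {Z Q S Δ l : ℝ}

theorem le_mul_of_slope_bound (hΔ : 0 < Δ) (hl : 0 < l) (hS : 0 < S)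
    (hQ : Q ≤ S ^ 2 * Δ ^ 2 / (256 * l)) {y : ℝ} (hy : y ∈ Set.Icc (1 : ℝ) 4)
    (hslope : 12 * l * y / (Δ * S) * Z - (12 * l * y / (Δ * S)) ^ 2 * Q < 2 * l) :
    Z ≤ Δ / 4 * S := by
  have hy0 : 0 < y := one_pos.trans_le hy.1
  have hvariance : (12 * l * y / (Δ * S)) ^ 2 * Q ≤ 9 / 16 * l * y ^ 2 := by
    refine (mul_le_mul_of_nonneg_left hQ (sq_nonneg _)).trans_eq ?_
    field_simp
    norm_num
  by_contra! hlarge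
  have hlinear : 3 * l * y < 12 * l * y / (Δ * S) * Z := by
    calc 3 * l * y = 12 * l * y / (Δ * S) * (Δ / 4 * S) := by field_simp; norm_num
      _ < _ := by gcongr
  have hquadratic : l * (3 * y) < l * (2 + 9 / 16 * y ^ 2) := by linarith
  nlinarith [lt_of_mul_lt_mul_left hquadratic hl.le,
    mul_nonneg (sub_nonneg.2 hy.1) (sub_nonneg.2 hy.2)]

/-- In an exponential tail bound the slope has to be fixed in advance, while the best one, of order
`l / (Δ * S)`, depends on the random `S`. Since `S` lies in `[p, T]`, one of the slopes
`12 * l * 4 ^ j / (Δ * T)` with `j < n` is within a factor `4` of the best one. -/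
theorem le_mul_of_forall_slope_bound {p T : ℝ} {n : ℕ} (hΔ : 0 < Δ) (hl : 0 < l) (hp : 0 < p)
    (hS : S ∈ Set.Icc p T) (hn : T / p < 4 ^ (n - 1)) (hQ : Q ≤ S ^ 2 * Δ ^ 2 / (256 * l))
    (hslope : ∀ j < n, 12 * l * 4 ^ j / (Δ * T) * Z - (12 * l * 4 ^ j / (Δ * T)) ^ 2 * Q < 2 * l) :
    Z ≤ Δ / 4 * S := by
  have hS0 : 0 < S := hp.trans_le hS.1
  have hT : 0 < T := hS0.trans_le hS.2
  obtain ⟨m, hle, hlt⟩ := exists_nat_pow_near ((one_le_div hS0).2 hS.2) (by norm_num : (1 : ℝ) < 4)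
  have hm : m < n - 1 := (pow_lt_pow_iff_right₀ (by norm_num : (1 : ℝ) < 4)).1
    ((hle.trans (div_le_div_of_nonneg_left hT.le hp hS.1)).trans_lt hn)
  refine le_mul_of_slope_bound hΔ hl hS0 hQ (y := 4 ^ (m + 1) * S / T) ⟨?_, ?_⟩ ?_
  · exact (one_le_div hT).2 ((div_lt_iff₀ hS0).1 hlt).le
  · rw [div_le_iff₀ hT, pow_succ]
    linarith [(le_div_iff₀ hS0).1 hle]
  · have hgrid : 12 * l * (4 ^ (m + 1) * S / T) / (Δ * S) = 12 * l * 4 ^ (m + 1) / (Δ * T) := by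
      field_simp
    rw [hgrid]
    exact hslope (m + 1) (by lia)

end Peeling

section Budget

variable {N : ℕ} {k : Fin N → ℕ} {ε Δ δ : ℝ}

theorem Admissible.numRounds_div_thr_lt_sq (h : Admissible k ε Δ δ) :
    (numRounds k ε Δ δ : ℝ) / thr k ε Δ < (N * numRounds k ε Δ δ) ^ 2 := by
  have hN := h.one_le_N
  have hA := h.one_le_maxActions
  have hΔ := h.Δ_pos
  have hT : (0 : ℝ) < numRounds k ε Δ δ := Nat.cast_pos.2 h.numRounds_pos
  have hratio : 8 * (maxActions k / min ε Δ) < numRounds k ε Δ δ := by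
    have hmin : ε * Δ ≤ min ε Δ :=
      le_min (mul_le_of_le_one_right h.ε_pos.le h.Δ_le) (mul_le_of_le_one_left hΔ.le h.ε_le)
    have hΛ := one_le_pow₀ h.one_le_logFactor (n := 2)
    have hbudget := h.maxActions_mul_sq_logFactor_div_le
    rw [mul_div_assoc', div_le_iff₀ hΔ] at hbudget
    rw [mul_div_assoc', div_lt_iff₀ h.min_pos]
    nlinarith [mul_le_mul_of_nonneg_right hmin hT.le]
  have hthr : (numRounds k ε Δ δ : ℝ) / thr k ε Δ =
      N * numRounds k ε Δ δ * (8 * (maxActions k / min ε Δ)) := by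
    unfold thr
    field_simp
  rw [hthr, sq]
  exact mul_lt_mul_of_pos_left (hratio.trans_le (le_mul_of_one_le_left hT.le hN)) (by positivity)

theorem Admissible.numRounds_div_thr_lt_pow (h : Admissible k ε Δ δ) :
    (numRounds k ε Δ δ : ℝ) / thr k ε Δ < 4 ^ (N * numRounds k ε Δ δ - 1) := by
  have hpos : 0 < N * numRounds k ε Δ δ := Nat.mul_pos h.N_pos h.numRounds_pos
  have hle : N * numRounds k ε Δ δ ≤ 2 ^ (N * numRounds k ε Δ δ - 1) := by
    have hlt := (N * numRounds k ε Δ δ - 1).lt_two_pow_self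
    lia
  refine h.numRounds_div_thr_lt_sq.trans_le ?_
  rw [show (4 : ℝ) = 2 ^ 2 by norm_num, pow_right_comm]
  gcongr
  exact_mod_cast hle

theorem Admissible.log_card_swaps_le (h : Admissible k ε Δ δ) :
    Real.log (N * (maxActions k : ℝ) ^ maxActions k / δ) ≤ maxActions k * logFactor k ε Δ δ := by
  have hN := h.one_le_N
  have hA := h.one_le_maxActions
  have hδ := h.δ_pos
  have hNδ : 1 ≤ (N : ℝ) / δ := (one_le_div hδ).2 (h.δ_lt.le.trans hN)
  have hle : N * (maxActions k : ℝ) ^ maxActions k / δ ≤ (N * maxActions k / δ) ^ maxActions k := by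
    rw [mul_div_right_comm, mul_div_right_comm, mul_pow]
    gcongr
    exact le_self_pow₀ hNδ (Nat.pos_iff_ne_zero.1 (Nat.one_le_cast.1 hA))
  calc Real.log (N * (maxActions k : ℝ) ^ maxActions k / δ)
      ≤ Real.log ((N * maxActions k / δ) ^ maxActions k) := Real.log_le_log (by positivity) hle
    _ = maxActions k * Real.log (N * maxActions k / δ) := Real.log_pow _ _
    _ ≤ maxActions k * logFactor k ε Δ δ := by
        gcongr
        exact h.log_div_le

end Budget

section Probability

variable {N : ℕ} {k : Fin N → ℕ} {Ω : Type*} [MeasurableSpace Ω] {u : Fin N → Profile k → ℝ}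
  {ε Δ δ : ℝ} {T : ℕ} {I : Interaction k Ω} {br : ℕ → Ω → Profile k} {μ : Measure Ω}

theorem measureReal_iUnion_le_mul {ι : Type*} [Fintype ι] (s : ι → Set Ω) {c C : ℝ} (hc : 0 ≤ c)
    (hcard : Fintype.card ι ≤ C) (hs : ∀ i, μ.real (s i) ≤ c) : μ.real (⋃ i, s i) ≤ C * c := by
  refine ((measureReal_iUnion_fintype_le s).trans
    (Finset.sum_le_card_nsmul _ _ _ fun i _ => hs i)).trans ?_
  rw [nsmul_eq_mul]
  exact mul_le_mul_of_nonneg_right hcard hc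

theorem card_fin_le_maxActions (k : Fin N → ℕ) (i : Fin N) :
    (Fintype.card (Fin (k i)) : ℝ) ≤ maxActions k := by
  exact_mod_cast (Fintype.card_fin (k i)).trans_le (le_maxActions k i)

theorem card_swaps_le (hA : 0 < maxActions k) (i : Fin N) :
    (Fintype.card (Fin (k i) → Fin (k i)) : ℝ) ≤ (maxActions k : ℝ) ^ maxActions k := by
  have hk := le_maxActions k i
  have hle : k i ^ k i ≤ maxActions k ^ maxActions k :=
    (Nat.pow_le_pow_left hk _).trans (Nat.pow_le_pow_right hA hk)
  simpa only [Fintype.card_fun, Fintype.card_fin] using mod_cast hle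

theorem dominanceError_eq (I : Interaction k Ω) (u : Fin N → Profile k → ℝ) (Δ : ℝ) (l r : ℕ)
    (ω : Ω) (i : Fin N) (a : Fin (k i)) :
    dominanceError I u Δ l r ω i a =
      ∑ c, ((Pi.single a 1 : Fin (k i) → ℝ) c - dominator u Δ l i a c) * I.noise u r ω i c := by
  simp [dominanceError, sub_mul, Finset.sum_sub_distrib, Pi.single_apply]

theorem swapError_eq (I : Interaction k Ω) (u : Fin N → Profile k → ℝ) (r : ℕ) (ω : Ω)
    (i : Fin N) (φ : Fin (k i) → Fin (k i)) :
    swapError I u r ω i φ = ∑ c, (I.strat r ω i c -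
      FunOnFinite.linearMap ℝ ℝ φ (I.strat r ω i) c) * I.noise u r ω i c := by
  simp only [swapError, mul_sub, sub_mul, Finset.sum_sub_distrib, sum_linearMap_mul]

namespace IsAdaptiveHedgeRun

theorem measureReal_not_ibrAccurate_le [IsProbabilityMeasure μ]
    (hrun : IsAdaptiveHedgeRun u ε Δ δ T I br) (h : Admissible k ε Δ δ)
    (hu : ∀ i x, u i x ∈ Set.Icc (0 : ℝ) 1) (hI : I.IsBandit u μ (elimLength u Δ + T)) :
    μ.real {ω | ¬ IBRAccurate I u Δ ω} ≤ δ := by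
  have hδ := h.δ_pos
  have hN := h.one_le_N
  have hA := h.one_le_maxActions
  have hevent : {ω | ¬ IBRAccurate I u Δ ω} =
      ⋃ r : Fin (elimLength u Δ), ⋃ i, ⋃ a, {ω | Δ ≤ dominanceError I u Δ r r ω i a} := by
    ext ω
    simp [IBRAccurate, Fin.exists_iff]
  rw [hevent]
  have hunion : μ.real (⋃ r : Fin (elimLength u Δ), ⋃ i, ⋃ a,
      {ω | Δ ≤ dominanceError I u Δ r r ω i a}) ≤
      elimLength u Δ * (N * (maxActions k * (δ / (elimLength u Δ * N * maxActions k)))) := by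
    refine measureReal_iUnion_le_mul _ (by positivity) (by simp) fun r => ?_
    refine measureReal_iUnion_le_mul _ (by positivity) (by simp) fun i => ?_
    refine measureReal_iUnion_le_mul _ (by positivity) (card_fin_le_maxActions k i) fun a => ?_
    simp only [dominanceError_eq]
    exact hrun.ibr_tail_bound h hI r.2 (hu i) (single_mem_stdSimplex ℝ a)
      (dominator_mem_stdSimplex u Δ r i a)
  refine hunion.trans ?_
  rcases (elimLength u Δ).eq_zero_or_pos with hzero | hpos
  · simpa [hzero] using hδ.le
  · exact le_of_eq (by field_simp)

theorem expert_tail_bound [IsProbabilityMeasure μ] (hrun : IsAdaptiveHedgeRun u ε Δ δ T I br)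
    (h : Admissible k ε Δ δ) (hu : ∀ i x, u i x ∈ Set.Icc (0 : ℝ) 1)
    (hI : I.IsBandit u μ (elimLength u Δ + T)) {t : ℕ} (ht : t < T) {i : Fin N} (a b : Fin (k i))
    (s z : ℝ) :
    μ.real {ω | z ≤ s * (∑ τ ∈ Finset.range (t + 1), I.strat (elimLength u Δ + τ) ω i b *
          dominanceError I u Δ (elimLength u Δ) (elimLength u Δ + τ) ω i a) -
        s ^ 2 * ∑ τ ∈ Finset.range (t + 1), I.strat (elimLength u Δ + τ) ω i b ^ 2 /
          (4 * I.batch (elimLength u Δ + τ) ω i)} ≤ Real.exp (-z) := by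
  have htail := hrun.ce_tail_bound h hI (hu i) (n := t + 1) ht
    (s := fun r ω => s * I.strat r ω i b) (x := fun _ _ => Pi.single a 1)
    (y := fun _ _ => dominator u Δ (elimLength u Δ) i a) (B := |s|)
    (fun r hr => (hI.strat_meas r hr i b).const_mul s)
    (fun _ _ _ => measurable_const) (fun _ _ _ => measurable_const)
    (fun r hr ω => by
      have hmem := mem_Icc_of_mem_stdSimplex (hrun.strat_mem h hr ω i) b
      rw [abs_mul, abs_of_nonneg hmem.1]
      exact mul_le_of_le_one_right (abs_nonneg s) hmem.2)
    (fun _ _ _ => single_mem_stdSimplex ℝ a)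
    (fun _ _ _ => dominator_mem_stdSimplex u Δ (elimLength u Δ) i a) z
  simpa only [dominanceError_eq, Finset.mul_sum, ← Finset.sum_sub_distrib, mul_assoc, mul_pow,
    mul_div_assoc] using htail

theorem expert_variance_le (hrun : IsAdaptiveHedgeRun u ε Δ δ T I br) (h : Admissible k ε Δ δ)
    {t : ℕ} (ht : t < T) (ω : Ω) (i : Fin N) (b : Fin (k i)) :
    ∑ τ ∈ Finset.range (t + 1), I.strat (elimLength u Δ + τ) ω i b ^ 2 /
        (4 * (I.batch (elimLength u Δ + τ) ω i : ℝ)) ≤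
      cumWeight (fun τ => I.strat (elimLength u Δ + τ) ω) t i b ^ 2 * Δ ^ 2 /
        (256 * Real.log (maxActions k * N * T / δ)) := by
  have hΔ := h.Δ_pos
  have hl := h.log_batch_arg_pos (T := T) (by lia)
  set l := Real.log (maxActions k * N * T / δ)
  set θ : ℕ → Weights k := fun τ => I.strat (elimLength u Δ + τ) ω
  have hpos : ∀ τ ≤ t, 0 < θ τ i b := fun τ hτ => hrun.ce_strat_pos h (by lia) ω i b
  have hterm : ∀ τ ∈ Finset.range (t + 1), θ τ i b ^ 2 /
      (4 * (I.batch (elimLength u Δ + τ) ω i : ℝ)) ≤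
        θ τ i b * (cumWeight θ t i b * Δ ^ 2 / (256 * l)) := by
    intro τ hτ
    have hτt : τ ≤ t := Finset.mem_range_succ_iff.1 hτ
    have hθ_pos := hpos τ hτt
    have hbatch : (0 : ℝ) < I.batch (elimLength u Δ + τ) ω i :=
      Nat.cast_pos.2 (hrun.ce_batch_pos h (by lia) ω i)
    have hcum_pos : 0 < cumWeight θ τ i b := cumWeight_pos fun σ hσ => hpos σ (by lia)
    have hcum_mono : cumWeight θ τ i b ≤ cumWeight θ t i b :=
      Finset.sum_le_sum_of_subset_of_nonneg (Finset.range_subset_range.2 (by lia))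
        fun σ hσ _ => (hpos σ (Finset.mem_range_succ_iff.1 hσ)).le
    have hceil := le_ceBatch (Δ := Δ) (δ := δ) (T := T) θ τ i b
    rw [← hrun.ce_batch τ (by lia) ω i, div_le_iff₀ (by positivity)] at hceil
    have hratio : 64 * l * θ τ i b ≤ I.batch (elimLength u Δ + τ) ω i *
        (Δ ^ 2 * cumWeight θ t i b) := hceil.trans (by gcongr)
    rw [mul_div_assoc', div_le_div_iff₀ (by positivity) (by positivity)]
    linarith [mul_le_mul_of_nonneg_left hratio (mul_pos four_pos hθ_pos).le]
  refine (Finset.sum_le_sum hterm).trans_eq ?_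
  rw [← Finset.sum_mul, ← cumWeight]
  ring

theorem cumWeight_mem_Icc (hrun : IsAdaptiveHedgeRun u ε Δ δ T I br) (h : Admissible k ε Δ δ)
    {t : ℕ} (ht : t < T) (ω : Ω) (i : Fin N) (b : Fin (k i)) :
    cumWeight (fun τ => I.strat (elimLength u Δ + τ) ω) t i b ∈ Set.Icc (thr k ε Δ) (T : ℝ) := by
  have hmem : ∀ τ ≤ t, I.strat (elimLength u Δ + τ) ω i b ∈ Set.Icc (0 : ℝ) 1 := fun τ hτ =>
    mem_Icc_of_mem_stdSimplex (hrun.ce_strat_mem h (by lia) ω i) b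
  constructor
  · exact (hrun.thr_le_strat_init h ω i b).trans (le_cumWeight
      (θ := fun τ => I.strat (elimLength u Δ + τ) ω)
      (fun τ hτ => hrun.ce_strat_pos h (by lia) ω i b) t.zero_le)
  · have hsum := Finset.sum_le_card_nsmul (Finset.range (t + 1))
      (fun τ => I.strat (elimLength u Δ + τ) ω i b) 1
      fun τ hτ => (hmem τ (Finset.mem_range_succ_iff.1 hτ)).2
    rw [Finset.card_range, nsmul_eq_mul, mul_one] at hsum
    exact hsum.trans (Nat.cast_le.2 ht)

theorem expertAccurate_of_slope_bound (hrun : IsAdaptiveHedgeRun u ε Δ δ T I br)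
    (h : Admissible k ε Δ δ) {n : ℕ} (hn : T / thr k ε Δ < 4 ^ (n - 1)) {ω : Ω}
    (hslope : ∀ t < T, ∀ i a b, ∀ j < n,
      12 * Real.log (maxActions k * N * T / δ) * 4 ^ j / (Δ * T) *
          (∑ τ ∈ Finset.range (t + 1), I.strat (elimLength u Δ + τ) ω i b *
            dominanceError I u Δ (elimLength u Δ) (elimLength u Δ + τ) ω i a) -
        (12 * Real.log (maxActions k * N * T / δ) * 4 ^ j / (Δ * T)) ^ 2 *
          ∑ τ ∈ Finset.range (t + 1), I.strat (elimLength u Δ + τ) ω i b ^ 2 /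
            (4 * I.batch (elimLength u Δ + τ) ω i) < 2 * Real.log (maxActions k * N * T / δ)) :
    ExpertAccurate I u Δ T ω := fun t ht i a b =>
  le_mul_of_forall_slope_bound h.Δ_pos (h.log_batch_arg_pos (by lia)) h.thr_pos
    (hrun.cumWeight_mem_Icc h ht ω i b) hn (hrun.expert_variance_le h ht ω i b)
    (hslope t ht i a b)

theorem measureReal_not_expertAccurate_le [IsProbabilityMeasure μ]
    (hrun : IsAdaptiveHedgeRun u ε Δ δ (numRounds k ε Δ δ) I br) (h : Admissible k ε Δ δ)
    (hu : ∀ i x, u i x ∈ Set.Icc (0 : ℝ) 1)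
    (hI : I.IsBandit u μ (elimLength u Δ + numRounds k ε Δ δ)) :
    μ.real {ω | ¬ ExpertAccurate I u Δ (numRounds k ε Δ δ) ω} ≤ δ := by
  have hδ := h.δ_pos
  have hN := h.one_le_N
  have hA := h.one_le_maxActions
  have hT : (0 : ℝ) < numRounds k ε Δ δ := Nat.cast_pos.2 h.numRounds_pos
  set T := numRounds k ε Δ δ
  set l := Real.log (maxActions k * N * T / δ)
  let deviates (t : ℕ) (i : Fin N) (a b : Fin (k i)) (s : ℝ) : Set Ω :=
    {ω | 2 * l ≤ s * (∑ τ ∈ Finset.range (t + 1), I.strat (elimLength u Δ + τ) ω i b *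
        dominanceError I u Δ (elimLength u Δ) (elimLength u Δ + τ) ω i a) -
      s ^ 2 * ∑ τ ∈ Finset.range (t + 1), I.strat (elimLength u Δ + τ) ω i b ^ 2 /
        (4 * I.batch (elimLength u Δ + τ) ω i)}
  have hcover : {ω | ¬ ExpertAccurate I u Δ T ω} ⊆ ⋃ t : Fin T, ⋃ i, ⋃ a, ⋃ b,
      ⋃ j : Fin (N * T), deviates t i a b (12 * l * 4 ^ (j : ℕ) / (Δ * T)) := by
    intro ω hω
    contrapose! hω
    simp only [deviates, Set.mem_iUnion, Set.mem_ofPred_eq, not_exists, not_le] at hω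
    exact not_not.2 (hrun.expertAccurate_of_slope_bound h h.numRounds_div_thr_lt_pow
      fun t ht i a b j hj => hω ⟨t, ht⟩ i a b ⟨j, hj⟩)
  have hunion : μ.real (⋃ t : Fin T, ⋃ i, ⋃ a, ⋃ b, ⋃ j : Fin (N * T),
      deviates t i a b (12 * l * 4 ^ (j : ℕ) / (Δ * T))) ≤
        T * (N * (maxActions k * (maxActions k * (N * T * Real.exp (-(2 * l)))))) := by
    refine measureReal_iUnion_le_mul _ (by positivity) (by simp) fun t => ?_
    refine measureReal_iUnion_le_mul _ (by positivity) (by simp) fun i => ?_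
    refine measureReal_iUnion_le_mul _ (by positivity) (card_fin_le_maxActions k i) fun a => ?_
    refine measureReal_iUnion_le_mul _ (by positivity) (card_fin_le_maxActions k i) fun b => ?_
    refine measureReal_iUnion_le_mul _ (by positivity) (by simp) fun j => ?_
    exact hrun.expert_tail_bound h hu hI t.2 a b _ _
  have hexp : Real.exp (-(2 * l)) = (δ / (maxActions k * N * T)) ^ 2 := by
    rw [two_mul, neg_add, Real.exp_add, ← sq, Real.exp_neg, Real.exp_log (by positivity), inv_div]
  calc μ.real {ω | ¬ ExpertAccurate I u Δ T ω}
      ≤ T * (N * (maxActions k * (maxActions k * (N * T * Real.exp (-(2 * l)))))) :=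
        (measureReal_mono hcover).trans hunion
    _ = δ ^ 2 := by rw [hexp]; field_simp
    _ ≤ δ := pow_le_of_le_one hδ.le h.δ_lt.le two_ne_zero

theorem swap_tail_bound [IsProbabilityMeasure μ] (hrun : IsAdaptiveHedgeRun u ε Δ δ T I br)
    (h : Admissible k ε Δ δ) (hu : ∀ i x, u i x ∈ Set.Icc (0 : ℝ) 1)
    (hI : I.IsBandit u μ (elimLength u Δ + T)) {i : Fin N} (φ : Fin (k i) → Fin (k i)) (s z : ℝ) :
    μ.real {ω | z ≤ s * (∑ t ∈ Finset.range T, swapError I u (elimLength u Δ + t) ω i φ) -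
      s ^ 2 / 4 * T} ≤ Real.exp (-z) := by
  have htail := hrun.ce_tail_bound h hI (hu i) le_rfl (s := fun _ _ => s)
    (x := fun r ω => I.strat r ω i)
    (y := fun r ω => FunOnFinite.linearMap ℝ ℝ φ (I.strat r ω i)) (B := |s|)
    (fun _ _ => measurable_const) (fun r hr c => hI.strat_meas r hr i c)
    (fun r hr c => by
      simp only [FunOnFinite.linearMap_apply_apply]
      exact Finset.measurable_fun_sum _ fun b _ => hI.strat_meas r hr i b)
    (fun _ _ _ => le_rfl) (fun r hr ω => hrun.strat_mem h hr ω i)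
    (fun r hr ω => stdSimplex.image_linearMap φ ⟨_, hrun.strat_mem h hr ω i, rfl⟩) z
  simp only [← swapError_eq] at htail
  refine (measureReal_mono fun ω hω => ?_).trans htail
  have hvariance : ∑ t ∈ Finset.range T, s ^ 2 / (4 * (I.batch (elimLength u Δ + t) ω i : ℝ)) ≤
      s ^ 2 / 4 * T := by
    refine (Finset.sum_le_sum fun t ht => ?_).trans_eq
      (by rw [Finset.sum_const, Finset.card_range, nsmul_eq_mul, mul_comm])
    have hbatch : (1 : ℝ) ≤ I.batch (elimLength u Δ + t) ω i :=
      Nat.one_le_cast.2 (hrun.ce_batch_pos h (Finset.mem_range.1 ht) ω i)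
    gcongr
    linarith
  rw [Set.mem_ofPred_eq] at hω ⊢
  rw [Finset.sum_sub_distrib, ← Finset.mul_sum]
  linarith

theorem measureReal_not_swapAccurate_le [IsProbabilityMeasure μ]
    (hrun : IsAdaptiveHedgeRun u ε Δ δ (numRounds k ε Δ δ) I br) (h : Admissible k ε Δ δ)
    (hu : ∀ i x, u i x ∈ Set.Icc (0 : ℝ) 1)
    (hI : I.IsBandit u μ (elimLength u Δ + numRounds k ε Δ δ)) :
    μ.real {ω | ¬ SwapAccurate I u ε Δ (numRounds k ε Δ δ) ω} ≤ δ := by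
  have hδ := h.δ_pos
  have hN := h.one_le_N
  have hA := h.one_le_maxActions
  set T := numRounds k ε Δ δ
  set z := Real.log (N * (maxActions k : ℝ) ^ maxActions k / δ) with hz
  have hz_le : 16 * z ≤ ε ^ 2 * T := by
    have hΛ := le_self_pow₀ h.one_le_logFactor two_ne_zero
    have hswaps := h.log_card_swaps_le
    nlinarith [h.maxActions_mul_sq_logFactor_le, h.one_le_logFactor]
  have hcover : {ω | ¬ SwapAccurate I u ε Δ T ω} ⊆ ⋃ i, ⋃ φ : Fin (k i) → Fin (k i),
      {ω | z ≤ ε / 2 * (∑ t ∈ Finset.range T, swapError I u (elimLength u Δ + t) ω i φ) -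
        (ε / 2) ^ 2 / 4 * T} := by
    intro ω hω
    simp only [SwapAccurate, Set.mem_ofPred_eq, not_forall, not_le] at hω
    obtain ⟨i, φ, hlarge⟩ := hω
    simp only [Set.mem_iUnion, Set.mem_ofPred_eq]
    exact ⟨i, φ, by linarith [mul_lt_mul_of_pos_left hlarge (half_pos h.ε_pos)]⟩
  have hunion : μ.real (⋃ i, ⋃ φ : Fin (k i) → Fin (k i),
      {ω | z ≤ ε / 2 * (∑ t ∈ Finset.range T, swapError I u (elimLength u Δ + t) ω i φ) -
        (ε / 2) ^ 2 / 4 * T}) ≤ N * ((maxActions k : ℝ) ^ maxActions k * Real.exp (-z)) := by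
    refine measureReal_iUnion_le_mul _ (by positivity) (by simp) fun i => ?_
    refine measureReal_iUnion_le_mul _ (by positivity)
      (card_swaps_le (Nat.one_le_cast.1 hA) i) fun φ => ?_
    exact hrun.swap_tail_bound h hu hI φ _ z
  refine ((measureReal_mono hcover).trans hunion).trans_eq ?_
  rw [hz, Real.exp_neg, Real.exp_log (by positivity), inv_div]
  field_simp

theorem isRationalizableCE_ceOutput (hrun : IsAdaptiveHedgeRun u ε Δ δ (numRounds k ε Δ δ) I br)
    (h : Admissible k ε Δ δ) (hu : ∀ i x, u i x ∈ Set.Icc (0 : ℝ) 1)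
    (hI : I.IsBandit u μ (elimLength u Δ + numRounds k ε Δ δ)) {ω : Ω}
    (hibr : IBRAccurate I u Δ ω) (hexpert : ExpertAccurate I u Δ (numRounds k ε Δ δ) ω)
    (hswap : SwapAccurate I u ε Δ (numRounds k ε Δ δ) ω) :
    IsRationalizableCE u ε Δ (ceOutput (thr k ε Δ) (numRounds k ε Δ δ)
      fun t => I.strat (elimLength u Δ + t) ω) := by
  refine ⟨hrun.isApproxCE_ceOutput h hu hI hswap, fun x hx i hmem => hx ?_⟩
  rw [ceOutput, Finset.sum_eq_zero, zero_div]
  refine fun t ht => Finset.prod_eq_zero (Finset.mem_univ i) (by_contra fun hne => ?_)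
  exact (lt_of_clip_ne_zero hne).not_ge
    (hrun.ce_strat_le_thr h hu hibr hexpert t (Finset.mem_range.1 ht) i (x i) hmem)

theorem one_sub_le_measureReal_isRationalizableCE [IsProbabilityMeasure μ]
    (hrun : IsAdaptiveHedgeRun u ε Δ δ (numRounds k ε Δ δ) I br) (h : Admissible k ε Δ δ)
    (hu : ∀ i x, u i x ∈ Set.Icc (0 : ℝ) 1)
    (hI : I.IsBandit u μ (elimLength u Δ + numRounds k ε Δ δ)) :
    1 - 3 * δ ≤ μ.real {ω | IsRationalizableCE u ε Δ (ceOutput (thr k ε Δ) (numRounds k ε Δ δ)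
      fun t => I.strat (elimLength u Δ + t) ω)} := by
  set good : Set Ω := {ω | IsRationalizableCE u ε Δ (ceOutput (thr k ε Δ) (numRounds k ε Δ δ)
    fun t => I.strat (elimLength u Δ + t) ω)}
  have hcover : goodᶜ ⊆ {ω | ¬ IBRAccurate I u Δ ω} ∪
      ({ω | ¬ ExpertAccurate I u Δ (numRounds k ε Δ δ) ω} ∪
        {ω | ¬ SwapAccurate I u ε Δ (numRounds k ε Δ δ) ω}) := by
    intro ω hω
    contrapose! hω
    simp only [Set.mem_union, Set.mem_ofPred_eq, not_or, not_not] at hω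
    exact Set.notMem_compl_iff.2 (hrun.isRationalizableCE_ceOutput h hu hI hω.1 hω.2.1 hω.2.2)
  have hcompl : μ.real goodᶜ ≤ δ + (δ + δ) :=
    (measureReal_mono hcover).trans <| (measureReal_union_le _ _).trans <|
      add_le_add (hrun.measureReal_not_ibrAccurate_le h hu hI) <|
        (measureReal_union_le _ _).trans <|
          add_le_add (hrun.measureReal_not_expertAccurate_le h hu hI)
            (hrun.measureReal_not_swapAccurate_le h hu hI)
  have hunion := measureReal_union_le (μ := μ) good goodᶜ
  rw [Set.union_compl_self, probReal_univ] at hunion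
  linarith

end IsAdaptiveHedgeRun

end Probability

end RatCE

theorem mainTheorem2 :
    ∃ (C₁ C₂ : ℝ) (κ₁ κ₂ : ℕ), 0 < C₁ ∧ 0 < C₂ ∧
      ∀ (N : ℕ) (k : Fin N → ℕ) (u : Fin N → Profile k → ℝ) (ε Δ δ : ℝ),
        0 < N → (∀ i, 0 < k i) → (∀ i x, u i x ∈ Set.Icc (0 : ℝ) 1) →
        0 < ε → ε ≤ 1 → 0 < Δ → Δ ≤ 1 → 0 < δ → δ < 1 →
        ∀ (Ω : Type*) [MeasurableSpace Ω] (μ : Measure Ω) [IsProbabilityMeasure μ]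
          (I : Interaction k Ω) (br : ℕ → Ω → Profile k),
          I.IsBandit u μ (elimLength u Δ + ceRounds C₁ κ₁ k ε Δ δ) →
          IsAdaptiveHedgeRun u ε Δ δ (ceRounds C₁ κ₁ k ε Δ δ) I br →
          1 - 3 * δ ≤ μ.real {ω | IsRationalizableCE u ε Δ
            (ceOutput (thr k ε Δ) (ceRounds C₁ κ₁ k ε Δ δ)
              (fun t => I.strat (elimLength u Δ + t) ω))} ∧
          ∀ ω, (I.samples (elimLength u Δ + ceRounds C₁ κ₁ k ε Δ δ) ω : ℝ) ≤
            C₂ * (elimLength u Δ * N * maxActions k / Δ ^ 2 +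
              N * maxActions k ^ 2 / min (ε ^ 2) (Δ ^ 2)) * logFactor k ε Δ δ ^ κ₂ := by
  refine ⟨4096, 30000, 2, 2, by norm_num, by norm_num, ?_⟩
  intro N k u ε Δ δ hN hk hu hε hε1 hΔ hΔ1 hδ hδ1 Ω _ μ _ I br hI hrun
  have h : Admissible k ε Δ δ := ⟨hN, hk, hε, hε1, hΔ, hΔ1, hδ, hδ1⟩
  exact ⟨hrun.one_sub_le_measureReal_isRationalizableCE h hu hI, fun ω => hrun.samples_le h ω⟩
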